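/- Let $M$ be an oriented smooth $4$-manifold, let $\pi:N\to M$ be the bundle of Lorentzian metrics on $M$ (signature $(-,+,+,+)$) and let $\kappa:K=\mathbb R\times M\to M$ be the trivial line bundle, whose sections are scalar fields $\phi$. Positively oriented local coordinates $(x^\mu)$ on $M$ induce coordinates $(x^\mu,y_{\mu\nu},z_{\mu\nu\alpha},z_{\mu\nu\alpha\beta},z_{\mu\nu\alpha\beta\gamma})$ on the jet bundle $J^3(M,N)$ (the first entries being coordinates on $J^2(M,N)$) and $(x^\mu,t,z_\mu)$ on $J^1(M,K)$, such that at the jets of local sections $\sigma=(g_{\mu\nu})$ and $\phi$ one has $y_{\mu\nu}=g_{\mu\nu}$, $z_{\mu\nu\alpha}=g_{\mu\nu,\alpha}$, $z_{\mu\nu\alpha\beta}=g_{\mu\nu,\alpha\beta}$, $z_{\mu\nu\alpha\beta\gamma}=g_{\mu\nu,\alpha\beta\gamma}$, $t=\phi$, $z_\mu=\phi_{,\mu}$. Let $L$ be an invariant second-order Lagrangian, i.e. a smooth scalar density on $J^2(M,N)$: in each positively oriented coordinate system it is given by a smooth function $L(x,y,z)$ of the coordinates of $J^2(M,N)$, and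 $L(x',y',z')\det(\partial x'/\partial x)=L(x,y,z)$ for any two such systems. Let $V:\mathbb R\to\mathbb R$ be smooth, and let $L_{\rm matter}=(\tfrac12 g^{\mu\nu}z_\mu z_\nu+V(t))\sqrt{-\det g}$, where $g_{\mu\nu}=y_{\mu\nu}$. Write $d_4x=dx^1\wedge\dots\wedge dx^4$. For positively oriented coordinates $(x^\mu)$ on an open subset of $M$, there are functions $p^{\mu\nu\alpha\beta}$, $p^{\mu\nu\alpha}$ on $J^3(M,N)$ and $q^\mu$ on $J^3(M,N)\times_M J^1(M,K)$ (over the coordinate domain) such that for all local sections $\sigma=(g_{\mu\nu})$ of $N$ and $\phi$ of $K$ $$(j^3\sigma)^*p^{\mu\nu\alpha\beta}=(j^2\sigma)^*\frac{\partial L}{\partial z_{\mu\nu\alpha\beta}},\qquad (j^3\sigma)^*p^{\mu\nu\alpha}=(j^2\sigma)^*\frac{\partial L}{\partial z_{\mu\nu\alpha}}-\frac{\partial}{\partial x^\beta}\Big((j^2\sigma)^*\frac{\partial L}{\partial z_{\mu\nu\alpha\beta}}\Big),$$ $$(j^3\sigma,j^1\phi)^*q^\mu=g^{\mu\nu}\phi_{,\nu}\sqrt{-\det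 g}$$ (partial derivatives with respect to symmetric arrays are symmetric in the corresponding indices, and normalized so that $dL$ is obtained by summing over all values of all indices). The $4$-form $$\Theta_{\rm total}=L\,d_4x+p^{\mu\nu\alpha\beta}(dz_{\mu\nu\alpha}-z_{\mu\nu\alpha\gamma}dx^\gamma)\wedge(\partial_\beta\lrcorner d_4x)+p^{\mu\nu\alpha}(dy_{\mu\nu}-z_{\mu\nu\beta}dx^\beta)\wedge(\partial_\alpha\lrcorner d_4x)+L_{\rm matter}\,d_4x+q^\mu(dt-z_\nu dx^\nu)\wedge(\partial_\mu\lrcorner d_4x)$$ does not depend on the choice of positively oriented coordinates: the forms obtained from any two such coordinate systems agree over the intersection of their domains. Hence there is a unique smooth global $4$-form $\Theta_{\rm total}$ on $J^3(M,N)\times_M J^1(M,K)$ which has this expression in all positively oriented coordinates. -/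

import Mathlib

open Set Filter Topology
open scoped Manifold ContDiff

noncomputable section

/-! ## Oriented smooth four-manifolds -/

/-- The coordinate space `ℝ⁴`. -/
abbrev E4 : Type := EuclideanSpace ℝ (Fin 4)

/-- The coordinate vector `∂_μ` of `ℝ⁴`. -/
def bvec (μ : Fin 4) : E4 := EuclideanSpace.single μ (1 : ℝ)

/-- Smooth maps between open subsets of `ℝ⁴` with positive Jacobian determinant. -/
def orientedPregroupoid : Pregroupoid E4 where
  property f s := ContDiffOn ℝ ∞ f s ∧ ∀ x ∈ s, 0 < (fderiv ℝ f x).det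
  comp {f g u v} hf hg hu hv huv := by
    refine ⟨hg.1.comp (hf.1.mono inter_subset_left) fun x hx => hx.2, fun x hx => ?_⟩
    have h1 : DifferentiableAt ℝ f x :=
      (hf.1.contDiffAt (hu.mem_nhds hx.1)).differentiableAt (by simp)
    have h2 : DifferentiableAt ℝ g (f x) :=
      (hg.1.contDiffAt (hv.mem_nhds hx.2)).differentiableAt (by simp)
    rw [fderiv_comp x h2 h1]
    have : ((fderiv ℝ g (f x)).comp (fderiv ℝ f x)).det
        = (fderiv ℝ g (f x)).det * (fderiv ℝ f x).det := by
      simp [ContinuousLinearMap.det, LinearMap.det_comp]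
    rw [this]
    exact mul_pos (hg.2 _ hx.2) (hf.2 _ hx.1)
  id_mem := by
    refine ⟨contDiff_id.contDiffOn, fun x _ => ?_⟩
    rw [fderiv_id]
    simp [ContinuousLinearMap.det]
  locality {f u} hu h := by
    refine ⟨fun x hx => ?_, fun x hx => ?_⟩
    · obtain ⟨v, hv, hxv, hf⟩ := h x hx
      exact ((hf.1.contDiffAt ((hu.inter hv).mem_nhds ⟨hx, hxv⟩))).contDiffWithinAt
    · obtain ⟨v, hv, hxv, hf⟩ := h x hx
      exact hf.2 x ⟨hx, hxv⟩
  congr {f g u} hu h hf := by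
    refine ⟨hf.1.congr h, fun x hx => ?_⟩
    have : g =ᶠ[𝓝 x] f := Filter.eventuallyEq_of_mem (hu.mem_nhds hx) h
    rw [this.fderiv_eq]
    exact hf.2 x hx

/-- The groupoid of orientation preserving smooth coordinate changes of `ℝ⁴`. A topological space
`M` with `[ChartedSpace E4 M] [HasGroupoid M orientedGroupoid]` is an oriented smooth
`4`-manifold, given by an oriented smooth atlas. -/
def orientedGroupoid : StructureGroupoid E4 := orientedPregroupoid.groupoid

section Manifold

variable (M : Type*) [TopologicalSpace M] [ChartedSpace E4 M]

/-- The positively oriented smooth coordinate systems `(x^μ)` on `M` (all of them, not only those of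
the given atlas). -/
def posAtlas : Set (OpenPartialHomeomorph M E4) := orientedGroupoid.maximalAtlas M

end Manifold

/-! ## Jet coordinates -/

/-- Arrays `z_{μν λ₁…λᵢ}`, written `z ![λ₁, …, λᵢ] μ ν`, which are symmetric in `μ, ν` and in
`λ₁, …, λᵢ`. -/
def JetArr (i : ℕ) : Submodule ℝ ((Fin i → Fin 4) → Fin 4 → Fin 4 → ℝ) where
  carrier := {z | (∀ l μ ν, z l μ ν = z l ν μ) ∧
    ∀ (l : Fin i → Fin 4) (τ : Equiv.Perm (Fin i)), z (l ∘ τ) = z l}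
  add_mem' {a b} ha hb := ⟨fun l μ ν => by simp [ha.1 l μ ν, hb.1 l μ ν],
    fun l τ => by simp [ha.2 l τ, hb.2 l τ]⟩
  zero_mem' := ⟨fun _ _ _ => rfl, fun _ _ => rfl⟩
  smul_mem' c {a} ha := ⟨fun l μ ν => by simp [ha.1 l μ ν], fun l τ => by simp [ha.2 l τ]⟩

/-- The symmetrization projection onto `JetArr i`. -/
def symArr (i : ℕ) : ((Fin i → Fin 4) → Fin 4 → Fin 4 → ℝ) →ₗ[ℝ] JetArr i where
  toFun z := ⟨fun l μ ν => ((i.factorial : ℝ))⁻¹ *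
      ∑ τ : Equiv.Perm (Fin i), (z (l ∘ τ) μ ν + z (l ∘ τ) ν μ) / 2, by
    refine ⟨fun l μ ν => by simp only [add_comm], fun l τ => ?_⟩
    funext μ ν
    refine congrArg (fun s : ℝ => ((i.factorial : ℝ))⁻¹ * s) ?_
    exact Fintype.sum_equiv (Equiv.mulLeft τ) _ _ fun σ => by
      simp [Function.comp_assoc, Equiv.Perm.coe_mul]⟩
  map_add' a b := by
    ext l μ ν
    simp only [Submodule.coe_add, Pi.add_apply, ← mul_add, ← Finset.sum_add_distrib]
    congr 1
    exact Finset.sum_congr rfl fun _ _ => by ring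
  map_smul' c a := by
    ext l μ ν
    simp only [Submodule.coe_smul, Pi.smul_apply, smul_eq_mul, RingHom.id_apply, Finset.mul_sum]
    exact Finset.sum_congr rfl fun _ _ => by ring

/-- The space of the coordinates `(x^μ, y_{μν}, z_{μνλ₁}, …, z_{μνλ₁…λₖ})` on `J^k(M,N)`; the `i`-th
entry of the second component is the array `z_{μνλ₁…λᵢ}`, and `y_{μν}` is its `0`-th entry. -/
abbrev JetCoord (k : ℕ) : Type := E4 × ((i : Fin (k + 1)) → JetArr i)

/-- The coordinate function `z_{μνλ₁…λᵢ}`, for `i ≤ k`. -/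
def zCoord {k : ℕ} (i : ℕ) (hi : i ≤ k) (l : Fin i → Fin 4) (μ ν : Fin 4) : JetCoord k →L[ℝ] ℝ :=
  (ContinuousLinearMap.proj (R := ℝ) (φ := fun _ : Fin 4 => ℝ) ν) ∘L
  (ContinuousLinearMap.proj (R := ℝ) (φ := fun _ : Fin 4 => Fin 4 → ℝ) μ) ∘L
  (ContinuousLinearMap.proj (R := ℝ) (φ := fun _ : Fin i → Fin 4 => Fin 4 → Fin 4 → ℝ) l) ∘L
  (JetArr i).subtypeL ∘L
  (ContinuousLinearMap.proj (R := ℝ) (φ := fun j : Fin (k + 1) => JetArr j)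
    ⟨i, Nat.lt_succ_of_le hi⟩) ∘L
  (ContinuousLinearMap.snd ℝ E4 ((j : Fin (k + 1)) → JetArr j))

/-- The coordinates `y_{μν}`. -/
def yCoord {k : ℕ} (w : JetCoord k) (μ ν : Fin 4) : ℝ := zCoord 0 (Nat.zero_le k) ![] μ ν w

/-- The forgetful map `J³(M,N) → J²(M,N)` in coordinates. -/
def trunc (w : JetCoord 3) : JetCoord 2 := (w.1, fun i => w.2 i.castSucc)

/-- The partial derivative `∂F/∂z_{μνλ₁…λᵢ}`, with the usual convention for symmetric arrays: the
derivative of `F` in the direction of the symmetrization of the unit array, so that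
`dF = … + (∂F/∂z_{μνλ₁…λᵢ}) dz_{μνλ₁…λᵢ}` with summation over all values of all indices. -/
def partialZ {k : ℕ} (F : JetCoord k → ℝ) (i : ℕ) (hi : i ≤ k) (l : Fin i → Fin 4) (μ ν : Fin 4)
    (w : JetCoord k) : ℝ :=
  fderiv ℝ F w (0, Pi.single ⟨i, Nat.lt_succ_of_le hi⟩
    (symArr i (Pi.single l (Pi.single μ (Pi.single ν 1)))))

/-- A symmetric bilinear form of signature `(-,+,+,+)` on a four-dimensional space. -/
def IsLorentzian {V : Type*} [AddCommGroup V] [Module ℝ V] (B : V → V → ℝ) : Prop :=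
  (∀ v w, B v w = B w v) ∧ (∃ v, B v v < 0) ∧
    ∃ S : Submodule ℝ V, Module.finrank ℝ S = 3 ∧ ∀ v ∈ S, v ≠ 0 → 0 < B v v

/-- The bilinear form on `ℝ⁴` with matrix `y`. -/
def matForm (y : Fin 4 → Fin 4 → ℝ) (v w : E4) : ℝ := ∑ μ, ∑ ν, y μ ν * v μ * w ν

/-! ## Local Lorentzian metrics, local scalar fields, and their jets -/

section Jets

variable (M : Type*) [TopologicalSpace M] [ChartedSpace E4 M]

/-- The components `g_{μν}` of a covariant `2`-tensor field in the coordinates `e`, as functions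
of these coordinates. -/
def comps {M : Type*} [TopologicalSpace M] [ChartedSpace E4 M]
    (g : (y : M) → TangentSpace (𝓡 4) y →L[ℝ] TangentSpace (𝓡 4) y →L[ℝ] ℝ)
    (e : OpenPartialHomeomorph M E4) (u : E4) : Fin 4 → Fin 4 → ℝ := fun μ ν =>
  g (e.symm u) (mfderiv (𝓡 4) (𝓡 4) e.symm u (bvec μ)) (mfderiv (𝓡 4) (𝓡 4) e.symm u (bvec ν))

/-- A smooth Lorentzian metric on an open subset `dom` of `M`, that is, a local section of
`π : N → M`. The values of `toFun` outside `dom` are irrelevant. -/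
structure LocalMetric where
  dom : TopologicalSpace.Opens M
  toFun : (y : M) → TangentSpace (𝓡 4) y →L[ℝ] TangentSpace (𝓡 4) y →L[ℝ] ℝ
  lorentzian : ∀ y ∈ dom, IsLorentzian (fun v w => toFun y v w)
  smooth : ∀ e ∈ posAtlas M, ContDiffOn ℝ ∞ (comps toFun e) (e.target ∩ e.symm ⁻¹' dom)

/-- A smooth function on an open subset `dom` of `M`, that is, a local section of `κ : ℝ × M → M`.
The values of `toFun` outside `dom` are irrelevant. -/
structure LocalScalar where
  dom : TopologicalSpace.Opens M
  toFun : M → ℝ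
  smooth : ContMDiffOn (𝓡 4) 𝓘(ℝ, ℝ) ∞ toFun dom

variable {M}

/-- The coordinates of the `k`-jet of `σ` at the point with coordinates `u`:
`(u, g_{μν}(u), g_{μν,λ₁}(u), …, g_{μν,λ₁…λₖ}(u))`. (The symmetrization changes nothing at points of
the domain of `σ`.) -/
def LocalMetric.jetCoord (σ : LocalMetric M) (k : ℕ) (e : OpenPartialHomeomorph M E4) (u : E4) :
    JetCoord k :=
  (u, fun i => symArr i fun l => iteratedFDeriv ℝ i (comps σ.toFun e) u fun j => bvec (l j))

/-- The coordinates `(u, φ(u), φ_{,μ}(u))` of the `1`-jet of `φ` at the point with coordinates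
`u`. -/
def LocalScalar.jetCoord (φ : LocalScalar M) (e : OpenPartialHomeomorph M E4) (u : E4) :
    E4 × ℝ × (Fin 4 → ℝ) :=
  (u, φ.toFun (e.symm u), fun μ => fderiv ℝ (φ.toFun ∘ e.symm) u (bvec μ))

variable (M)

/-- Two pairs (local metric, point of its domain) have the same `k`-jet if the points agree and all
derivatives of the components up to order `k` at the point agree in every coordinate system. -/
def metricJetSetoid (k : ℕ) : Setoid {a : LocalMetric M × M // a.2 ∈ a.1.dom} where
  r a b := a.1.2 = b.1.2 ∧ ∀ e ∈ posAtlas M, a.1.2 ∈ e.source →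
    a.1.1.jetCoord k e (e a.1.2) = b.1.1.jetCoord k e (e b.1.2)
  iseqv := ⟨fun _ => ⟨rfl, fun _ _ _ => rfl⟩,
    fun h => ⟨h.1.symm, fun e he hs => (h.2 e he (h.1 ▸ hs)).symm⟩,
    fun h h' => ⟨h.1.trans h'.1, fun e he hs => (h.2 e he hs).trans (h'.2 e he (h.1 ▸ hs))⟩⟩

/-- The jet bundle `J^k(M,N)`. -/
def MetricJet (k : ℕ) : Type _ := Quotient (metricJetSetoid M k)

/-- Two pairs (local function, point of its domain) have the same `1`-jet if the points, the values
and the first derivatives agree. -/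
def scalarJetSetoid : Setoid {a : LocalScalar M × M // a.2 ∈ a.1.dom} where
  r a b := a.1.2 = b.1.2 ∧ ∀ e ∈ posAtlas M, a.1.2 ∈ e.source →
    a.1.1.jetCoord e (e a.1.2) = b.1.1.jetCoord e (e b.1.2)
  iseqv := ⟨fun _ => ⟨rfl, fun _ _ _ => rfl⟩,
    fun h => ⟨h.1.symm, fun e he hs => (h.2 e he (h.1 ▸ hs)).symm⟩,
    fun h h' => ⟨h.1.trans h'.1, fun e he hs => (h.2 e he hs).trans (h'.2 e he (h.1 ▸ hs))⟩⟩

/-- The jet bundle `J¹(M,K)` of the trivial bundle `K = ℝ × M`. -/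
def ScalarJet : Type _ := Quotient (scalarJetSetoid M)

variable {M}

/-- The point `j^kσ(x)` of `J^k(M,N)`. -/
def LocalMetric.jet (σ : LocalMetric M) (k : ℕ) (x : M) (hx : x ∈ σ.dom) : MetricJet M k :=
  Quotient.mk (metricJetSetoid M k) ⟨(σ, x), hx⟩

/-- The point `j¹φ(x)` of `J¹(M,K)`. -/
def LocalScalar.jet (φ : LocalScalar M) (x : M) (hx : x ∈ φ.dom) : ScalarJet M :=
  Quotient.mk (scalarJetSetoid M) ⟨(φ, x), hx⟩

/-- The source projection `π^k : J^k(M,N) → M`. -/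
def MetricJet.base {k : ℕ} (j : MetricJet M k) : M :=
  Quotient.lift (fun a : {a : LocalMetric M × M // a.2 ∈ a.1.dom} => a.1.2)
    (fun a b (h : (metricJetSetoid M k).r a b) => h.1) j

/-- The source projection `κ¹ : J¹(M,K) → M`. -/
def ScalarJet.base (j : ScalarJet M) : M :=
  Quotient.lift (fun a : {a : LocalScalar M × M // a.2 ∈ a.1.dom} => a.1.2)
    (fun a b (h : (scalarJetSetoid M).r a b) => h.1) j

open Classical in
/-- The coordinates on `J^k(M,N)` induced by the coordinates `e` on `M` (and `0` outside the domain
of these coordinates). -/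
def MetricJet.coord {k : ℕ} (e : OpenPartialHomeomorph M E4) (j : MetricJet M k) : JetCoord k :=
  Quotient.lift (fun a : {a : LocalMetric M × M // a.2 ∈ a.1.dom} =>
    if e ∈ posAtlas M ∧ a.1.2 ∈ e.source then a.1.1.jetCoord k e (e a.1.2) else 0)
    (fun a b h => by
      have h1 : a.1.2 = b.1.2 := h.1
      by_cases h2 : e ∈ posAtlas M ∧ a.1.2 ∈ e.source
      · have h3 : e ∈ posAtlas M ∧ b.1.2 ∈ e.source := h1 ▸ h2
        rw [if_pos h2, if_pos h3]
        exact h.2 e h2.1 h2.2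
      · have h3 : ¬ (e ∈ posAtlas M ∧ b.1.2 ∈ e.source) := h1 ▸ h2
        rw [if_neg h2, if_neg h3]) j

open Classical in
/-- The coordinates `(x^μ, t, z_μ)` on `J¹(M,K)` induced by the coordinates `e` on `M` (and `0`
outside the domain of these coordinates). -/
def ScalarJet.coord (e : OpenPartialHomeomorph M E4) (j : ScalarJet M) : E4 × ℝ × (Fin 4 → ℝ) :=
  Quotient.lift (fun a : {a : LocalScalar M × M // a.2 ∈ a.1.dom} =>
    if e ∈ posAtlas M ∧ a.1.2 ∈ e.source then a.1.1.jetCoord e (e a.1.2) else 0)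
    (fun a b h => by
      have h1 : a.1.2 = b.1.2 := h.1
      by_cases h2 : e ∈ posAtlas M ∧ a.1.2 ∈ e.source
      · have h3 : e ∈ posAtlas M ∧ b.1.2 ∈ e.source := h1 ▸ h2
        rw [if_pos h2, if_pos h3]
        exact h.2 e h2.1 h2.2
      · have h3 : ¬ (e ∈ posAtlas M ∧ b.1.2 ∈ e.source) := h1 ▸ h2
        rw [if_neg h2, if_neg h3]) j

variable (M)

/-- The fibre product `J³(M,N) ×_M J¹(M,K)`. -/
@[ext]
structure TotalJet where
  grav : MetricJet M 3
  matter : ScalarJet M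
  base_eq : grav.base = matter.base

variable {M}

/-- The projection of the fibre product to `M`. -/
def TotalJet.base (P : TotalJet M) : M := P.grav.base

/-- The space of the coordinates `(x^μ, y_{μν}, z_{μνα}, z_{μναβ}, z_{μναβγ}; t, z_μ)` on the fibre
product. -/
abbrev TotalCoord : Type := JetCoord 3 × ℝ × (Fin 4 → ℝ)

/-- The coordinates on the fibre product induced by the coordinates `e` on `M`. -/
def TotalJet.coord (e : OpenPartialHomeomorph M E4) (P : TotalJet M) : TotalCoord :=
  (P.grav.coord e, (P.matter.coord e).2)


end Jets

/-! ### Analytic preliminaries -/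

theorem flat_pullback {F G : Type*} [NormedAddCommGroup F] [NormedSpace ℝ F]
    [NormedAddCommGroup G] [NormedSpace ℝ G] {h : E4 → F} {ψ : E4 → E4} {A : E4 → F →L[ℝ] G}
    {s t : Set E4} (hs : IsOpen s) (ht : IsOpen t) (hh : ContDiffOn ℝ ∞ h s)
    (hψ : ContDiffOn ℝ ∞ ψ t) (hA : ContDiffOn ℝ ∞ A t) (hm : MapsTo ψ t s) {u : E4} (hu : u ∈ t)
    {k : ℕ} (hk : ∀ i ≤ k, iteratedFDeriv ℝ i h (ψ u) = 0) :
    ∀ i ≤ k, iteratedFDeriv ℝ i (fun x => A x (h (ψ x))) u = 0 := by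
  have h1 : ∀ i ≤ k, iteratedFDerivWithin ℝ i (h ∘ ψ) t u = 0 := by
    intro i hi
    obtain ⟨D, hD⟩ : ∃ D : ℝ, ∀ j, 1 ≤ j → j ≤ i → ‖iteratedFDerivWithin ℝ j ψ t u‖ ≤ D ^ j := by
      refine ⟨1 + ∑ j ∈ Finset.range (i + 1), ‖iteratedFDerivWithin ℝ j ψ t u‖, fun j h1 h2 => ?_⟩
      have h3 : ‖iteratedFDerivWithin ℝ j ψ t u‖ ≤
          ∑ j ∈ Finset.range (i + 1), ‖iteratedFDerivWithin ℝ j ψ t u‖ :=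
        Finset.single_le_sum (f := fun j => ‖iteratedFDerivWithin ℝ j ψ t u‖)
          (fun _ _ => norm_nonneg _) (Finset.mem_range.2 (by omega))
      have h4 : (1 : ℝ) ≤ 1 + ∑ j ∈ Finset.range (i + 1), ‖iteratedFDerivWithin ℝ j ψ t u‖ := by
        have := (norm_nonneg _).trans h3
        linarith
      calc _ ≤ 1 + ∑ j ∈ Finset.range (i + 1), ‖iteratedFDerivWithin ℝ j ψ t u‖ := by linarith
        _ ≤ _ := le_self_pow₀ h4 (by omega)
    have := norm_iteratedFDerivWithin_comp_le (n := i) (C := 0) (D := D) hh hψ (by exact_mod_cast le_top)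
      hs.uniqueDiffOn ht.uniqueDiffOn hm hu (fun j hj => by
        rw [iteratedFDerivWithin_of_isOpen j hs (hm hu), hk j (hj.trans hi), norm_zero]) hD
    simpa using this
  intro i hi
  have h2 := (ContinuousLinearMap.id ℝ (F →L[ℝ] G)).norm_iteratedFDerivWithin_le_of_bilinear
    hA (hh.comp hψ hm) ht.uniqueDiffOn hu (n := i) (by exact_mod_cast le_top)
  have h3 : ‖iteratedFDerivWithin ℝ i (fun x => A x (h (ψ x))) t u‖ ≤ 0 := by
    refine h2.trans (le_of_eq ?_)
    rw [Finset.sum_eq_zero, mul_zero]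
    intro j hj
    rw [h1 (i - j) (by omega), norm_zero, mul_zero]
  rw [iteratedFDerivWithin_of_isOpen i ht hu] at h3
  simpa using h3

/-- Higher derivatives of smooth functions are symmetric. -/
theorem iteratedFDeriv_symm {E F : Type*} [NormedAddCommGroup E] [NormedSpace ℝ E]
    [NormedAddCommGroup F] [NormedSpace ℝ F] {f : E → F} {s : Set E} (hs : IsOpen s)
    (hf : ContDiffOn ℝ ∞ f s) (n : ℕ) : ∀ {x : E}, x ∈ s → ∀ (v : Fin n → E)
    (τ : Equiv.Perm (Fin n)),
    iteratedFDeriv ℝ n f x (v ∘ τ) = iteratedFDeriv ℝ n f x v := by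
  have hd : ∀ (n : ℕ) {x : E}, x ∈ s → ContDiffAt ℝ ∞ (iteratedFDeriv ℝ n f) x := fun n x hx =>
    (hf.contDiffAt (hs.mem_nhds hx)).iteratedFDeriv_right (m := ∞) (by exact_mod_cast le_rfl)
  induction n with
  | zero => intro x hx v τ; congr 1; exact Subsingleton.elim _ _
  | succ n ih =>
    intro x hx v τ
    -- adjacent transpositions suffice
    suffices H : ∀ (i : Fin n) (v : Fin (n + 1) → E),
        iteratedFDeriv ℝ (n + 1) f x (v ∘ Equiv.swap i.castSucc i.succ)
          = iteratedFDeriv ℝ (n + 1) f x v by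
      have hτ : τ ∈ Submonoid.closure
          (Set.range fun i : Fin n => Equiv.swap i.castSucc i.succ) := by
        rw [Equiv.Perm.mclosure_swap_castSucc_succ]; trivial
      induction hτ using Submonoid.closure_induction generalizing v with
      | mem τ hτ => obtain ⟨i, rfl⟩ := hτ; exact H i v
      | one => rfl
      | mul a b _ _ ha hb =>
        rw [Equiv.Perm.coe_mul, ← Function.comp_assoc, hb, ha]
    intro i v
    rcases Nat.eq_zero_or_pos i.val with h0 | h0
    · obtain ⟨m, rfl⟩ : ∃ m, n = m + 1 := ⟨n - 1, by have := i.isLt; omega⟩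
      obtain rfl : i = 0 := Fin.ext h0
      have hsymm : IsSymmSndFDerivAt ℝ (iteratedFDeriv ℝ m f) x :=
        (hd m hx).isSymmSndFDerivAt (by
          simp only [minSmoothness_of_isRCLikeNormedField]
          exact (WithTop.coe_le_coe.2 le_top : ((2 : ℕ∞) : ℕ∞ω) ≤ ∞))
      have key : ∀ w : Fin (m + 2) → E, iteratedFDeriv ℝ (m + 1 + 1) f x w
          = fderiv ℝ (fderiv ℝ (iteratedFDeriv ℝ m f)) x (w 0) (w 1) (fun j => w j.succ.succ) := by
        intro w
        have h1 : DifferentiableAt ℝ (iteratedFDeriv ℝ (m + 1) f) x :=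
          (hd (m + 1) hx).differentiableAt (by simp)
        have h2 : DifferentiableAt ℝ (fderiv ℝ (iteratedFDeriv ℝ m f)) x :=
          ((hd m hx).fderiv_right (m := ∞) (by exact_mod_cast le_rfl)).differentiableAt (by simp)
        rw [iteratedFDeriv_succ_apply_left,
          ← fderiv_continuousMultilinear_apply_const_apply h1]
        simp only [iteratedFDeriv_succ_apply_left]
        have h3 : DifferentiableAt ℝ (fun y => fderiv ℝ (iteratedFDeriv ℝ m f) y (w 1)) x :=
          h2.clm_apply (differentiableAt_const _)
        have h4 := fderiv_continuousMultilinear_apply_const_apply h3 (fun j : Fin m => w j.succ.succ)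
          (w 0)
        refine h4.trans ?_
        rw [fderiv_clm_apply h2 (differentiableAt_const _)]
        simp
      rw [key, key, hsymm.eq]
      have e1 : (v ∘ Equiv.swap (Fin.castSucc (0 : Fin (m + 1))) (Fin.succ 0)) 1 = v 0 := by
        simp [Function.comp]
      have e0 : (v ∘ Equiv.swap (Fin.castSucc (0 : Fin (m + 1))) (Fin.succ 0)) 0 = v 1 := by
        simp [Function.comp]
      have e2 : (fun j : Fin m => (v ∘ Equiv.swap (Fin.castSucc (0 : Fin (m + 1))) (Fin.succ 0))
          j.succ.succ) = fun j => v j.succ.succ := by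
        funext j
        simp only [Function.comp]
        rw [Equiv.swap_apply_of_ne_of_ne] <;> simp [Fin.ext_iff]
      rw [e0, e1, e2]
    · have e0 : (v ∘ Equiv.swap i.castSucc i.succ) 0 = v 0 := by
        simp only [Function.comp]
        rw [Equiv.swap_apply_of_ne_of_ne]
        · intro h; simp [Fin.ext_iff] at h; omega
        · intro h; simp [Fin.ext_iff] at h
      obtain ⟨m, rfl⟩ : ∃ m, n = m + 1 := ⟨n - 1, by omega⟩
      obtain ⟨j, rfl⟩ : ∃ j : Fin m, i = j.succ :=
        ⟨⟨i - 1, by omega⟩, Fin.ext (by simp; omega)⟩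
      have e1 : Fin.tail (v ∘ Equiv.swap j.succ.castSucc j.succ.succ)
          = Fin.tail v ∘ Equiv.swap j.castSucc j.succ := by
        funext l
        simp only [Fin.tail, Function.comp]
        congr 1
        rw [← Fin.succ_castSucc, Equiv.swap_apply_def, Equiv.swap_apply_def]
        simp only [Fin.succ_inj]
        split_ifs <;> rfl
      rw [iteratedFDeriv_succ_apply_left, iteratedFDeriv_succ_apply_left, e0, e1]
      have hdiff : DifferentiableAt ℝ (iteratedFDeriv ℝ (m + 1) f) x :=
        (hd (m + 1) hx).differentiableAt (by simp)
      have h3 : ∀ w : Fin (m + 1) → E, fderiv ℝ (iteratedFDeriv ℝ (m + 1) f) x (v 0) w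
          = fderiv ℝ (fun y => iteratedFDeriv ℝ (m + 1) f y w) x (v 0) := by
        intro w
        rw [fderiv_continuousMultilinear_apply_const_apply hdiff]
      rw [h3, h3]
      have h4 : (fun y => iteratedFDeriv ℝ (m + 1) f y (Fin.tail v ∘ Equiv.swap j.castSucc j.succ))
          =ᶠ[𝓝 x] fun y => iteratedFDeriv ℝ (m + 1) f y (Fin.tail v) :=
        Filter.eventuallyEq_of_mem (hs.mem_nhds hx) fun y hy => ih hy _ _
      rw [h4.fderiv_eq]

/-- Joint smoothness of the iterated partial derivatives of a smooth function. -/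
theorem contDiffAt_iteratedFDeriv_param {W E F : Type*} [NormedAddCommGroup W] [NormedSpace ℝ W]
    [NormedAddCommGroup E] [NormedSpace ℝ E] [NormedAddCommGroup F] [NormedSpace ℝ F]
    {f : W → E → F} {s : Set (W × E)} (hs : IsOpen s)
    (hf : ContDiffOn ℝ ∞ (Function.uncurry f) s) (n : ℕ) :
    ContDiffOn ℝ ∞ (fun p : W × E => iteratedFDeriv ℝ n (f p.1) p.2) s := by
  induction n with
  | zero =>
    have : (fun p : W × E => iteratedFDeriv ℝ 0 (f p.1) p.2)
        = (continuousMultilinearCurryFin0 ℝ E F).symm ∘ Function.uncurry f := rfl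
    rw [this]
    exact (LinearIsometryEquiv.contDiff _).comp_contDiffOn hf
  | succ n ih =>
    intro p hp
    refine ContDiffAt.contDiffWithinAt ?_
    have h1 : ContDiffAt ℝ ∞ (fun q : W × E => fderiv ℝ (iteratedFDeriv ℝ n (f q.1)) q.2) p := by
      refine ContDiffAt.fderiv (n := ∞) (f := fun q : W × E => iteratedFDeriv ℝ n (f q.1))
        (g := fun q => q.2) ?_ contDiffAt_snd (by exact_mod_cast le_rfl)
      have h2 : ContDiffAt ℝ ∞ (fun p : W × E => iteratedFDeriv ℝ n (f p.1) p.2) (p.1, p.2) :=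
        ih.contDiffAt (hs.mem_nhds hp)
      exact ContDiffAt.comp (g := fun p : W × E => iteratedFDeriv ℝ n (f p.1) p.2)
        (f := fun q : (W × E) × E => (q.1.1, q.2)) (p, p.2) h2 (by fun_prop)
    have : (fun p : W × E => iteratedFDeriv ℝ (n + 1) (f p.1) p.2)
        = (continuousMultilinearCurryLeftEquiv ℝ (fun _ : Fin (n + 1) => E) F).symm ∘
          fun q : W × E => fderiv ℝ (iteratedFDeriv ℝ n (f q.1)) q.2 := by
      funext q
      simp only [iteratedFDeriv_succ_eq_comp_left]
      rfl
    rw [this]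
    exact (LinearIsometryEquiv.contDiff _).contDiffAt.comp p h1

/-- The polynomial metric with given jet at `w.1`. -/
def polyMetric {k : ℕ} (w : JetCoord k) (u : E4) : Fin 4 → Fin 4 → ℝ :=
  ∑ i : Fin (k + 1), ((i : ℕ).factorial : ℝ)⁻¹ •
    ∑ l : Fin i → Fin 4, (∏ j, (u - w.1) (l j)) • (w.2 i).1 l

theorem polyMetric_symm {k : ℕ} (w : JetCoord k) (u : E4) (μ ν : Fin 4) :
    polyMetric w u μ ν = polyMetric w u ν μ := by
  simp only [polyMetric, Finset.sum_apply, Pi.smul_apply]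
  exact Finset.sum_congr rfl fun i _ => congrArg _ (Finset.sum_congr rfl fun l _ =>
    congrArg _ ((w.2 i).2.1 l μ ν))

theorem polyMetric_contDiff (k : ℕ) :
    ContDiff ℝ ∞ (fun p : JetCoord k × E4 => polyMetric p.1 p.2) := by
  unfold polyMetric
  refine ContDiff.sum fun i _ => ContDiff.const_smul _ (ContDiff.sum fun l _ => ?_)
  refine ContDiff.smul (𝕜 := ℝ) (f := fun p : JetCoord k × E4 => ∏ j, (p.2 - p.1.1) (l j))
    (g := fun p : JetCoord k × E4 => (p.1.2 i).1 l) ?_ ?_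
  · refine contDiff_prod fun j _ => ?_
    have h : ContDiff ℝ ∞ (fun p : JetCoord k × E4 => p.2 - p.1.1) := by fun_prop
    exact (EuclideanSpace.proj (𝕜 := ℝ) (l j)).contDiff.comp h
  · have h : ContDiff ℝ ∞ (fun p : JetCoord k × E4 => p.1.2 i) :=
      (ContinuousLinearMap.proj (R := ℝ) (φ := fun j : Fin (k + 1) => JetArr j) i).contDiff.comp
        (contDiff_snd.comp contDiff_fst)
    have h2 := (JetArr i).subtypeL.contDiff (n := ∞) |>.comp h
    exact (contDiff_pi.1 h2) l

theorem iteratedFDeriv_polyMetric {k : ℕ} (w : JetCoord k) (i : Fin (k + 1)) (l : Fin i → Fin 4) :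
    iteratedFDeriv ℝ i (polyMetric w) w.1 (fun j => bvec (l j)) = (w.2 i).1 l := by
  let p : FormalMultilinearSeries ℝ E4 (Fin 4 → Fin 4 → ℝ) := fun n =>
    if h : n < k + 1 then ((n.factorial : ℝ)⁻¹) • ∑ l : Fin n → Fin 4,
      ((ContinuousMultilinearMap.mkPiAlgebra ℝ (Fin n) ℝ).compContinuousLinearMap
        (fun j => (EuclideanSpace.proj (l j) : E4 →L[ℝ] ℝ))).smulRight ((w.2 ⟨n, h⟩).1 l)
    else 0
  have hp : ∀ (n : ℕ) (h : n < k + 1) (v : Fin n → E4), p n v =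
      ((n.factorial : ℝ)⁻¹) • ∑ l : Fin n → Fin 4, (∏ j, v j (l j)) • (w.2 ⟨n, h⟩).1 l := by
    intro n h v
    simp only [p, dif_pos h]
    simp
  have hF : HasFiniteFPowerSeriesOnBall (polyMetric w) p w.1 (k + 1) ⊤ := by
    refine HasFiniteFPowerSeriesOnBall.mk' ?_ (by simp) ?_
    · intro m hm
      simp only [p]
      rw [dif_neg (by omega)]
    · intro y _
      rw [Finset.sum_range]
      refine Finset.sum_congr rfl fun n _ => ?_
      rw [hp n n.2]
      simp
  rw [hF.toHasFPowerSeriesOnBall.iteratedFDeriv_eq_sum_of_completeSpace]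
  have : ∀ τ : Equiv.Perm (Fin i), p i (fun j => bvec (l (τ j)))
      = (((i : ℕ).factorial : ℝ)⁻¹) • (w.2 i).1 l := by
    intro τ
    rw [hp i i.2]
    congr 1
    rw [Finset.sum_eq_single (l ∘ τ)]
    · rw [← (w.2 i).2.2 l τ]
      simp [bvec]
    · intro m _ hm
      obtain ⟨j, hj⟩ := Function.ne_iff.1 hm
      rw [Finset.prod_eq_zero (Finset.mem_univ j), zero_smul]
      have : m j ≠ l (τ j) := hj
      simp [bvec, this]
    · simp
  rw [Finset.sum_congr rfl fun τ _ => this τ]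
  simp only [Finset.sum_const, Finset.card_univ, Fintype.card_perm, Fintype.card_fin]
  rw [← Nat.cast_smul_eq_nsmul ℝ, smul_smul, mul_inv_cancel₀ (by positivity), one_smul]

theorem symArr_of_symm {i : ℕ} (z : (Fin i → Fin 4) → Fin 4 → Fin 4 → ℝ) (hz : z ∈ JetArr i) :
    symArr i z = ⟨z, hz⟩ := by
  ext l μ ν
  simp only [symArr, LinearMap.coe_mk, AddHom.coe_mk]
  have : ∀ τ : Equiv.Perm (Fin i), (z (l ∘ τ) μ ν + z (l ∘ τ) ν μ) / 2 = z l μ ν := by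
    intro τ
    rw [hz.2 l τ, hz.1 l ν μ]; ring
  rw [Finset.sum_congr rfl fun τ _ => this τ]
  simp only [Finset.sum_const, Finset.card_univ, Fintype.card_perm, Fintype.card_fin,
    nsmul_eq_mul]
  rw [← mul_assoc, inv_mul_cancel₀ (by positivity), one_mul]

/-! ### Lorentzian forms -/

theorem isOpen_posDefOn (S : Submodule ℝ E4) :
    IsOpen {y : Fin 4 → Fin 4 → ℝ | ∀ v ∈ S, v ≠ 0 → 0 < matForm y v v} := by
  have hc : Continuous fun q : (Fin 4 → Fin 4 → ℝ) × E4 => matForm q.1 q.2 q.2 := by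
    unfold matForm; fun_prop
  have : {y : Fin 4 → Fin 4 → ℝ | ∀ v ∈ S, v ≠ 0 → 0 < matForm y v v}
      = {y | ∀ v ∈ (S : Set E4) ∩ Metric.sphere 0 1, 0 < matForm y v v} := by
    ext y
    refine ⟨fun h v hv => h v hv.1 (by rintro rfl; simpa using hv.2), fun h v hv h0 => ?_⟩
    have h1 := h (‖v‖⁻¹ • v) ⟨S.smul_mem _ hv, by simp [norm_smul, h0]⟩
    have h2 : matForm y (‖v‖⁻¹ • v) (‖v‖⁻¹ • v) = ‖v‖⁻¹ ^ 2 * matForm y v v := by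
      simp only [matForm, Finset.mul_sum, PiLp.smul_apply, smul_eq_mul]
      exact Finset.sum_congr rfl fun _ _ => Finset.sum_congr rfl fun _ _ => by ring
    rw [h2] at h1
    exact pos_of_mul_pos_right h1 (by positivity)
  rw [this, isOpen_iff_eventually]
  intro y hy
  refine IsCompact.eventually_forall_of_forall_eventually
    ((isCompact_sphere (0 : E4) 1).inter_left S.closed_of_finiteDimensional) fun v hv => ?_
  exact (hc.tendsto (y, v)).eventually (lt_mem_nhds (hy v hv))

theorem isOpen_lorentzian {X : Type*} [TopologicalSpace X] {s : Set X} (hs : IsOpen s)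
    {f : X → Fin 4 → Fin 4 → ℝ} (hf : ContinuousOn f s) (hsymm : ∀ x μ ν, f x μ ν = f x ν μ) :
    IsOpen (s ∩ {x | IsLorentzian (matForm (f x))}) := by
  have h : IsOpen {y : Fin 4 → Fin 4 → ℝ | (∃ v, matForm y v v < 0) ∧
      ∃ S : Submodule ℝ E4, Module.finrank ℝ S = 3 ∧ ∀ v ∈ S, v ≠ 0 → 0 < matForm y v v} := by
    have h1 : IsOpen (⋃ v : E4, {y : Fin 4 → Fin 4 → ℝ | matForm y v v < 0}) := by
      refine isOpen_iUnion fun v => ?_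
      have hc : Continuous fun y : Fin 4 → Fin 4 → ℝ => matForm y v v := by
        unfold matForm; fun_prop
      exact isOpen_lt hc continuous_const
    have h2 : IsOpen (⋃ S : Submodule ℝ E4, ⋃ _ : Module.finrank ℝ S = 3,
        {y : Fin 4 → Fin 4 → ℝ | ∀ v ∈ S, v ≠ 0 → 0 < matForm y v v}) :=
      isOpen_iUnion fun S => isOpen_iUnion fun _ => isOpen_posDefOn S
    convert h1.inter h2 using 1
    ext y
    simp
  have := hf.isOpen_inter_preimage hs h
  convert this using 1
  ext x
  simp only [mem_inter_iff, mem_ofPred_eq, mem_preimage, IsLorentzian]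
  have hx : ∀ v w, matForm (f x) v w = matForm (f x) w v := by
    intro v w
    unfold matForm
    rw [Finset.sum_comm]
    exact Finset.sum_congr rfl fun _ _ => Finset.sum_congr rfl fun _ _ => by
      rw [hsymm x]; ring
  tauto

theorem IsLorentzian.comp {V W : Type*} [AddCommGroup V] [Module ℝ V] [AddCommGroup W] [Module ℝ W]
    {B : V → V → ℝ} (hB : IsLorentzian B) {C : W → W → ℝ} (T : V ≃ₗ[ℝ] W)
    (h : ∀ v w, C (T v) (T w) = B v w) : IsLorentzian C := by
  have h' : ∀ v w, C v w = B (T.symm v) (T.symm w) := fun v w => by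
    rw [← h]; simp
  obtain ⟨h1, ⟨v, hv⟩, S, hS, h3⟩ := hB
  refine ⟨fun v w => by rw [h', h', h1], ⟨T v, by rwa [h]⟩, S.map T.toLinearMap, ?_, ?_⟩
  · rw [← hS]; exact LinearEquiv.finrank_map_eq T S
  · rintro _ ⟨v, hv, rfl⟩ h0
    have : C (T v) (T v) = B v v := h v v
    simp only [LinearEquiv.coe_coe, this]
    exact h3 v hv (by rintro rfl; simp at h0)

/-! ### Coordinate changes -/

theorem isOpen_overlap {M : Type*} [TopologicalSpace M] (e e' : OpenPartialHomeomorph M E4) :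
    IsOpen (e.target ∩ e.symm ⁻¹' e'.source) :=
  e.isOpen_inter_preimage_symm e'.open_source

section Change

variable {M : Type*} [TopologicalSpace M] [ChartedSpace E4 M]

theorem orientedGroupoid_le : orientedGroupoid ≤ contDiffGroupoid ∞ (𝓡 4) := by
  intro e he
  have h : orientedPregroupoid.property e e.source ∧
    orientedPregroupoid.property e.symm e.target := he
  refine mem_groupoid_of_pregroupoid.2 ⟨?_, ?_⟩
  · simpa [contDiffPregroupoid] using h.1.1
  · simpa [contDiffPregroupoid] using h.2.1

theorem posAtlas_subset : posAtlas M ⊆ IsManifold.maximalAtlas (𝓡 4) ∞ M :=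
  StructureGroupoid.maximalAtlas_mono orientedGroupoid_le

theorem isManifold_of_oriented [HasGroupoid M orientedGroupoid] : IsManifold (𝓡 4) ∞ M :=
  { hasGroupoid_of_le (inferInstance : HasGroupoid M orientedGroupoid) orientedGroupoid_le with }

theorem chartAt_mem_posAtlas [HasGroupoid M orientedGroupoid] (x : M) :
    chartAt E4 x ∈ posAtlas M :=
  StructureGroupoid.chart_mem_maximalAtlas _ x

theorem trans_contDiffOn {e e' : OpenPartialHomeomorph M E4} (he : e ∈ posAtlas M)
    (he' : e' ∈ posAtlas M) :
    ContDiffOn ℝ ∞ (e' ∘ e.symm) (e.target ∩ e.symm ⁻¹' e'.source) :=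
  (show orientedPregroupoid.property _ _ ∧ orientedPregroupoid.property _ _ from
    StructureGroupoid.compatible_of_mem_maximalAtlas he he').1.1

/-- The Jacobian matrix `∂x^a/∂x'^μ` of the change from the coordinates `e'` to `e`. -/
def jac (e' e : OpenPartialHomeomorph M E4) (u : E4) (a μ : Fin 4) : ℝ :=
  fderiv ℝ (e ∘ e'.symm) u (bvec μ) a

theorem eq_sum_bvec (v : E4) : v = ∑ a, v a • bvec a := by
  ext i
  simp [bvec, Pi.single_apply]

theorem clm_apply_eq_sum (T : E4 →L[ℝ] E4) (v : E4) : T v = ∑ a, v a • T (bvec a) := by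
  conv_lhs => rw [eq_sum_bvec v, map_sum]
  simp only [map_smul]

theorem bilin_sum (B : E4 →L[ℝ] E4 →L[ℝ] ℝ) (c d : Fin 4 → ℝ) (v : Fin 4 → E4) :
    B (∑ a, c a • v a) (∑ b, d b • v b) = ∑ a, ∑ b, B (v a) (v b) * c a * d b := by
  simp only [map_sum, sum_apply, map_smul, smul_apply, smul_eq_mul, Finset.mul_sum]
  rw [Finset.sum_comm]
  exact Finset.sum_congr rfl fun a _ => Finset.sum_congr rfl fun b _ => by ring

theorem mfderiv_symm_change {e e' : OpenPartialHomeomorph M E4} (he : e ∈ posAtlas M)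
    (he' : e' ∈ posAtlas M) {u : E4} (hu : u ∈ e'.target ∩ e'.symm ⁻¹' e.source) :
    mfderiv (𝓡 4) (𝓡 4) e'.symm u =
      (mfderiv (𝓡 4) (𝓡 4) e.symm (e (e'.symm u))).comp (fderiv ℝ (e ∘ e'.symm) u) := by
  have h1 : e'.symm =ᶠ[𝓝 u] e.symm ∘ (e ∘ e'.symm) :=
    Filter.eventuallyEq_of_mem ((isOpen_overlap e' e).mem_nhds hu) fun x hx =>
      (e.left_inv hx.2).symm
  have h2 : MDifferentiableAt (𝓡 4) (𝓡 4) e.symm ((e ∘ e'.symm) u) :=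
    (contMDiffAt_symm_of_mem_maximalAtlas (posAtlas_subset he)
      (e.map_source hu.2)).mdifferentiableAt (by simp)
  have h3 : DifferentiableAt ℝ (e ∘ e'.symm) u :=
    ((trans_contDiffOn he' he).contDiffAt ((isOpen_overlap e' e).mem_nhds hu)).differentiableAt
      (by simp)
  rw [h1.mfderiv_eq, mfderiv_comp u h2 h3.mdifferentiableAt, mfderiv_eq_fderiv]
  rfl

/-- The pullback of a covariant `2`-tensor. -/
def pull (J : Fin 4 → Fin 4 → ℝ) (y : Fin 4 → Fin 4 → ℝ) : Fin 4 → Fin 4 → ℝ :=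
  fun μ ν => ∑ a, ∑ b, y a b * J a μ * J b ν

theorem comps_change
    (g : (y : M) → TangentSpace (𝓡 4) y →L[ℝ] TangentSpace (𝓡 4) y →L[ℝ] ℝ)
    {e e' : OpenPartialHomeomorph M E4} (he : e ∈ posAtlas M)
    (he' : e' ∈ posAtlas M) {u : E4} (hu : u ∈ e'.target ∩ e'.symm ⁻¹' e.source) :
    comps g e' u = pull (jac e' e u) (comps g e (e (e'.symm u))) := by
  funext μ ν
  have key : ∀ μ, (mfderiv (𝓡 4) (𝓡 4) e'.symm u (bvec μ) : E4) =
      ∑ a, jac e' e u a μ • (mfderiv (𝓡 4) (𝓡 4) e.symm (e (e'.symm u)) (bvec a) : E4) := by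
    intro μ
    have h1 : (mfderiv (𝓡 4) (𝓡 4) e'.symm u (bvec μ) : E4)
        = (mfderiv (𝓡 4) (𝓡 4) e.symm (e (e'.symm u)) : E4 →L[ℝ] E4)
          (fderiv ℝ (e ∘ e'.symm) u (bvec μ)) :=
      congrArg (fun T : E4 →L[ℝ] E4 => T (bvec μ)) (mfderiv_symm_change he he' hu)
    exact h1.trans (clm_apply_eq_sum (mfderiv (𝓡 4) (𝓡 4) e.symm (e (e'.symm u)) : E4 →L[ℝ] E4) _)
  have hl : e.symm (e (e'.symm u)) = e'.symm u := e.left_inv hu.2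
  have h2 : (g (e.symm (e (e'.symm u))) : E4 →L[ℝ] E4 →L[ℝ] ℝ)
      = (g (e'.symm u) : E4 →L[ℝ] E4 →L[ℝ] ℝ) := by rw [hl]
  have h3 : comps g e' u μ ν = (g (e.symm (e (e'.symm u))) : E4 →L[ℝ] E4 →L[ℝ] ℝ)
    (mfderiv (𝓡 4) (𝓡 4) e'.symm u (bvec μ) : E4)
    (mfderiv (𝓡 4) (𝓡 4) e'.symm u (bvec ν) : E4) :=
      congrArg (fun B : E4 →L[ℝ] E4 →L[ℝ] ℝ => B (mfderiv (𝓡 4) (𝓡 4) e'.symm u (bvec μ) : E4)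
        (mfderiv (𝓡 4) (𝓡 4) e'.symm u (bvec ν) : E4)) h2.symm
  refine h3.trans ?_
  rw [key μ, key ν]
  exact bilin_sum _ _ _ _

theorem jac_contDiffOn {e e' : OpenPartialHomeomorph M E4} (he : e ∈ posAtlas M)
    (he' : e' ∈ posAtlas M) :
    ContDiffOn ℝ ∞ (fun u => jac e' e u) (e'.target ∩ e'.symm ⁻¹' e.source) := by
  refine contDiffOn_pi.2 fun a => contDiffOn_pi.2 fun μ => ?_
  have h1 : ContDiffOn ℝ ∞ (fderiv ℝ (e ∘ e'.symm)) (e'.target ∩ e'.symm ⁻¹' e.source) :=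
    (trans_contDiffOn he' he).fderiv_of_isOpen (isOpen_overlap e' e) (by exact_mod_cast le_rfl)
  exact (EuclideanSpace.proj (𝕜 := ℝ) a).contDiff.comp_contDiffOn
    (h1.clm_apply contDiffOn_const)

theorem pull_contDiff : ContDiff ℝ ∞ fun p : (Fin 4 → Fin 4 → ℝ) × (Fin 4 → Fin 4 → ℝ) =>
    pull p.1 p.2 := by
  unfold pull; fun_prop

/-- `pull J` as a continuous linear map. -/
def pullL (J : Fin 4 → Fin 4 → ℝ) : (Fin 4 → Fin 4 → ℝ) →L[ℝ] (Fin 4 → Fin 4 → ℝ) :=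
  LinearMap.toContinuousLinearMap
    { toFun := pull J
      map_add' := fun x y => by
        funext μ ν
        simp only [pull, Pi.add_apply, ← Finset.sum_add_distrib]
        exact Finset.sum_congr rfl fun _ _ => Finset.sum_congr rfl fun _ _ => by ring
      map_smul' := fun c x => by
        funext μ ν
        simp only [pull, Pi.smul_apply, smul_eq_mul, Finset.mul_sum, RingHom.id_apply]
        exact Finset.sum_congr rfl fun _ _ => Finset.sum_congr rfl fun _ _ => by ring }

theorem pullL_contDiff : ContDiff ℝ ∞ pullL := by
  refine contDiff_clm_apply_iff.2 fun y => ?_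
  exact pull_contDiff.comp (contDiff_id.prodMk contDiff_const)

/-! ### Jets in coordinates -/

theorem comps_symm (σ : LocalMetric M) {e : OpenPartialHomeomorph M E4} {u : E4}
    (hu : e.symm u ∈ σ.dom) (μ ν : Fin 4) : comps σ.toFun e u μ ν = comps σ.toFun e u ν μ :=
  (σ.lorentzian _ hu).1 _ _

theorem raw_mem (σ : LocalMetric M) {e : OpenPartialHomeomorph M E4} (he : e ∈ posAtlas M) {u : E4}
    (hu : u ∈ e.target ∩ e.symm ⁻¹' σ.dom) (i : ℕ) :
    (fun l : Fin i → Fin 4 => iteratedFDeriv ℝ i (comps σ.toFun e) u fun j => bvec (l j))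
      ∈ JetArr i := by
  have ho : IsOpen (e.target ∩ e.symm ⁻¹' (σ.dom : Set M)) :=
    e.isOpen_inter_preimage_symm σ.dom.isOpen
  refine ⟨fun l μ ν => ?_, fun l τ => iteratedFDeriv_symm ho (σ.smooth e he) i hu
    (fun j => bvec (l j)) τ⟩
  let S : (Fin 4 → Fin 4 → ℝ) →L[ℝ] (Fin 4 → Fin 4 → ℝ) := LinearMap.toContinuousLinearMap
    { toFun := fun y μ ν => y ν μ, map_add' := fun _ _ => rfl, map_smul' := fun _ _ => rfl }
  have h1 : S ∘ comps σ.toFun e =ᶠ[𝓝 u] comps σ.toFun e :=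
    Filter.eventuallyEq_of_mem (ho.mem_nhds hu) fun x hx => by
      funext μ ν; exact comps_symm σ hx.2 ν μ
  have h2 := S.iteratedFDeriv_comp_left ((σ.smooth e he).contDiffAt (ho.mem_nhds hu)) (i := i)
    (by exact_mod_cast le_top)
  rw [(h1.iteratedFDeriv ℝ i).eq_of_nhds] at h2
  exact congrArg (fun T : ContinuousMultilinearMap ℝ (fun _ : Fin i => E4) (Fin 4 → Fin 4 → ℝ) =>
    T (fun j => bvec (l j)) μ ν) h2

end Change

/-! ### Jets and coordinates -/

theorem mem_dom_coord {M : Type*} [TopologicalSpace M] {x : M} {e : OpenPartialHomeomorph M E4} (hx : x ∈ e.source) {s : Set M}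
    (hs : x ∈ s) : e x ∈ e.target ∩ e.symm ⁻¹' s :=
  ⟨e.map_source hx, by rwa [mem_preimage, e.left_inv hx]⟩

section Jets2

variable {M : Type*} [TopologicalSpace M] [ChartedSpace E4 M]

theorem cmm_ext {F : Type*} [NormedAddCommGroup F] [NormedSpace ℝ F] {i : ℕ}
    {f g : ContinuousMultilinearMap ℝ (fun _ : Fin i => E4) F}
    (h : ∀ l : Fin i → Fin 4, f (fun j => bvec (l j)) = g fun j => bvec (l j)) : f = g := by
  apply ContinuousMultilinearMap.toMultilinearMap_injective
  refine Module.Basis.ext_multilinear (fun _ => (EuclideanSpace.basisFun (Fin 4) ℝ).toBasis)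
    fun l => ?_
  have : ∀ j, (EuclideanSpace.basisFun (Fin 4) ℝ).toBasis (l j) = bvec (l j) := fun j => by
    simp [bvec]
  simp only [this]
  exact h l

theorem jetCoord_apply (σ : LocalMetric M) {e : OpenPartialHomeomorph M E4} (he : e ∈ posAtlas M)
    {u : E4} (hu : u ∈ e.target ∩ e.symm ⁻¹' σ.dom) (k : ℕ) (i : Fin (k + 1)) (l : Fin i → Fin 4) :
    ((σ.jetCoord k e u).2 i).1 l = iteratedFDeriv ℝ i (comps σ.toFun e) u fun j => bvec (l j) := by
  simp only [LocalMetric.jetCoord]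
  rw [symArr_of_symm _ (raw_mem σ he hu i)]

theorem jetCoord_eq_change {σ₁ σ₂ : LocalMetric M} {x : M} (h₁ : x ∈ σ₁.dom) (h₂ : x ∈ σ₂.dom)
    {e e' : OpenPartialHomeomorph M E4} (he : e ∈ posAtlas M) (he' : e' ∈ posAtlas M)
    (hx : x ∈ e.source) (hx' : x ∈ e'.source) {k : ℕ}
    (h : σ₁.jetCoord k e (e x) = σ₂.jetCoord k e (e x)) :
    σ₁.jetCoord k e' (e' x) = σ₂.jetCoord k e' (e' x) := by
  have hu₁ : e x ∈ e.target ∩ e.symm ⁻¹' σ₁.dom := mem_dom_coord hx h₁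
  have hu₂ : e x ∈ e.target ∩ e.symm ⁻¹' σ₂.dom := mem_dom_coord hx h₂
  set s : Set E4 := (e.target ∩ e.symm ⁻¹' (σ₁.dom ∩ σ₂.dom : Set M)) with hs
  have so : IsOpen s := e.isOpen_inter_preimage_symm (σ₁.dom.isOpen.inter σ₂.dom.isOpen)
  set t : Set E4 := e'.target ∩ e'.symm ⁻¹' (e.source ∩ (σ₁.dom ∩ σ₂.dom : Set M)) with ht
  have hto : IsOpen t := e'.isOpen_inter_preimage_symm
    (e.open_source.inter (σ₁.dom.isOpen.inter σ₂.dom.isOpen))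
  have c₁ : ContDiffOn ℝ ∞ (comps σ₁.toFun e) s :=
    (σ₁.smooth e he).mono fun y hy => ⟨hy.1, hy.2.1⟩
  have c₂ : ContDiffOn ℝ ∞ (comps σ₂.toFun e) s :=
    (σ₂.smooth e he).mono fun y hy => ⟨hy.1, hy.2.2⟩
  have tsub : t ⊆ e'.target ∩ e'.symm ⁻¹' e.source := fun y hy => ⟨hy.1, hy.2.1⟩
  have hm : MapsTo (e ∘ e'.symm) t s := fun y hy =>
    ⟨e.map_source hy.2.1, by simpa [e.left_inv hy.2.1] using hy.2.2⟩
  have hut : e' x ∈ t := mem_dom_coord hx' ⟨hx, h₁, h₂⟩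
  have hus : e x ∈ s := mem_dom_coord hx ⟨h₁, h₂⟩
  have hex : (e ∘ e'.symm) (e' x) = e x := by simp [e'.left_inv hx']
  have flat : ∀ i ≤ k, iteratedFDeriv ℝ i (fun y => comps σ₁.toFun e y - comps σ₂.toFun e y)
      ((e ∘ e'.symm) (e' x)) = 0 := by
    intro i hi
    rw [hex]
    have hi' : ((i : ℕ∞) : ℕ∞ω) ≤ ∞ := by exact_mod_cast le_top
    have e1 := iteratedFDeriv_sub_apply (i := i) (((c₁.contDiffAt (so.mem_nhds hus))).of_le hi')
      (((c₂.contDiffAt (so.mem_nhds hus))).of_le hi')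
    refine e1.trans (sub_eq_zero.2 (cmm_ext fun l => ?_))
    have a1 := jetCoord_apply σ₁ he hu₁ k ⟨i, Nat.lt_succ_of_le hi⟩ l
    have a2 := jetCoord_apply σ₂ he hu₂ k ⟨i, Nat.lt_succ_of_le hi⟩ l
    rw [h] at a1
    exact a1.symm.trans a2
  have key := flat_pullback so hto (c₁.sub c₂) ((trans_contDiffOn he' he).mono tsub)
    (pullL_contDiff.comp_contDiffOn ((jac_contDiffOn he he').mono tsub)) hm hut flat
  have hu₁' : e' x ∈ e'.target ∩ e'.symm ⁻¹' σ₁.dom := mem_dom_coord hx' h₁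
  have hu₂' : e' x ∈ e'.target ∩ e'.symm ⁻¹' σ₂.dom := mem_dom_coord hx' h₂
  refine Prod.ext rfl (funext fun i => Subtype.ext (funext fun l => ?_))
  rw [jetCoord_apply σ₁ he' hu₁', jetCoord_apply σ₂ he' hu₂']
  have hi' : (((i : ℕ) : ℕ∞) : ℕ∞ω) ≤ ∞ := by exact_mod_cast le_top
  have e1 := iteratedFDeriv_sub_apply (i := i)
    (((σ₁.smooth e' he').contDiffAt
      ((e'.isOpen_inter_preimage_symm σ₁.dom.isOpen).mem_nhds hu₁')).of_le hi')
    (((σ₂.smooth e' he').contDiffAt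
      ((e'.isOpen_inter_preimage_symm σ₂.dom.isOpen).mem_nhds hu₂')).of_le hi')
  have e2 : (comps σ₁.toFun e' - comps σ₂.toFun e') =ᶠ[𝓝 (e' x)]
      fun y => (pullL ∘ jac e' e) y
        ((fun y => comps σ₁.toFun e y - comps σ₂.toFun e y) ((e ∘ e'.symm) y)) := by
    refine Filter.eventuallyEq_of_mem (hto.mem_nhds hut) fun y hy => ?_
    have b1 := comps_change σ₁.toFun he he' (tsub hy)
    have b2 := comps_change σ₂.toFun he he' (tsub hy)
    simp only [Pi.sub_apply, b1, b2, Function.comp, map_sub]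
    rfl
  rw [(e2.iteratedFDeriv ℝ i).eq_of_nhds] at e1
  have e3 := e1.symm.trans (key i (Nat.le_of_lt_succ i.2))
  rw [sub_eq_zero.1 e3]

theorem chart_mdiff {e : OpenPartialHomeomorph M E4} (he : e ∈ posAtlas M) :
    e.MDifferentiable (𝓡 4) (𝓡 4) :=
  ⟨(contMDiffOn_of_mem_maximalAtlas (posAtlas_subset he)).mdifferentiableOn (by simp),
    (contMDiffOn_symm_of_mem_maximalAtlas (posAtlas_subset he)).mdifferentiableOn (by simp)⟩

/-- The bilinear form `(v, w) ↦ c(Av, Aw)`. -/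
def bilinOf (c : Fin 4 → Fin 4 → ℝ) (A : E4 →L[ℝ] E4) : E4 →L[ℝ] E4 →L[ℝ] ℝ :=
  ∑ μ, ∑ ν, c μ ν • ((EuclideanSpace.proj μ : E4 →L[ℝ] ℝ) ∘L A).smulRight
    ((EuclideanSpace.proj ν : E4 →L[ℝ] ℝ) ∘L A)

theorem bilinOf_apply (c : Fin 4 → Fin 4 → ℝ) (A : E4 →L[ℝ] E4) (v w : E4) :
    bilinOf c A v w = matForm c (A v) (A w) := by
  simp only [bilinOf, sum_apply, smul_apply, ContinuousLinearMap.smulRight_apply, matForm]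
  exact Finset.sum_congr rfl fun _ _ => Finset.sum_congr rfl fun _ _ => by
    simp [mul_assoc]

/-- The tensor field with components `g` in the coordinates `e`. -/
def tensorOfComps (e : OpenPartialHomeomorph M E4) (g : E4 → Fin 4 → Fin 4 → ℝ) (y : M) :
    TangentSpace (𝓡 4) y →L[ℝ] TangentSpace (𝓡 4) y →L[ℝ] ℝ :=
  bilinOf (g (e y)) (mfderiv (𝓡 4) (𝓡 4) e y : E4 →L[ℝ] E4)

theorem tensorOfComps_apply {e : OpenPartialHomeomorph M E4} (he : e ∈ posAtlas M)
    (g : E4 → Fin 4 → Fin 4 → ℝ) {u : E4} (hu : u ∈ e.target) (v w : E4) :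
    (tensorOfComps e g (e.symm u) : E4 →L[ℝ] E4 →L[ℝ] ℝ)
      ((mfderiv (𝓡 4) (𝓡 4) e.symm u : E4 →L[ℝ] E4) v)
      ((mfderiv (𝓡 4) (𝓡 4) e.symm u : E4 →L[ℝ] E4) w) = matForm (g u) v w := by
  have h : ∀ v : E4, (mfderiv (𝓡 4) (𝓡 4) e (e.symm u) : E4 →L[ℝ] E4)
      ((mfderiv (𝓡 4) (𝓡 4) e.symm u : E4 →L[ℝ] E4) v) = v := fun v =>
    congrArg (fun T : E4 →L[ℝ] E4 => T v) ((chart_mdiff he).comp_symm_deriv hu)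
  refine (bilinOf_apply _ _ _ _).trans ?_
  exact (congrArg₂ (matForm (g (e (e.symm u)))) (h v) (h w)).trans (by rw [e.right_inv hu])

theorem matForm_bvec (y : Fin 4 → Fin 4 → ℝ) (μ ν : Fin 4) :
    matForm y (bvec μ) (bvec ν) = y μ ν := by
  simp [matForm, bvec]

theorem comps_tensorOfComps {e : OpenPartialHomeomorph M E4} (he : e ∈ posAtlas M)
    (g : E4 → Fin 4 → Fin 4 → ℝ) {u : E4} (hu : u ∈ e.target) :
    comps (tensorOfComps e g) e u = g u := by
  funext μ ν
  exact (tensorOfComps_apply he g hu _ _).trans (matForm_bvec _ _ _)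

/-- The local metric with components `g` in the coordinates `e`. -/
def LocalMetric.ofComps {e : OpenPartialHomeomorph M E4} (he : e ∈ posAtlas M)
    (g : E4 → Fin 4 → Fin 4 → ℝ) (hg : ContDiffOn ℝ ∞ g e.target)
    (hs : ∀ u μ ν, g u μ ν = g u ν μ) : LocalMetric M where
  dom := ⟨e.source ∩ {y | IsLorentzian (matForm (g (e y)))},
    isOpen_lorentzian (f := fun y => g (e y)) e.open_source
      (hg.continuousOn.comp e.continuousOn fun _ hy => e.map_source hy) fun _ => hs _⟩
  toFun := tensorOfComps e g
  lorentzian := fun y hy => by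
    have hyt := e.map_source hy.1
    have key : IsLorentzian (fun v w : TangentSpace (𝓡 4) (e.symm (e y)) =>
        tensorOfComps e g (e.symm (e y)) v w) :=
      IsLorentzian.comp (B := matForm (g (e y))) hy.2
        ((chart_mdiff he).symm.mfderiv hyt).toLinearEquiv
        fun v w => tensorOfComps_apply he g hyt v w
    rwa [e.left_inv hy.1] at key
  smooth := fun e' he' => by
    have hsub : e'.target ∩ e'.symm ⁻¹' (e.source ∩ {y | IsLorentzian (matForm (g (e y)))}) ⊆
        e'.target ∩ e'.symm ⁻¹' e.source := fun y hy => ⟨hy.1, hy.2.1⟩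
    refine ContDiffOn.mono ?_ hsub
    have h1 : ContDiffOn ℝ ∞ (fun u => pull (jac e' e u) (g ((e ∘ e'.symm) u)))
        (e'.target ∩ e'.symm ⁻¹' e.source) :=
      pull_contDiff.comp_contDiffOn ((jac_contDiffOn he he').prodMk
        (hg.comp (trans_contDiffOn he' he) fun y hy => e.map_source hy.2))
    refine h1.congr fun u hu => ?_
    rw [comps_change _ he he' hu, comps_tensorOfComps he g (e.map_source hu.2)]
    rfl

end Jets2

/-- The image of the coordinates on the fibre product. -/
def coordTarget {M : Type*} [TopologicalSpace M] (e : OpenPartialHomeomorph M E4) : Set TotalCoord :=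
  {w | w.1.1 ∈ e.target ∧ IsLorentzian (matForm (yCoord w.1))}

theorem isOpen_coordTarget_inter {M : Type*} [TopologicalSpace M]
    (e : OpenPartialHomeomorph M E4) {s : Set M} (hs : IsOpen s) :
    IsOpen (coordTarget e ∩ {w | e.symm w.1.1 ∈ s}) := by
  have h1 : IsOpen {w : TotalCoord | w.1.1 ∈ e.target ∩ e.symm ⁻¹' s} :=
    (e.isOpen_inter_preimage_symm hs).preimage (by fun_prop)
  have h2 := isOpen_lorentzian (f := fun w : TotalCoord => yCoord w.1) h1
    (by
      refine Continuous.continuousOn (continuous_pi fun μ => continuous_pi fun ν => ?_)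
      exact (zCoord 0 (Nat.zero_le 3) ![] μ ν).continuous.comp continuous_fst)
    (fun w μ ν => (w.1.2 0).2.1 _ μ ν)
  convert h2 using 1
  ext w
  simp only [coordTarget, mem_inter_iff, mem_ofPred_eq, mem_preimage]
  tauto

section Charts

variable {M : Type*} [TopologicalSpace M] [ChartedSpace E4 M]

theorem matForm_comps (σ : LocalMetric M) (e : OpenPartialHomeomorph M E4) (u v w : E4) :
    matForm (comps σ.toFun e u) v w = (σ.toFun (e.symm u) : E4 →L[ℝ] E4 →L[ℝ] ℝ)
      ((mfderiv (𝓡 4) (𝓡 4) e.symm u : E4 →L[ℝ] E4) v)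
      ((mfderiv (𝓡 4) (𝓡 4) e.symm u : E4 →L[ℝ] E4) w) := by
  refine (bilin_sum (σ.toFun (e.symm u)) (fun a => v a) (fun a => w a)
    (fun μ => (mfderiv (𝓡 4) (𝓡 4) e.symm u : E4 →L[ℝ] E4) (bvec μ))).symm.trans ?_
  exact congrArg₂ (fun a b => (σ.toFun (e.symm u) : E4 →L[ℝ] E4 →L[ℝ] ℝ) a b)
    (clm_apply_eq_sum _ v).symm (clm_apply_eq_sum _ w).symm

theorem isLorentzian_comps (σ : LocalMetric M) {e : OpenPartialHomeomorph M E4}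
    (he : e ∈ posAtlas M) {u : E4} (hu : u ∈ e.target ∩ e.symm ⁻¹' σ.dom) :
    IsLorentzian (matForm (comps σ.toFun e u)) := by
  refine IsLorentzian.comp (σ.lorentzian _ hu.2)
    ((chart_mdiff he).symm.mfderiv hu.1).toLinearEquiv.symm fun v w => ?_
  refine (matForm_comps σ e u _ _).trans ?_
  have h : ∀ v, ((chart_mdiff he).symm.mfderiv hu.1).toLinearEquiv
      (((chart_mdiff he).symm.mfderiv hu.1).toLinearEquiv.symm v) = v := fun v =>
    LinearEquiv.apply_symm_apply _ v
  exact congrArg₂ (fun a b => σ.toFun (e.symm u) a b) (h v) (h w)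

theorem yCoord_eq {k : ℕ} (w : JetCoord k) : yCoord w = (w.2 0).1 ![] := rfl

theorem yCoord_jetCoord (σ : LocalMetric M) {e : OpenPartialHomeomorph M E4} (he : e ∈ posAtlas M)
    {u : E4} (hu : u ∈ e.target ∩ e.symm ⁻¹' σ.dom) (k : ℕ) :
    yCoord (σ.jetCoord k e u) = comps σ.toFun e u := by
  exact (jetCoord_apply σ he hu k 0 ![]).trans rfl

theorem polyMetric_self {k : ℕ} (w : JetCoord k) : polyMetric w w.1 = yCoord w :=
  iteratedFDeriv_polyMetric w 0 ![]

/-- The affine function with given `1`-jet. -/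
def LocalScalar.ofCoord [HasGroupoid M orientedGroupoid] {e : OpenPartialHomeomorph M E4}
    (he : e ∈ posAtlas M) (x : E4) (t : ℝ) (z : Fin 4 → ℝ) : LocalScalar M where
  dom := ⟨e.source, e.open_source⟩
  toFun := fun y => t + ∑ a, z a * (e y - x) a
  smooth := by
    have h1 : ContDiff ℝ ∞ (fun u : E4 => t + ∑ a, z a * (u - x) a) := by
      have h : ∀ a : Fin 4, ContDiff ℝ ∞ fun u : E4 => (u - x) a := fun a =>
        (EuclideanSpace.proj (𝕜 := ℝ) a).contDiff.comp (contDiff_id.sub contDiff_const)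
      fun_prop
    exact h1.contMDiff.comp_contMDiffOn (contMDiffOn_of_mem_maximalAtlas (posAtlas_subset he))

theorem scalar_smooth [HasGroupoid M orientedGroupoid] (φ : LocalScalar M)
    {e : OpenPartialHomeomorph M E4} (he : e ∈ posAtlas M) :
    ContDiffOn ℝ ∞ (φ.toFun ∘ e.symm) (e.target ∩ e.symm ⁻¹' φ.dom) := by
  have := isManifold_of_oriented (M := M)
  rw [← contMDiffOn_iff_contDiffOn]
  exact φ.smooth.comp ((contMDiffOn_symm_of_mem_maximalAtlas (posAtlas_subset he)).mono
    inter_subset_left) fun y hy => hy.2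

theorem scalar_change [HasGroupoid M orientedGroupoid] (φ : LocalScalar M)
    {e e' : OpenPartialHomeomorph M E4} (he : e ∈ posAtlas M)
    (he' : e' ∈ posAtlas M) {u : E4} (hu : u ∈ e'.target ∩ e'.symm ⁻¹' e.source)
    (hd : e'.symm u ∈ φ.dom) :
    φ.jetCoord e' u = (u, (φ.jetCoord e (e (e'.symm u))).2.1,
      fun μ => ∑ a, (φ.jetCoord e (e (e'.symm u))).2.2 a * jac e' e u a μ) := by
  have hl : e.symm (e (e'.symm u)) = e'.symm u := e.left_inv hu.2
  have h1 : φ.toFun ∘ e'.symm =ᶠ[𝓝 u] (φ.toFun ∘ e.symm) ∘ (e ∘ e'.symm) :=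
    Filter.eventuallyEq_of_mem ((isOpen_overlap e' e).mem_nhds hu) fun x hx =>
      congrArg φ.toFun (e.left_inv hx.2).symm
  have h2 : DifferentiableAt ℝ (φ.toFun ∘ e.symm) ((e ∘ e'.symm) u) :=
    ((scalar_smooth φ he).contDiffAt
      ((e.isOpen_inter_preimage_symm φ.dom.isOpen).mem_nhds
        (mem_dom_coord hu.2 hd))).differentiableAt (by simp)
  have h3 : DifferentiableAt ℝ (e ∘ e'.symm) u :=
    ((trans_contDiffOn he' he).contDiffAt ((isOpen_overlap e' e).mem_nhds hu)).differentiableAt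
      (by simp)
  refine Prod.ext rfl (Prod.ext ?_ (funext fun μ => ?_))
  · simp [LocalScalar.jetCoord, hl]
  · simp only [LocalScalar.jetCoord]
    rw [h1.fderiv_eq, fderiv_comp u h2 h3, ContinuousLinearMap.comp_apply]
    conv_lhs => rw [eq_sum_bvec (fderiv ℝ (e ∘ e'.symm) u (bvec μ)), map_sum]
    refine Finset.sum_congr rfl fun a _ => ?_
    rw [map_smul, smul_eq_mul, mul_comm]
    rfl

theorem ofCoord_jetCoord [HasGroupoid M orientedGroupoid] {e : OpenPartialHomeomorph M E4}
    (he : e ∈ posAtlas M) {x : E4} (hx : x ∈ e.target) (t : ℝ) (z : Fin 4 → ℝ) :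
    (LocalScalar.ofCoord he x t z).jetCoord e x = (x, t, z) := by
  have h1 : (LocalScalar.ofCoord he x t z).toFun ∘ e.symm =ᶠ[𝓝 x]
      fun u => t + ∑ a, z a * (u - x) a :=
    Filter.eventuallyEq_of_mem (e.open_target.mem_nhds hx) fun u hu => by
      simp [LocalScalar.ofCoord, e.right_inv hu]
  have h2 : HasFDerivAt (fun u : E4 => t + ∑ a, z a * (u - x) a)
      (∑ a, z a • (EuclideanSpace.proj a : E4 →L[ℝ] ℝ)) x := by
    refine HasFDerivAt.const_add t ?_
    refine HasFDerivAt.fun_sum fun a _ => HasFDerivAt.const_mul ?_ _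
    exact (EuclideanSpace.proj (𝕜 := ℝ) a).hasFDerivAt.comp x ((hasFDerivAt_id x).sub_const x)
  refine Prod.ext rfl (Prod.ext ?_ (funext fun μ => ?_))
  · have := h1.eq_of_nhds
    simpa [LocalScalar.jetCoord] using this
  · simp only [LocalScalar.jetCoord]
    rw [h1.fderiv_eq, h2.fderiv]
    simp [bvec, sum_apply]

theorem ofComps_jetCoord {e : OpenPartialHomeomorph M E4} (he : e ∈ posAtlas M) {k : ℕ}
    (w : JetCoord k) (hw : w.1 ∈ e.target) (hL : IsLorentzian (matForm (yCoord w)))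
    (hg : ContDiffOn ℝ ∞ (polyMetric w) e.target)
    (hs : ∀ u μ ν, polyMetric w u μ ν = polyMetric w u ν μ) :
    (LocalMetric.ofComps he (polyMetric w) hg hs).jetCoord k e w.1 = w := by
  have hu : w.1 ∈ e.target ∩ e.symm ⁻¹' (LocalMetric.ofComps he (polyMetric w) hg hs).dom := by
    refine ⟨hw, e.map_target hw, ?_⟩
    change IsLorentzian (matForm (polyMetric w (e (e.symm w.1))))
    rwa [e.right_inv hw, polyMetric_self]
  refine Prod.ext rfl (funext fun i => Subtype.ext (funext fun l => ?_))
  rw [jetCoord_apply _ he hu]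
  have h1 : comps (LocalMetric.ofComps he (polyMetric w) hg hs).toFun e =ᶠ[𝓝 w.1] polyMetric w :=
    Filter.eventuallyEq_of_mem (e.open_target.mem_nhds hw) fun u hu =>
      comps_tensorOfComps he _ hu
  rw [(h1.iteratedFDeriv ℝ i).eq_of_nhds, iteratedFDeriv_polyMetric]

theorem MetricJet.coord_jet (σ : LocalMetric M) (k : ℕ) {x : M} (hx : x ∈ σ.dom)
    {e : OpenPartialHomeomorph M E4} (he : e ∈ posAtlas M) (hxe : x ∈ e.source) :
    (σ.jet k x hx).coord e = σ.jetCoord k e (e x) :=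
  if_pos (⟨he, hxe⟩ : e ∈ posAtlas M ∧ x ∈ e.source)

theorem ScalarJet.coord_jet (φ : LocalScalar M) {x : M} (hx : x ∈ φ.dom)
    {e : OpenPartialHomeomorph M E4} (he : e ∈ posAtlas M) (hxe : x ∈ e.source) :
    (φ.jet x hx).coord e = φ.jetCoord e (e x) :=
  if_pos (⟨he, hxe⟩ : e ∈ posAtlas M ∧ x ∈ e.source)

theorem MetricJet.exists_rep {k : ℕ} (j : MetricJet M k) :
    ∃ (σ : LocalMetric M) (x : M) (hx : x ∈ σ.dom), j = σ.jet k x hx := by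
  obtain ⟨⟨⟨σ, x⟩, hx⟩, rfl⟩ := Quotient.exists_rep j
  exact ⟨σ, x, hx, rfl⟩

theorem ScalarJet.exists_rep (j : ScalarJet M) :
    ∃ (φ : LocalScalar M) (x : M) (hx : x ∈ φ.dom), j = φ.jet x hx := by
  obtain ⟨⟨⟨φ, x⟩, hx⟩, rfl⟩ := Quotient.exists_rep j
  exact ⟨φ, x, hx, rfl⟩

theorem TotalJet.exists_rep (P : TotalJet M) :
    ∃ (σ : LocalMetric M) (φ : LocalScalar M) (x : M) (hσ : x ∈ σ.dom) (hφ : x ∈ φ.dom),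
      P = ⟨σ.jet 3 x hσ, φ.jet x hφ, rfl⟩ := by
  obtain ⟨j, s, h⟩ := P
  obtain ⟨σ, x, hx, rfl⟩ := j.exists_rep
  obtain ⟨φ, y, hy, rfl⟩ := s.exists_rep
  obtain rfl : x = y := h
  exact ⟨σ, φ, x, hx, hy, rfl⟩

theorem polyMetric_contDiffOn {k : ℕ} (w : JetCoord k) (s : Set E4) :
    ContDiffOn ℝ ∞ (polyMetric w) s :=
  ((polyMetric_contDiff k).comp (contDiff_const.prodMk contDiff_id)).contDiffOn

theorem mem_dom_ofComps {e : OpenPartialHomeomorph M E4}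
    (he : e ∈ posAtlas M) {w : TotalCoord} (hw : w ∈ coordTarget e) :
    e.symm w.1.1 ∈ (LocalMetric.ofComps he (polyMetric w.1) (polyMetric_contDiffOn _ _)
      (polyMetric_symm _)).dom := by
  refine ⟨e.map_target hw.1, ?_⟩
  change IsLorentzian (matForm (polyMetric w.1 (e (e.symm w.1.1))))
  rw [e.right_inv hw.1, polyMetric_self]
  exact hw.2

theorem mem_dom_ofCoord [HasGroupoid M orientedGroupoid] {e : OpenPartialHomeomorph M E4}
    (he : e ∈ posAtlas M) {w : TotalCoord} (hw : w ∈ coordTarget e) :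
    e.symm w.1.1 ∈ (LocalScalar.ofCoord he w.1.1 w.2.1 w.2.2).dom :=
  e.map_target hw.1

/-- The jet with given coordinates. -/
def TotalJet.ofCoord [HasGroupoid M orientedGroupoid] {e : OpenPartialHomeomorph M E4}
    (he : e ∈ posAtlas M) (w : TotalCoord) (hw : w ∈ coordTarget e) : TotalJet M where
  grav := (LocalMetric.ofComps he (polyMetric w.1) (polyMetric_contDiffOn _ _)
      (polyMetric_symm _)).jet 3 (e.symm w.1.1) (mem_dom_ofComps he hw)
  matter := (LocalScalar.ofCoord he w.1.1 w.2.1 w.2.2).jet (e.symm w.1.1)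
    (mem_dom_ofCoord he hw)
  base_eq := rfl

theorem TotalJet.coord_ofCoord [HasGroupoid M orientedGroupoid] {e : OpenPartialHomeomorph M E4}
    (he : e ∈ posAtlas M) (w : TotalCoord) (hw : w ∈ coordTarget e) :
    (TotalJet.ofCoord he w hw).coord e = w := by
  have h1 := MetricJet.coord_jet _ 3 (mem_dom_ofComps he hw) he (e.map_target hw.1)
  have h2 := ScalarJet.coord_jet _ (mem_dom_ofCoord he hw) he (e.map_target hw.1)
  rw [e.right_inv hw.1] at h1 h2
  refine Prod.ext ?_ ?_
  · exact h1.trans (ofComps_jetCoord he w.1 hw.1 hw.2 _ _)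
  · exact congrArg (fun p : E4 × ℝ × (Fin 4 → ℝ) => p.2)
      (h2.trans (ofCoord_jetCoord he hw.1 _ _))

theorem TotalJet.coord_bijOn [HasGroupoid M orientedGroupoid] {e : OpenPartialHomeomorph M E4}
    (he : e ∈ posAtlas M) :
    BijOn (TotalJet.coord e) {P : TotalJet M | P.base ∈ e.source} (coordTarget e) := by
  refine ⟨?_, ?_, ?_⟩
  · intro P hP
    obtain ⟨σ, φ, x, hσ, hφ, rfl⟩ := P.exists_rep
    have hx : x ∈ e.source := hP
    simp only [TotalJet.coord]
    rw [MetricJet.coord_jet _ _ _ he hx]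
    refine ⟨e.map_source hx, ?_⟩
    simp only
    rw [yCoord_jetCoord σ he (mem_dom_coord hx hσ)]
    exact isLorentzian_comps σ he (mem_dom_coord hx hσ)
  · intro P hP Q hQ h
    obtain ⟨σ, φ, x, hσ, hφ, rfl⟩ := P.exists_rep
    obtain ⟨σ', φ', y, hσ', hφ', rfl⟩ := Q.exists_rep
    have hx : x ∈ e.source := hP
    have hy : y ∈ e.source := hQ
    simp only [TotalJet.coord] at h
    rw [MetricJet.coord_jet _ _ _ he hx, MetricJet.coord_jet _ _ _ he hy,
      ScalarJet.coord_jet _ _ he hx, ScalarJet.coord_jet _ _ he hy] at h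
    have h1 := congrArg Prod.fst h
    have h2 := congrArg Prod.snd h
    have hxy : e x = e y := congrArg Prod.fst h1
    obtain rfl : x = y := e.injOn hx hy hxy
    refine TotalJet.ext ?_ ?_
    · exact Quotient.sound (s := metricJetSetoid M 3)
        ⟨rfl, fun e' he' hx' => jetCoord_eq_change hσ hσ' he he' hx hx' h1⟩
    · refine Quotient.sound (s := scalarJetSetoid M) ⟨rfl, fun e' he' hx' => ?_⟩
      have hx'' : x ∈ e'.source := hx'
      have h3 : φ.jetCoord e (e x) = φ'.jetCoord e (e x) := Prod.ext rfl h2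
      change φ.jetCoord e' (e' x) = φ'.jetCoord e' (e' x)
      have hd : ∀ {s : Set M}, x ∈ s → e' x ∈ e'.target ∩ e'.symm ⁻¹' s := mem_dom_coord hx''
      rw [scalar_change φ he he' (hd hx) (hd hφ).2, scalar_change φ' he he' (hd hx) (hd hφ').2,
        e'.left_inv hx'', h3]
  · intro w hw
    exact ⟨TotalJet.ofCoord he w hw, e.map_target hw.1, TotalJet.coord_ofCoord he w hw⟩

theorem polyMetric_comp {X : Type*} [NormedAddCommGroup X] [NormedSpace ℝ X] {k : ℕ}
    {a : X → JetCoord k × E4} {s : Set X} (ha : ContDiffOn ℝ ∞ a s) :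
    ContDiffOn ℝ ∞ (fun x => polyMetric (a x).1 (a x).2) s := by
  have h := polyMetric_contDiff k
  exact h.comp_contDiffOn ha

theorem coord_change_formula [HasGroupoid M orientedGroupoid]
    {e e' : OpenPartialHomeomorph M E4} (he : e ∈ posAtlas M) (he' : e' ∈ posAtlas M)
    {w : TotalCoord} (hw : w ∈ coordTarget e) (hw' : e.symm w.1.1 ∈ e'.source) :
    (TotalJet.ofCoord he w hw).coord e' = ((((e' ∘ e.symm) w.1.1,
      fun i : Fin 4 => symArr i fun l =>
      iteratedFDeriv ℝ i (fun u => pull (jac e' e u) (polyMetric w.1 ((e ∘ e'.symm) u)))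
        ((e' ∘ e.symm) w.1.1) fun j => bvec (l j)) : JetCoord 3), w.2.1,
      fun μ => ∑ a, w.2.2 a * jac e' e ((e' ∘ e.symm) w.1.1) a μ) := by
  have hm : (e' ∘ e.symm) w.1.1 ∈ e'.target ∩ e'.symm ⁻¹' e.source :=
    mem_dom_coord hw' (e.map_target hw.1)
  have hi : e (e'.symm ((e' ∘ e.symm) w.1.1)) = w.1.1 := by
    simp only [Function.comp]
    rw [e'.left_inv hw', e.right_inv hw.1]
  have a1 := MetricJet.coord_jet _ 3 (mem_dom_ofComps he hw) he' hw'
  have a2 := ScalarJet.coord_jet _ (mem_dom_ofCoord he hw) he' hw'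
  refine Prod.ext ?_ ?_
  · refine a1.trans (Prod.ext rfl (funext fun i => ?_))
    refine congrArg (symArr i) (funext fun l => ?_)
    have h1 : comps (LocalMetric.ofComps he (polyMetric w.1) (polyMetric_contDiffOn _ _)
        (polyMetric_symm _)).toFun e' =ᶠ[𝓝 ((e' ∘ e.symm) w.1.1)]
        fun u => pull (jac e' e u) (polyMetric w.1 ((e ∘ e'.symm) u)) :=
      Filter.eventuallyEq_of_mem ((isOpen_overlap e' e).mem_nhds hm) fun u hu => by
        refine (comps_change _ he he' hu).trans ?_
        exact congrArg (pull _) (comps_tensorOfComps he _ (e.map_source hu.2))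
    exact congrArg (fun T : ContinuousMultilinearMap ℝ (fun _ : Fin i => E4) _ =>
      T fun j => bvec (l j)) ((h1.iteratedFDeriv ℝ i).eq_of_nhds)
  · refine (congrArg Prod.snd a2).trans ?_
    have h2 := scalar_change (LocalScalar.ofCoord he w.1.1 w.2.1 w.2.2) he he' hm hm.2
    rw [hi, ofCoord_jetCoord he hw.1] at h2
    exact congrArg Prod.snd h2

theorem pull_comp {X : Type*} [NormedAddCommGroup X] [NormedSpace ℝ X]
    {a : X → (Fin 4 → Fin 4 → ℝ) × (Fin 4 → Fin 4 → ℝ)} {s : Set X} (ha : ContDiffOn ℝ ∞ a s) :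
    ContDiffOn ℝ ∞ (fun x => pull (a x).1 (a x).2) s := by
  have h := pull_contDiff
  exact h.comp_contDiffOn ha

theorem change_contDiffOn {e e' : OpenPartialHomeomorph M E4} (he : e ∈ posAtlas M)
    (he' : e' ∈ posAtlas M) {k : ℕ} :
    ContDiffOn ℝ ∞ (Function.uncurry fun (w : JetCoord k) (u : E4) =>
      pull (jac e' e u) (polyMetric w ((e ∘ e'.symm) u)))
      (univ ×ˢ (e'.target ∩ e'.symm ⁻¹' e.source)) := by
  have h1 : ContDiffOn ℝ ∞ (fun p : JetCoord k × E4 => jac e' e p.2)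
      (univ ×ˢ (e'.target ∩ e'.symm ⁻¹' e.source)) :=
    (jac_contDiffOn he he').comp contDiffOn_snd fun p hp => hp.2
  have h3 : ContDiffOn ℝ ∞ (fun p : JetCoord k × E4 => (e ∘ e'.symm) p.2)
      (univ ×ˢ (e'.target ∩ e'.symm ⁻¹' e.source)) :=
    (trans_contDiffOn he' he).comp contDiffOn_snd fun p hp => hp.2
  have h4 : ContDiffOn ℝ ∞ (fun p : JetCoord k × E4 => (p.1, (e ∘ e'.symm) p.2))
      (univ ×ˢ (e'.target ∩ e'.symm ⁻¹' e.source)) := contDiffOn_fst.prodMk h3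
  have h2 := polyMetric_comp h4
  have h5 := h1.prodMk h2
  have h6 := pull_comp h5
  exact h6

/-- The coordinate changes on the fibre product are smooth. -/
theorem coord_change_contDiffOn [HasGroupoid M orientedGroupoid]
    {e e' : OpenPartialHomeomorph M E4} (he : e ∈ posAtlas M) (he' : e' ∈ posAtlas M)
    {f : TotalCoord → TotalCoord}
    (hf : ∀ w (hw : w ∈ coordTarget e), f w = (TotalJet.ofCoord he w hw).coord e') :
    ContDiffOn ℝ ∞ f (coordTarget e ∩ {w | e.symm w.1.1 ∈ e'.source}) := by
  set χ : TotalCoord → E4 := fun w => (e' ∘ e.symm) w.1.1 with hχ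
  set S := coordTarget e ∩ {w : TotalCoord | e.symm w.1.1 ∈ e'.source} with hS
  have hχs : ContDiffOn ℝ ∞ χ S :=
    (trans_contDiffOn he he').comp (by fun_prop) fun w hw => ⟨hw.1.1, hw.2⟩
  have hχm : ∀ w ∈ S, χ w ∈ e'.target ∩ e'.symm ⁻¹' e.source := fun w hw =>
    mem_dom_coord hw.2 (e.map_target hw.1.1)
  set G : JetCoord 3 → E4 → Fin 4 → Fin 4 → ℝ := fun w u =>
    pull (jac e' e u) (polyMetric w ((e ∘ e'.symm) u)) with hG
  have hGs := change_contDiffOn (k := 3) he he'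
  have hform : ∀ w ∈ S, f w = (((χ w, fun i : Fin 4 => symArr i fun l =>
      iteratedFDeriv ℝ i (G w.1) (χ w) fun j => bvec (l j)) : JetCoord 3), w.2.1,
      fun μ => ∑ a, w.2.2 a * jac e' e (χ w) a μ) := fun w hw =>
    (hf w hw.1).trans (coord_change_formula he he' hw.1 hw.2)
  refine ContDiffOn.congr ?_ hform
  refine ContDiffOn.prodMk (hχs.prodMk (contDiffOn_pi.2 fun i => ?_))
    (ContDiffOn.prodMk (by fun_prop) (contDiffOn_pi.2 fun μ => ?_))
  · refine (LinearMap.toContinuousLinearMap (symArr i)).contDiff.comp_contDiffOn ?_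
    refine contDiffOn_pi.2 fun l => ?_
    have h1 := contDiffAt_iteratedFDeriv_param (isOpen_univ.prod (isOpen_overlap e' e)) hGs i
    have h2 : ContDiffOn ℝ ∞ (fun w : TotalCoord => iteratedFDeriv ℝ i (G w.1) (χ w)) S :=
      h1.comp (f := fun w : TotalCoord => (w.1, χ w)) (contDiffOn_fst.prodMk hχs)
        fun w hw => ⟨mem_univ _, hχm w hw⟩
    exact (ContinuousMultilinearMap.apply ℝ (fun _ : Fin i => E4) (Fin 4 → Fin 4 → ℝ)
      (fun j => bvec (l j))).contDiff.comp_contDiffOn h2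
  · have h1 : ContDiffOn ℝ ∞ (fun w => jac e' e (χ w)) S :=
      (jac_contDiffOn he he').comp hχs hχm
    refine ContDiffOn.sum fun a _ => ContDiffOn.mul ?_ ?_
    · exact ContDiff.contDiffOn (by fun_prop)
    · exact contDiffOn_pi.1 (contDiffOn_pi.1 h1 a) μ

theorem coord_symm [HasGroupoid M orientedGroupoid] {e : OpenPartialHomeomorph M E4}
    (he : e ∈ posAtlas M) {c : PartialEquiv (TotalJet M) TotalCoord}
    (h1 : c.source = {P | P.base ∈ e.source}) (h2 : c.target = coordTarget e)
    (h3 : ∀ P, c P = P.coord e) {w : TotalCoord} (hw : w ∈ coordTarget e) :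
    c.symm w = TotalJet.ofCoord he w hw := by
  have hs : c.symm w ∈ {P : TotalJet M | P.base ∈ e.source} := h1 ▸ c.map_target (h2 ▸ hw)
  refine (TotalJet.coord_bijOn he).injOn hs (e.map_target hw.1) ?_
  rw [TotalJet.coord_ofCoord, ← h3]
  exact c.right_inv (h2 ▸ hw)

theorem coord_trans_source [HasGroupoid M orientedGroupoid] {e e' : OpenPartialHomeomorph M E4}
    (he : e ∈ posAtlas M) {c c' : PartialEquiv (TotalJet M) TotalCoord}
    (h1 : c.source = {P | P.base ∈ e.source}) (h2 : c.target = coordTarget e)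
    (h3 : ∀ P, c P = P.coord e) (h1' : c'.source = {P | P.base ∈ e'.source}) :
    (c.symm.trans c').source = coordTarget e ∩ {w | e.symm w.1.1 ∈ e'.source} := by
  ext w
  simp only [PartialEquiv.trans_source, PartialEquiv.symm_source, h2, h1', mem_inter_iff,
    mem_preimage]
  refine and_congr_right fun hw => ?_
  rw [coord_symm he h1 h2 h3 hw]
  rfl

theorem coord_trans_contDiffOn [HasGroupoid M orientedGroupoid]
    {e e' : OpenPartialHomeomorph M E4}
    (he : e ∈ posAtlas M) (he' : e' ∈ posAtlas M) {c c' : PartialEquiv (TotalJet M) TotalCoord}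
    (h1 : c.source = {P | P.base ∈ e.source}) (h2 : c.target = coordTarget e)
    (h3 : ∀ P, c P = P.coord e) (h1' : c'.source = {P | P.base ∈ e'.source})
    (h3' : ∀ P, c' P = P.coord e') :
    ContDiffOn ℝ ∞ (c.symm.trans c') (c.symm.trans c').source := by
  rw [coord_trans_source he h1 h2 h3 h1']
  refine coord_change_contDiffOn he he' fun w hw => ?_
  exact (h3' _).trans (congrArg (TotalJet.coord e') (coord_symm he h1 h2 h3 hw))

variable (M) in
/-- The manifold structure of the fibre product `J³(M,N) ×_M J¹(M,K)`: its charts are the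
coordinates induced by positively oriented coordinates on `M`. -/
def totalJetCore [HasGroupoid M orientedGroupoid] : ChartedSpaceCore TotalCoord (TotalJet M) where
  atlas := {c | ∃ e ∈ posAtlas M, c.source = {P | P.base ∈ e.source} ∧ c.target = coordTarget e ∧
    ∀ P, c P = P.coord e}
  chartAt P :=
    have : Nonempty (TotalJet M) := ⟨P⟩
    (TotalJet.coord_bijOn (chartAt_mem_posAtlas P.base)).toPartialEquiv
  mem_chart_source P := mem_chart_source E4 P.base
  chart_mem_atlas P := ⟨chartAt E4 P.base, chartAt_mem_posAtlas _, rfl, rfl, fun _ => rfl⟩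
  open_source := by
    rintro c c' ⟨e, he, h1, h2, h3⟩ ⟨e', he', h1', h2', h3'⟩
    rw [coord_trans_source he h1 h2 h3 h1']
    exact isOpen_coordTarget_inter e e'.open_source
  continuousOn_toFun := by
    rintro c c' ⟨e, he, h1, h2, h3⟩ ⟨e', he', h1', h2', h3'⟩
    exact (coord_trans_contDiffOn he he' h1 h2 h3 h1' h3').continuousOn

instance [HasGroupoid M orientedGroupoid] : TopologicalSpace (TotalJet M) :=
  (totalJetCore M).toTopologicalSpace

instance [HasGroupoid M orientedGroupoid] : ChartedSpace TotalCoord (TotalJet M) :=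
  (totalJetCore M).toChartedSpace

instance [HasGroupoid M orientedGroupoid] : IsManifold 𝓘(ℝ, TotalCoord) ∞ (TotalJet M) := by
  refine isManifold_of_contDiffOn _ _ _ fun c c' hc hc' => ?_
  obtain ⟨d, hd, rfl⟩ := mem_iUnion₂.1 hc
  obtain ⟨d', hd', rfl⟩ := mem_iUnion₂.1 hc'
  obtain ⟨e, he, h1, h2, h3⟩ := hd
  obtain ⟨e', he', h1', h2', h3'⟩ := hd'
  simpa using! coord_trans_contDiffOn he he' h1 h2 h3 h1' h3'

end Charts

/-! ## Invariant Lagrangians and momenta -/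

section DeDonder

variable {M : Type*} [TopologicalSpace M] [ChartedSpace E4 M]

/-- An invariant Lagrangian of second order gravity: a smooth scalar density on `J²(M,N)`. It is
given by its coordinate expressions `L e = L(x^μ, y_{μν}, z_{μνα}, z_{μναβ})`, one for each
positively oriented coordinate system `e` on `M`, which are smooth functions on the range of the
induced coordinates of `J²(M,N)` and satisfy `L' det(∂x'/∂x) = L`, that is, `L' d₄x' = L d₄x`.
Expressions `L e` which are given by the same function for all `e` are allowed, and so are
expressions that depend on the point of `M`. -/
def IsInvariantLagrangian (L : OpenPartialHomeomorph M E4 → JetCoord 2 → ℝ) : Prop :=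
  (∀ e ∈ posAtlas M,
    ContDiffOn ℝ ∞ (L e) {w | w.1 ∈ e.target ∧ IsLorentzian (matForm (yCoord w))}) ∧
  ∀ e ∈ posAtlas M, ∀ e' ∈ posAtlas M, ∀ j : MetricJet M 2, j.base ∈ e.source →
    j.base ∈ e'.source →
    L e' (j.coord e') * (fderiv ℝ (e' ∘ e.symm) (e j.base)).det = L e (j.coord e)

/-- The inverse `g^{μν}` of a matrix `g_{μν}`. -/
def invMetric (y : Fin 4 → Fin 4 → ℝ) (μ ν : Fin 4) : ℝ := (Matrix.of y)⁻¹ μ ν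

/-- The density `√(-det g)`. -/
def volDensity (y : Fin 4 → Fin 4 → ℝ) : ℝ := Real.sqrt (-(Matrix.of y).det)

/-- The coordinate expression `(½ g^{μν} z_μ z_ν + V(t)) √(-det g)` of the matter Lagrangian. -/
def matterLagrangian (V : ℝ → ℝ) (w : TotalCoord) : ℝ :=
  ((1 / 2 : ℝ) * ∑ μ, ∑ ν, invMetric (yCoord w.1) μ ν * w.2.2 μ * w.2.2 ν + V w.2.1) *
    volDensity (yCoord w.1)

variable (M) in
/-- Coefficient functions `p^{μναβ}`, `p^{μνα}` on `J³(M,N)` and `q^μ` on the fibre product. -/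
structure Momenta where
  p2 : Fin 4 → Fin 4 → Fin 4 → Fin 4 → MetricJet M 3 → ℝ
  p1 : Fin 4 → Fin 4 → Fin 4 → MetricJet M 3 → ℝ
  q : Fin 4 → TotalJet M → ℝ

/-- `𝔭` consists, over the domain of the coordinates `e`, of the momenta of the Lagrangian `L` and
of the matter Lagrangian: for all local sections `σ` of `N` (with components `g_{μν}`) and `φ` of
`K`,
* `(j³σ)^* p^{μναβ} = (j²σ)^* ∂L/∂z_{μναβ}`,
* `(j³σ)^* p^{μνα} = (j²σ)^* ∂L/∂z_{μνα} - ∂/∂x^β ((j²σ)^* ∂L/∂z_{μναβ})`,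
* `(j³σ, j¹φ)^* q^μ = g^{μν} φ_{,ν} √(-det g)`. -/
structure IsMomenta (L : OpenPartialHomeomorph M E4 → JetCoord 2 → ℝ)
    (e : OpenPartialHomeomorph M E4) (𝔭 : Momenta M) : Prop where
  p2_eq : ∀ (σ : LocalMetric M) (x : M) (hx : x ∈ σ.dom), x ∈ e.source → ∀ μ ν α β,
    𝔭.p2 μ ν α β (σ.jet 3 x hx) = partialZ (L e) 2 le_rfl ![α, β] μ ν (σ.jetCoord 2 e (e x))
  p1_eq : ∀ (σ : LocalMetric M) (x : M) (hx : x ∈ σ.dom), x ∈ e.source → ∀ μ ν α,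
    𝔭.p1 μ ν α (σ.jet 3 x hx) =
      partialZ (L e) 1 one_le_two ![α] μ ν (σ.jetCoord 2 e (e x)) -
        ∑ β, fderiv ℝ (fun u => partialZ (L e) 2 le_rfl ![α, β] μ ν (σ.jetCoord 2 e u)) (e x)
          (bvec β)
  q_eq : ∀ (σ : LocalMetric M) (φ : LocalScalar M) (x : M) (hσ : x ∈ σ.dom) (hφ : x ∈ φ.dom),
    x ∈ e.source → ∀ μ,
    𝔭.q μ ⟨σ.jet 3 x hσ, φ.jet x hφ, rfl⟩ =
      (∑ ν, invMetric (comps σ.toFun e (e x)) μ ν *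
        fderiv ℝ (φ.toFun ∘ e.symm) (e x) (bvec ν)) * volDensity (comps σ.toFun e (e x))

/-! ## The De Donder form -/

/-- The wedge product `η ∧ ξ` of a `1`-form and a `k`-form,
`(η ∧ ξ)(v₀, …, vₖ) = ∑ᵢ (-1)ⁱ η(vᵢ) ξ(v₀, …, vᵢ₋₁, vᵢ₊₁, …, vₖ)`. -/
def wedge {k : ℕ} (η : TotalCoord →L[ℝ] ℝ) (ξ : TotalCoord [⋀^Fin k]→L[ℝ] ℝ) :
    TotalCoord [⋀^Fin (k + 1)]→L[ℝ] ℝ :=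
  ContinuousAlternatingMap.alternatizeUncurryFin (η.smulRight ξ)

/-- The form `dx^μ`. -/
def dx (μ : Fin 4) : TotalCoord →L[ℝ] ℝ :=
  (EuclideanSpace.proj μ : E4 →L[ℝ] ℝ) ∘L ContinuousLinearMap.fst ℝ _ _ ∘L
    ContinuousLinearMap.fst ℝ _ _

/-- The form `dz_{μνλ₁…λᵢ}` (and `dy_{μν}` for `i = 0`). -/
def dz (i : ℕ) (hi : i ≤ 3) (l : Fin i → Fin 4) (μ ν : Fin 4) : TotalCoord →L[ℝ] ℝ :=
  zCoord i hi l μ ν ∘L ContinuousLinearMap.fst ℝ _ _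

/-- The form `dt`. -/
def dt : TotalCoord →L[ℝ] ℝ :=
  ContinuousLinearMap.fst ℝ _ _ ∘L ContinuousLinearMap.snd ℝ _ _

/-- The form `d₄x = dx⁰ ∧ dx¹ ∧ dx² ∧ dx³`. -/
def d4x : TotalCoord [⋀^Fin 4]→L[ℝ] ℝ :=
  wedge (dx 0) (wedge (dx 1) (wedge (dx 2) (wedge (dx 3)
    (ContinuousAlternatingMap.constOfIsEmpty ℝ TotalCoord (Fin 0) 1))))

/-- The form `∂_β ⌟ d₄x`. -/
def d3x (β : Fin 4) : TotalCoord [⋀^Fin 3]→L[ℝ] ℝ := d4x.curryLeft ((bvec β, 0), 0)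

/-- The contact form `dz_{μνα} - z_{μναγ} dx^γ` at the point `w`. -/
def contactZ (w : TotalCoord) (μ ν α : Fin 4) : TotalCoord →L[ℝ] ℝ :=
  dz 1 (by norm_num) ![α] μ ν - ∑ γ, zCoord 2 (by norm_num) ![α, γ] μ ν w.1 • dx γ

/-- The contact form `dy_{μν} - z_{μνβ} dx^β` at the point `w`. -/
def contactY (w : TotalCoord) (μ ν : Fin 4) : TotalCoord →L[ℝ] ℝ :=
  dz 0 (by norm_num) ![] μ ν - ∑ β, zCoord 1 (by norm_num) ![β] μ ν w.1 • dx β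

/-- The contact form `dt - z_ν dx^ν` at the point `w`. -/
def contactT (w : TotalCoord) : TotalCoord →L[ℝ] ℝ := dt - ∑ ν, w.2.2 ν • dx ν

/-- The coordinate expression of the total De Donder form, at the point `P` of the fibre product
and in the coordinates induced by `e`:
`L d₄x + p^{μναβ} (dz_{μνα} - z_{μναγ} dx^γ) ∧ (∂_β ⌟ d₄x)
  + p^{μνα} (dy_{μν} - z_{μνβ} dx^β) ∧ (∂_α ⌟ d₄x)
  + L_matter d₄x + q^μ (dt - z_ν dx^ν) ∧ (∂_μ ⌟ d₄x)`. -/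
def deDonderCoord (L : OpenPartialHomeomorph M E4 → JetCoord 2 → ℝ) (V : ℝ → ℝ)
    (e : OpenPartialHomeomorph M E4) (𝔭 : Momenta M) (P : TotalJet M) :
    TotalCoord [⋀^Fin 4]→L[ℝ] ℝ :=
  L e (trunc (P.coord e).1) • d4x +
  ∑ μ, ∑ ν, ∑ α, ∑ β, 𝔭.p2 μ ν α β P.grav • wedge (contactZ (P.coord e) μ ν α) (d3x β) +
  ∑ μ, ∑ ν, ∑ α, 𝔭.p1 μ ν α P.grav • wedge (contactY (P.coord e) μ ν) (d3x α) +
  matterLagrangian V (P.coord e) • d4x +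
  ∑ μ, 𝔭.q μ P • wedge (contactT (P.coord e)) (d3x μ)

/-- A differential form of degree `4` on the fibre product (with no condition on its dependence on
the point). -/
abbrev FourForm (M : Type*) [TopologicalSpace M] [ChartedSpace E4 M]
    [HasGroupoid M orientedGroupoid] : Type _ :=
  (P : TotalJet M) → TangentSpace 𝓘(ℝ, TotalCoord) P [⋀^Fin 4]→L[ℝ] ℝ

/-- Smoothness of a `4`-form: its expressions in the charts of the fibre product are smooth. -/
def IsSmoothForm [HasGroupoid M orientedGroupoid] (Θ : FourForm M) : Prop :=
  ∀ c ∈ atlas TotalCoord (TotalJet M),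
    ContDiffOn ℝ ∞ (fun w : TotalCoord =>
      ((Θ (c.symm w)).compContinuousLinearMap
        (mfderiv 𝓘(ℝ, TotalCoord) 𝓘(ℝ, TotalCoord) c.symm w) : TotalCoord [⋀^Fin 4]→L[ℝ] ℝ))
      c.target

/-- The `4`-form on the fibre product, over the domain of the coordinates `e`, with the coordinate
expression `deDonderCoord`. -/
def deDonderForm [HasGroupoid M orientedGroupoid]
    (L : OpenPartialHomeomorph M E4 → JetCoord 2 → ℝ) (V : ℝ → ℝ)
    (e : OpenPartialHomeomorph M E4) (𝔭 : Momenta M) : FourForm M := fun P =>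
  (deDonderCoord L V e 𝔭 P).compContinuousLinearMap
    (mfderiv 𝓘(ℝ, TotalCoord) 𝓘(ℝ, TotalCoord) (TotalJet.coord e) P)

end DeDonder

end

/-!
The terms of `Θ_total` are of the form `ℓ d₄x + j^β ∧ (∂_β ⌟ d₄x)` (`lepageForm`) with a function
`ℓ = L + L_matter` and `1`-forms `j^β`. Such a form does not depend on the coordinates if `ℓ` is a
scalar density and the `j^β` transform, under pullback, as the components of a vector density
(`lepageForm_comp`). For `ℓ` and for the part `q^β (dt - z_ν dx^ν)` of `j^β` this is a direct
computation.

The gravitational part of `j^β` is understood through variations. Let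
`D h = A^{αβ} h_{,αβ} + B^α h_{,α} + C h` be the linearization of the Lagrangian at a metric `g`,
acting on variations `h` of `g`. A tangent vector `v` at the jet `j³g` is, up to a vector tangent
to the prolonged section, the jet of a variation `h`, and the contact forms read off the `1`-jet of
`h` (`contact_eq`). Hence
`j^β(v)` is the boundary current `J^β = p^{μναβ} h_{μν,α} + p^{μνβ} h_{μν}` of `h` in the first
variation formula (`deDonderCurrent_apply`), and since this description of tangent vectors is
compatible with coordinate changes (`fderiv_coord_change`), it remains to see that `J` is a vector
density.

The Lagrangian being invariant, `D h` is a scalar density (`variation_push`). Applied to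
`(x^a - u^a) (x^c - u^c) h` at `u`, this shows that the symbol `S^{αβ} = A^{αβ} h` is a tensor
density (`symbolAt_push`). Applied to `(x^c - u^c) h`, it gives the transformation law of
`X^α = 2 A^{αβ} h_{,β} + B^α h`, which is that of a vector density up to a term with the second
derivatives of the coordinate change. By the Piola identity (`divergence_density`) the divergence
`∂_β S^{βα}` has the same additional term, and `J^α = X^α - ∂_β S^{βα}` (`current_eq`) is a vector
density (`current_push`).

The momenta are functions on the jet spaces because the derivative along a section which occurs in
`p^{μνα}` is a total derivative (`momentumOne_jetOf`), and the coordinate expressions are smooth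
because Lorentzian matrices are invertible (`IsLorentzian.det_ne_zero`).
-/

noncomputable section

/-! ### Jets of tensor components and vertical derivatives -/

/-- The partial derivative `∂_α f` of a function on `ℝ⁴`. -/
def pd {V : Type*} [NormedAddCommGroup V] [NormedSpace ℝ V] (f : E4 → V) (α : Fin 4) (u : E4) : V :=
  fderiv ℝ f u (bvec α)

/-- The coordinates of the `k`-jet at `u` of the components `g` of a symmetric tensor field. -/
def jetOf (k : ℕ) (g : E4 → Fin 4 → Fin 4 → ℝ) (u : E4) : JetCoord k :=
  (u, fun i => symArr i fun l => iteratedFDeriv ℝ i g u fun j => bvec (l j))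

theorem symArr_eq_sum (i : ℕ) (a : (Fin i → Fin 4) → Fin 4 → Fin 4 → ℝ) :
    symArr i a = ∑ μ, ∑ ν, ∑ l, a l μ ν •
      symArr i (Pi.single l (Pi.single μ (Pi.single ν 1))) := by
  simp only [← map_smul, ← map_sum]
  congr 1
  ext l μ ν
  simp only [Finset.sum_apply, Pi.smul_apply, smul_eq_mul]
  rw [Finset.sum_eq_single μ, Finset.sum_eq_single ν, Finset.sum_eq_single l]
  · simp
  · intro m _ hm
    simp [Pi.single_eq_of_ne' hm]
  · simp
  · intro m _ hm
    refine Finset.sum_eq_zero fun m' _ => ?_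
    by_cases h : l = m'
    · subst h; simp [Pi.single_eq_of_ne' hm]
    · simp [Pi.single_eq_of_ne h]
  · simp
  · intro m _ hm
    refine Finset.sum_eq_zero fun n _ => Finset.sum_eq_zero fun m' _ => ?_
    by_cases h : l = m'
    · subst h; simp [Pi.single_eq_of_ne' hm]
    · simp [Pi.single_eq_of_ne h]
  · simp

theorem sum_fin_one_arrow {V : Type*} [AddCommMonoid V] (f : (Fin 1 → Fin 4) → V) :
    ∑ l, f l = ∑ α, f ![α] := by
  refine Fintype.sum_equiv (Equiv.funUnique (Fin 1) (Fin 4)) _ _ fun l => ?_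
  congr 1
  ext j
  rw [Subsingleton.elim j 0]
  rfl

theorem sum_fin_two_arrow {V : Type*} [AddCommMonoid V] (f : (Fin 2 → Fin 4) → V) :
    ∑ l, f l = ∑ α, ∑ β, f ![α, β] := by
  rw [← Fintype.sum_prod_type']
  refine Fintype.sum_equiv (finTwoArrowEquiv (Fin 4)) _ _ fun l => ?_
  congr 1
  ext j
  fin_cases j <;> rfl

/-- The derivative of a function of second order jets in a vertical direction. -/
theorem fderiv_vertical (F : JetCoord 2 → ℝ) (w : JetCoord 2)
    (a : (i : Fin 3) → (Fin i → Fin 4) → Fin 4 → Fin 4 → ℝ) :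
    fderiv ℝ F w (0, fun i => symArr i (a i)) = ∑ μ, ∑ ν,
      ((∑ α, ∑ β, partialZ F 2 le_rfl ![α, β] μ ν w * a 2 ![α, β] μ ν) +
        (∑ α, partialZ F 1 one_le_two ![α] μ ν w * a 1 ![α] μ ν) +
        partialZ F 0 (Nat.zero_le 2) ![] μ ν w * a 0 ![] μ ν) := by
  have h1 : ((0, fun i => symArr i (a i)) : JetCoord 2)
      = ∑ i : Fin 3, ((0, Pi.single i (symArr i (a i))) : JetCoord 2) := by
    refine Prod.ext ?_ ?_
    · simp [Prod.fst_sum]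
    · rw [Prod.snd_sum]
      exact (Finset.univ_sum_single _).symm
  have h2 : ∀ i : Fin 3, fderiv ℝ F w (0, Pi.single i (symArr i (a i))) =
      ∑ μ, ∑ ν, ∑ l, partialZ F i (Nat.le_of_lt_succ i.2) l μ ν w * a i l μ ν := by
    intro i
    have h3 : ((0, Pi.single i (symArr i (a i))) : JetCoord 2) =
        (ContinuousLinearMap.inr ℝ E4 ((j : Fin 3) → JetArr j) ∘L
          ContinuousLinearMap.single ℝ (fun j : Fin 3 => JetArr j) i) (symArr i (a i)) := rfl
    rw [h3, symArr_eq_sum]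
    simp only [map_sum, map_smul, smul_eq_mul]
    refine Finset.sum_congr rfl fun μ _ => Finset.sum_congr rfl fun ν _ =>
      Finset.sum_congr rfl fun l _ => ?_
    rw [mul_comm]
    rfl
  rw [h1, map_sum, Finset.sum_congr rfl fun i _ => h2 i, Fin.sum_univ_three]
  simp only [← Finset.sum_add_distrib]
  refine Finset.sum_congr rfl fun μ _ => Finset.sum_congr rfl fun ν _ => ?_
  have k2 : ∑ l : Fin 2 → Fin 4, partialZ F 2 le_rfl l μ ν w * a 2 l μ ν = _ :=
    sum_fin_two_arrow _
  have k1 : ∑ l : Fin 1 → Fin 4, partialZ F 1 one_le_two l μ ν w * a 1 l μ ν = _ :=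
    sum_fin_one_arrow _
  have k0 : ∑ l : Fin 0 → Fin 4, partialZ F 0 (Nat.zero_le 2) l μ ν w * a 0 l μ ν =
      partialZ F 0 (Nat.zero_le 2) ![] μ ν w * a 0 ![] μ ν :=
    Fintype.sum_subsingleton _ ![]
  exact (congrArg₂ (· + ·) (congrArg₂ (· + ·) k0 k1) k2).trans (by
    simp only [Finset.sum_add_distrib]; ring)

theorem partialZ_two_swap {k : ℕ} (F : JetCoord k → ℝ) (hk : 2 ≤ k) (α β μ ν : Fin 4)
    (w : JetCoord k) : partialZ F 2 hk ![α, β] μ ν w = partialZ F 2 hk ![β, α] μ ν w := by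
  have h : symArr 2 (Pi.single ![α, β] (Pi.single μ (Pi.single ν 1))) =
      symArr 2 (Pi.single ![β, α] (Pi.single μ (Pi.single ν 1))) := by
    ext l a b
    simp only [symArr, LinearMap.coe_mk, AddHom.coe_mk]
    congr 1
    refine Fintype.sum_equiv (Equiv.mulRight (Equiv.swap 0 1)) _ _ fun τ => ?_
    have h1 : ∀ m : Fin 2 → Fin 4, (Pi.single ![α, β] (Pi.single μ (Pi.single ν 1)) :
        (Fin 2 → Fin 4) → Fin 4 → Fin 4 → ℝ) m =
        (Pi.single ![β, α] (Pi.single μ (Pi.single ν 1)) :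
        (Fin 2 → Fin 4) → Fin 4 → Fin 4 → ℝ) (m ∘ Equiv.swap 0 1) := by
      intro m
      have h2 : m = ![α, β] ↔ m ∘ Equiv.swap 0 1 = ![β, α] := by
        simp only [funext_iff, Fin.forall_fin_two, Function.comp, Equiv.swap_apply_left,
          Equiv.swap_apply_right]
        exact and_comm
      by_cases h3 : m = ![α, β]
      · rw [h2.1 h3, h3]; simp
      · rw [Pi.single_eq_of_ne h3, Pi.single_eq_of_ne (mt h2.2 h3)]
    rw [h1]
    rfl
  unfold partialZ
  rw [h]

theorem contDiffAt_pd {V : Type*} [NormedAddCommGroup V] [NormedSpace ℝ V] {f : E4 → V} {u : E4}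
    (hf : ContDiffAt ℝ ∞ f u) (α : Fin 4) : ContDiffAt ℝ ∞ (pd f α) u :=
  (hf.fderiv_right (m := ∞) (by exact_mod_cast le_rfl)).clm_apply contDiffAt_const

theorem ContDiffAt.diff {V W : Type*} [NormedAddCommGroup V] [NormedSpace ℝ V]
    [NormedAddCommGroup W] [NormedSpace ℝ W] {f : V → W} {u : V}
    (hf : ContDiffAt ℝ ∞ f u) : DifferentiableAt ℝ f u := hf.differentiableAt (by simp)

theorem eventually_of_contDiffOn {V : Type*} [NormedAddCommGroup V] [NormedSpace ℝ V] {f : E4 → V}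
    {s : Set E4} (hs : IsOpen s) (hf : ContDiffOn ℝ ∞ f s) {u : E4} (hu : u ∈ s) :
    ∀ᶠ x in 𝓝 u, ContDiffAt ℝ ∞ f x :=
  Filter.eventually_of_mem (hs.mem_nhds hu) fun _ hx => hf.contDiffAt (hs.mem_nhds hx)

theorem pd_apply {f : E4 → Fin 4 → Fin 4 → ℝ} {u : E4} (hf : DifferentiableAt ℝ f u)
    (α μ ν : Fin 4) : pd f α u μ ν = pd (fun x => f x μ ν) α u := by
  have h1 := hasFDerivAt_pi'.1 hf.hasFDerivAt μ
  have h2 := hasFDerivAt_pi'.1 h1 ν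
  exact congrArg (fun T : E4 →L[ℝ] ℝ => T (bvec α)) h2.fderiv.symm

theorem pd_congr {V : Type*} [NormedAddCommGroup V] [NormedSpace ℝ V] {f g : E4 → V} {u : E4}
    (h : f =ᶠ[𝓝 u] g) (α : Fin 4) : pd f α =ᶠ[𝓝 u] pd g α :=
  h.fderiv.mono fun _ hx => congrArg (fun T : E4 →L[ℝ] V => T (bvec α)) hx

theorem pd_mul {f g : E4 → ℝ} {u : E4} (hf : DifferentiableAt ℝ f u)
    (hg : DifferentiableAt ℝ g u) (α : Fin 4) :
    pd (fun x => f x * g x) α u = f u * pd g α u + g u * pd f α u := by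
  simp only [pd]
  rw [fderiv_fun_mul hf hg]
  simp

theorem iteratedFDeriv_two_bvec {f : E4 → Fin 4 → Fin 4 → ℝ} {u : E4}
    (hf : ContDiffAt ℝ ∞ f u) (h : ∀ᶠ x in 𝓝 u, DifferentiableAt ℝ f x) (α β μ ν : Fin 4) :
    iteratedFDeriv ℝ 2 f u (fun j => bvec (![α, β] j)) μ ν =
      pd (pd (fun x => f x μ ν) β) α u := by
  rw [iteratedFDeriv_two_apply]
  have h1 : DifferentiableAt ℝ (fderiv ℝ f) u :=
    (hf.fderiv_right (m := ∞) (by exact_mod_cast le_rfl)).diff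
  have h2 : fderiv ℝ (fderiv ℝ f) u (bvec α) (bvec β) = pd (pd f β) α u := by
    unfold pd
    rw [fderiv_clm_apply h1 (differentiableAt_const _)]
    simp
  refine (congrFun₂ h2 μ ν).trans ?_
  rw [pd_apply (contDiffAt_pd hf β).diff]
  have h3 : (fun x => pd f β x μ ν) =ᶠ[𝓝 u] pd (fun x => f x μ ν) β := by
    filter_upwards [h] with x hx using pd_apply hx _ _ _
  exact (pd_congr h3 α).eq_of_nhds

theorem iteratedFDeriv_one_bvec {f : E4 → Fin 4 → Fin 4 → ℝ} {u : E4}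
    (hf : DifferentiableAt ℝ f u) (α μ ν : Fin 4) :
    iteratedFDeriv ℝ 1 f u (fun j => bvec (![α] j)) μ ν = pd (fun x => f x μ ν) α u := by
  rw [iteratedFDeriv_one_apply]
  exact pd_apply hf α μ ν

theorem jetOf_congr {k : ℕ} {g g' : E4 → Fin 4 → Fin 4 → ℝ} {u : E4} (h : g =ᶠ[𝓝 u] g') :
    jetOf k g u = jetOf k g' u := by
  refine Prod.ext rfl (funext fun i => congrArg (symArr i) (funext fun l => ?_))
  rw [(h.iteratedFDeriv ℝ i).eq_of_nhds]

theorem jetOf_add_smul {k : ℕ} {g h : E4 → Fin 4 → Fin 4 → ℝ} {u : E4} (hg : ContDiffAt ℝ ∞ g u)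
    (hh : ContDiffAt ℝ ∞ h u) (s : ℝ) :
    jetOf k (fun x => g x + s • h x) u = jetOf k g u + s • ((0, (jetOf k h u).2) : JetCoord k) := by
  refine Prod.ext (by simp [jetOf]) (funext fun i => ?_)
  simp only [jetOf, Prod.snd_add, Prod.smul_snd, Pi.add_apply, Pi.smul_apply, ← map_smul,
    ← map_add]
  congr 1
  funext l
  have hi : (((i : ℕ) : ℕ∞) : ℕ∞ω) ≤ ∞ := by exact_mod_cast le_top
  have h1 := iteratedFDeriv_add_apply (i := i) (hg.of_le hi) ((hh.const_smul s).of_le hi)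
  have h2 := iteratedFDeriv_const_smul_apply (i := i) (a := s) (hh.of_le hi)
  refine (congrArg (fun T : ContinuousMultilinearMap ℝ (fun _ : Fin i => E4) _ =>
    T fun j => bvec (l j)) (h1.trans (congrArg _ h2))).trans ?_
  rfl

theorem contDiffOn_jetOf {k : ℕ} {g : E4 → Fin 4 → Fin 4 → ℝ} {s : Set E4} (hs : IsOpen s)
    (hg : ContDiffOn ℝ ∞ g s) : ContDiffOn ℝ ∞ (jetOf k g) s := by
  refine contDiffOn_id.prodMk (contDiffOn_pi.2 fun i => ?_)
  refine (LinearMap.toContinuousLinearMap (symArr i)).contDiff.comp_contDiffOn ?_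
  refine contDiffOn_pi.2 fun l => ?_
  have h1 : ContDiffOn ℝ ∞ (iteratedFDeriv ℝ i g) s := fun u hu =>
    ((hg.contDiffAt (hs.mem_nhds hu)).iteratedFDeriv_right (m := ∞)
      (by exact_mod_cast le_rfl)).contDiffWithinAt
  exact (ContinuousMultilinearMap.apply ℝ (fun _ : Fin i => E4) (Fin 4 → Fin 4 → ℝ)
      (fun j => bvec (l j))).contDiff.comp_contDiffOn h1

/-- The linearization of `u ↦ F (j²g(u))` at `g` in the direction `h`. -/
def variation (F : JetCoord 2 → ℝ) (g h : E4 → Fin 4 → Fin 4 → ℝ) (u : E4) : ℝ :=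
  fderiv ℝ F (jetOf 2 g u) (0, (jetOf 2 h u).2)

theorem variation_eq (F : JetCoord 2 → ℝ) (g : E4 → Fin 4 → Fin 4 → ℝ)
    {h : E4 → Fin 4 → Fin 4 → ℝ} {u : E4} (hh : ∀ᶠ x in 𝓝 u, ContDiffAt ℝ ∞ h x) :
    variation F g h u = ∑ μ, ∑ ν,
      ((∑ α, ∑ β, partialZ F 2 le_rfl ![α, β] μ ν (jetOf 2 g u) *
          pd (pd (fun x => h x μ ν) β) α u) +
        (∑ α, partialZ F 1 one_le_two ![α] μ ν (jetOf 2 g u) * pd (fun x => h x μ ν) α u) +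
        partialZ F 0 (Nat.zero_le 2) ![] μ ν (jetOf 2 g u) * h u μ ν) := by
  refine (fderiv_vertical F (jetOf 2 g u)
    fun i l => iteratedFDeriv ℝ i h u fun j => bvec (l j)).trans ?_
  refine Finset.sum_congr rfl fun μ _ => Finset.sum_congr rfl fun ν _ => ?_
  congr 1
  · congr 1
    · refine Finset.sum_congr rfl fun α _ => Finset.sum_congr rfl fun β _ => congrArg _ ?_
      exact iteratedFDeriv_two_bvec hh.self_of_nhds (hh.mono fun x hx => hx.diff) α β μ ν
    · refine Finset.sum_congr rfl fun α _ => congrArg _ ?_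
      exact iteratedFDeriv_one_bvec hh.self_of_nhds.diff α μ ν

/-! ### The linearized Lagrangian is a scalar density -/

theorem yCoord_jetOf {k : ℕ} {g : E4 → Fin 4 → Fin 4 → ℝ} {u : E4}
    (hs : ∀ μ ν, g u μ ν = g u ν μ) : yCoord (jetOf k g u) = g u := by
  have h : (fun l : Fin 0 → Fin 4 => iteratedFDeriv ℝ 0 g u fun j => bvec (l j)) ∈ JetArr 0 :=
    ⟨fun _ μ ν => hs μ ν, fun _ _ => rfl⟩
  have h2 := symArr_of_symm _ h
  exact congrArg (fun z : JetArr 0 => z.1 ![]) h2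

theorem isOpen_lagrangian_domain (k : ℕ) {s : Set E4} (hs : IsOpen s) :
    IsOpen {w : JetCoord k | w.1 ∈ s ∧ IsLorentzian (matForm (yCoord w))} :=
  isOpen_lorentzian (f := fun w : JetCoord k => yCoord w) (hs.preimage continuous_fst)
    (Continuous.continuousOn (continuous_pi fun μ => continuous_pi fun ν =>
      (zCoord 0 (Nat.zero_le k) ![] μ ν).continuous))
    (fun w μ ν => (w.2 0).2.1 _ μ ν)

theorem contDiffAt_partialZ {F : JetCoord 2 → ℝ} {w : JetCoord 2} (hF : ContDiffAt ℝ ∞ F w)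
    (i : ℕ) (hi : i ≤ 2) (l : Fin i → Fin 4) (μ ν : Fin 4) :
    ContDiffAt ℝ ∞ (partialZ F i hi l μ ν) w :=
  (hF.fderiv_right (m := ∞) (by exact_mod_cast le_rfl)).clm_apply contDiffAt_const

theorem hasDerivAt_variation {F : JetCoord 2 → ℝ} {g h : E4 → Fin 4 → Fin 4 → ℝ} {u : E4}
    (hF : DifferentiableAt ℝ F (jetOf 2 g u)) (hg : ContDiffAt ℝ ∞ g u)
    (hh : ContDiffAt ℝ ∞ h u) :
    HasDerivAt (fun s : ℝ => F (jetOf 2 (fun x => g x + s • h x) u)) (variation F g h u) 0 := by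
  have h1 : (fun s : ℝ => F (jetOf 2 (fun x => g x + s • h x) u)) =
      F ∘ fun s : ℝ => jetOf 2 g u + s • ((0, (jetOf 2 h u).2) : JetCoord 2) := by
    funext s
    simp only [Function.comp, jetOf_add_smul hg hh s]
  rw [h1]
  have h2 : HasDerivAt (fun s : ℝ => jetOf 2 g u + s • ((0, (jetOf 2 h u).2) : JetCoord 2))
      ((0, (jetOf 2 h u).2) : JetCoord 2) 0 := by
    simpa using ((hasDerivAt_id (0 : ℝ)).smul_const
      ((0, (jetOf 2 h u).2) : JetCoord 2)).const_add (jetOf 2 g u)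
  refine HasFDerivAt.comp_hasDerivAt (0 : ℝ) ?_ h2
  simpa using hF.hasFDerivAt

section Push

variable {M : Type*} [TopologicalSpace M]

/-- The components in the coordinates `e'` of the tensor field with components `g` in the
coordinates `e`. -/
def push (e e' : OpenPartialHomeomorph M E4) (g : E4 → Fin 4 → Fin 4 → ℝ) (u : E4) :
    Fin 4 → Fin 4 → ℝ :=
  pull (jac e' e u) (g ((e ∘ e'.symm) u))

theorem push_add_smul (e e' : OpenPartialHomeomorph M E4) (g h : E4 → Fin 4 → Fin 4 → ℝ)
    (s : ℝ) : push e e' (fun x => g x + s • h x) =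
      fun u => push e e' g u + s • push e e' h u := by
  funext u
  change pullL _ _ = pullL _ _ + s • pullL _ _
  rw [map_add, map_smul]

theorem push_smul (e e' : OpenPartialHomeomorph M E4) (f : E4 → ℝ) (h : E4 → Fin 4 → Fin 4 → ℝ) :
    push e e' (fun x => f x • h x) = fun u => f ((e ∘ e'.symm) u) • push e e' h u := by
  funext u
  change pullL _ _ = _ • pullL _ _
  rw [map_smul]

theorem overlap_image {e e' : OpenPartialHomeomorph M E4} {u : E4}
    (hu : u ∈ e.target ∩ e.symm ⁻¹' e'.source) :
    (e' ∘ e.symm) u ∈ e'.target ∩ e'.symm ⁻¹' e.source :=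
  mem_dom_coord hu.2 (e.map_target hu.1)

theorem overlap_inv {e e' : OpenPartialHomeomorph M E4} {u : E4}
    (hu : u ∈ e.target ∩ e.symm ⁻¹' e'.source) : (e ∘ e'.symm) ((e' ∘ e.symm) u) = u := by
  simp only [Function.comp]
  rw [e'.left_inv hu.2, e.right_inv hu.1]

variable [ChartedSpace E4 M]

theorem push_contDiffOn {e e' : OpenPartialHomeomorph M E4} (he : e ∈ posAtlas M)
    (he' : e' ∈ posAtlas M) {g : E4 → Fin 4 → Fin 4 → ℝ} (hg : ContDiff ℝ ∞ g) :
    ContDiffOn ℝ ∞ (push e e' g) (e'.target ∩ e'.symm ⁻¹' e.source) :=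
  pull_contDiff.comp_contDiffOn ((jac_contDiffOn he he').prodMk
    (hg.comp_contDiffOn (trans_contDiffOn he' he)))

theorem pull_symm (J y : Fin 4 → Fin 4 → ℝ) (hy : ∀ μ ν, y μ ν = y ν μ) (μ ν : Fin 4) :
    pull J y μ ν = pull J y ν μ := by
  unfold pull
  rw [Finset.sum_comm]
  exact Finset.sum_congr rfl fun a _ => Finset.sum_congr rfl fun b _ => by rw [hy a b]; ring

theorem comps_ofComps {e e' : OpenPartialHomeomorph M E4} (he : e ∈ posAtlas M)
    (he' : e' ∈ posAtlas M) {g : E4 → Fin 4 → Fin 4 → ℝ} (hg : ContDiffOn ℝ ∞ g e.target)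
    (hs : ∀ u μ ν, g u μ ν = g u ν μ) {u : E4} (hu : u ∈ e'.target ∩ e'.symm ⁻¹' e.source) :
    comps (LocalMetric.ofComps he g hg hs).toFun e' u = push e e' g u :=
  (comps_change _ he he' hu).trans
    (congrArg (pull _) (comps_tensorOfComps he _ (e.map_source hu.2)))

theorem mem_dom_ofComps_iff {e : OpenPartialHomeomorph M E4} (he : e ∈ posAtlas M)
    {g : E4 → Fin 4 → Fin 4 → ℝ} (hg : ContDiffOn ℝ ∞ g e.target)
    (hs : ∀ u μ ν, g u μ ν = g u ν μ) {u : E4} (hu : u ∈ e.target) :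
    e.symm u ∈ (LocalMetric.ofComps he g hg hs).dom ↔ IsLorentzian (matForm (g u)) := by
  have h : e.symm u ∈ (LocalMetric.ofComps he g hg hs).dom ↔
      e.symm u ∈ e.source ∧ IsLorentzian (matForm (g (e (e.symm u)))) := Iff.rfl
  rw [h, e.right_inv hu]
  exact and_iff_right (e.map_target hu)

theorem isLorentzian_push {e e' : OpenPartialHomeomorph M E4} (he : e ∈ posAtlas M)
    (he' : e' ∈ posAtlas M) {g : E4 → Fin 4 → Fin 4 → ℝ} (hg : ContDiff ℝ ∞ g)
    (hs : ∀ u μ ν, g u μ ν = g u ν μ) {u : E4} (hu : u ∈ e.target ∩ e.symm ⁻¹' e'.source)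
    (hl : IsLorentzian (matForm (g u))) :
    IsLorentzian (matForm (push e e' g ((e' ∘ e.symm) u))) := by
  have hd := (mem_dom_ofComps_iff he hg.contDiffOn hs hu.1).2 hl
  rw [← comps_ofComps he he' hg.contDiffOn hs (overlap_image hu)]
  refine isLorentzian_comps _ he' ⟨(overlap_image hu).1, ?_⟩
  simpa [e'.left_inv hu.2] using hd

variable {L : OpenPartialHomeomorph M E4 → JetCoord 2 → ℝ}

theorem IsInvariantLagrangian.contDiffAt (hL : IsInvariantLagrangian L)
    {e : OpenPartialHomeomorph M E4} (he : e ∈ posAtlas M) {w : JetCoord 2} (hw : w.1 ∈ e.target)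
    (hl : IsLorentzian (matForm (yCoord w))) : ContDiffAt ℝ ∞ (L e) w :=
  (hL.1 e he).contDiffAt ((isOpen_lagrangian_domain 2 e.open_target).mem_nhds ⟨hw, hl⟩)

theorem IsInvariantLagrangian.contDiffAt_jetOf (hL : IsInvariantLagrangian L)
    {e : OpenPartialHomeomorph M E4} (he : e ∈ posAtlas M) {g : E4 → Fin 4 → Fin 4 → ℝ} {u : E4}
    (hs : ∀ μ ν, g u μ ν = g u ν μ) (hu : u ∈ e.target) (hl : IsLorentzian (matForm (g u))) :
    ContDiffAt ℝ ∞ (L e) (jetOf 2 g u) :=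
  hL.contDiffAt he hu (by rwa [yCoord_jetOf hs])

theorem IsInvariantLagrangian.apply_push (hL : IsInvariantLagrangian L)
    {e e' : OpenPartialHomeomorph M E4} (he : e ∈ posAtlas M) (he' : e' ∈ posAtlas M)
    {g : E4 → Fin 4 → Fin 4 → ℝ} (hg : ContDiff ℝ ∞ g) (hs : ∀ u μ ν, g u μ ν = g u ν μ) {u : E4}
    (hu : u ∈ e.target ∩ e.symm ⁻¹' e'.source) (hl : IsLorentzian (matForm (g u))) :
    L e' (jetOf 2 (push e e' g) ((e' ∘ e.symm) u)) * (fderiv ℝ (e' ∘ e.symm) u).det =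
      L e (jetOf 2 g u) := by
  have hd := (mem_dom_ofComps_iff he hg.contDiffOn hs hu.1).2 hl
  set σ := LocalMetric.ofComps he g hg.contDiffOn hs with hσ
  have h1 := hL.2 e he e' he' (σ.jet 2 (e.symm u) hd) (e.map_target hu.1) hu.2
  rw [MetricJet.coord_jet σ 2 hd he' hu.2, MetricJet.coord_jet σ 2 hd he (e.map_target hu.1)] at h1
  have h2 : e (MetricJet.base (σ.jet 2 (e.symm u) hd)) = u := e.right_inv hu.1
  have h3 : σ.jetCoord 2 e' (e' (e.symm u)) = jetOf 2 (push e e' g) ((e' ∘ e.symm) u) :=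
    jetOf_congr (Filter.eventuallyEq_of_mem ((isOpen_overlap e' e).mem_nhds (overlap_image hu))
      fun x hx => comps_ofComps he he' hg.contDiffOn hs hx)
  have h4 : σ.jetCoord 2 e (e (e.symm u)) = jetOf 2 g u := by
    rw [e.right_inv hu.1]
    exact jetOf_congr (Filter.eventuallyEq_of_mem (e.open_target.mem_nhds hu.1)
      fun x hx => comps_tensorOfComps he _ hx)
  rwa [h2, h3, h4] at h1

/-- The linearization of an invariant Lagrangian is a scalar density. -/
theorem variation_push (hL : IsInvariantLagrangian L)
    {e e' : OpenPartialHomeomorph M E4} (he : e ∈ posAtlas M) (he' : e' ∈ posAtlas M)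
    {g h : E4 → Fin 4 → Fin 4 → ℝ} (hg : ContDiff ℝ ∞ g) (hs : ∀ u μ ν, g u μ ν = g u ν μ)
    (hh : ContDiff ℝ ∞ h) (hhs : ∀ u μ ν, h u μ ν = h u ν μ) {u : E4}
    (hu : u ∈ e.target ∩ e.symm ⁻¹' e'.source) (hl : IsLorentzian (matForm (g u))) :
    variation (L e') (push e e' g) (push e e' h) ((e' ∘ e.symm) u) *
      (fderiv ℝ (e' ∘ e.symm) u).det = variation (L e) g h u := by
  have hu' := overlap_image hu
  have hn := (isOpen_overlap e' e).mem_nhds hu'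
  have h1 := hasDerivAt_variation (h := h)
    ((hL.contDiffAt_jetOf he (hs u) hu.1 hl).diff) hg.contDiffAt hh.contDiffAt
  have h2 := hasDerivAt_variation (h := push e e' h)
    ((hL.contDiffAt_jetOf he' (fun μ ν => pull_symm _ _ (hs _) μ ν) hu'.1
      (isLorentzian_push he he' hg hs hu hl)).diff)
    ((push_contDiffOn he he' hg).contDiffAt hn) ((push_contDiffOn he he' hh).contDiffAt hn)
  refine (h2.mul_const _).unique (h1.congr_of_eventuallyEq ?_)
  have ho : IsOpen (univ ∩ {s : ℝ | IsLorentzian (matForm (g u + s • h u))}) :=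
    isOpen_lorentzian isOpen_univ (by fun_prop) fun s μ ν => by simp [hs u μ ν, hhs u μ ν]
  -- `g + s h` is Lorentzian at `u` for small `s`
  filter_upwards [ho.mem_nhds ⟨mem_univ 0, by simpa using hl⟩] with s hs'
  rw [← push_add_smul]
  exact hL.apply_push he he' (hg.add (hh.const_smul s))
    (fun u μ ν => by simp [hs u μ ν, hhs u μ ν]) hu hs'.2

end Push

/-! ### The divergence of a vector density -/

/-- Jacobi's formula for the derivative of a determinant. -/
theorem hasFDerivAt_det {n : Type*} [Fintype n] [DecidableEq n] {E : Type*} [NormedAddCommGroup E]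
    [NormedSpace ℝ E] {A : E → Matrix n n ℝ} {A' : n → n → E →L[ℝ] ℝ} {u : E}
    (h : ∀ i j, HasFDerivAt (fun x => A x i j) (A' i j) u) :
    HasFDerivAt (fun x => (A x).det) (∑ i, ∑ j, (A u).adjugate i j • A' j i) u := by
  have h1 : HasFDerivAt (fun x => ∑ τ : Equiv.Perm n,
      ((Equiv.Perm.sign τ : ℤ) : ℝ) * ∏ i, A x (τ i) i)
      (∑ τ : Equiv.Perm n, ((Equiv.Perm.sign τ : ℤ) : ℝ) •
        ∑ i, (∏ j ∈ Finset.univ.erase i, A u (τ j) j) • A' (τ i) i) u :=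
    HasFDerivAt.fun_sum fun τ _ =>
      (HasFDerivAt.finsetProd fun i _ => h (τ i) i).const_mul _
  have h2 : (fun x => (A x).det) = fun x => ∑ τ : Equiv.Perm n,
      ((Equiv.Perm.sign τ : ℤ) : ℝ) * ∏ i, A x (τ i) i := by
    funext x; exact Matrix.det_apply' _
  rw [h2]
  refine h1.congr_fderiv ?_
  ext v
  simp only [sum_apply, smul_apply, smul_eq_mul, Finset.mul_sum]
  rw [Finset.sum_comm]
  refine Finset.sum_congr rfl fun i _ => ?_
  have h3 : (A u).adjugate.mulVec (fun j => A' j i v) i =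
      ((A u).updateCol i fun j => A' j i v).det := by
    rw [← Matrix.cramer_eq_adjugate_mulVec, Matrix.cramer_apply]
  refine Eq.trans ?_ (h3.symm.trans rfl)
  rw [Matrix.det_apply']
  refine Finset.sum_congr rfl fun τ _ => ?_
  rw [← Finset.mul_prod_erase _ _ (Finset.mem_univ i), Matrix.updateCol_self]
  have h4 : ∏ j ∈ Finset.univ.erase i, (A u).updateCol i (fun j => A' j i v) (τ j) j =
      ∏ j ∈ Finset.univ.erase i, A u (τ j) j :=
    Finset.prod_congr rfl fun j hj => Matrix.updateCol_ne (Finset.ne_of_mem_erase hj)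
  rw [h4]
  ring

/-- The Jacobian matrix of a map. -/
def jacMatrix (ψ : E4 → E4) (u : E4) : Matrix (Fin 4) (Fin 4) ℝ :=
  Matrix.of fun a μ => fderiv ℝ ψ u (bvec μ) a

theorem det_eq_det_toMatrix (T : E4 →L[ℝ] E4) :
    T.det = (Matrix.of fun a μ => T (bvec μ) a).det := by
  unfold ContinuousLinearMap.det
  rw [← LinearMap.det_toMatrix (EuclideanSpace.basisFun (Fin 4) ℝ).toBasis]
  congr 1

theorem det_fderiv (ψ : E4 → E4) (u : E4) : (fderiv ℝ ψ u).det = (jacMatrix ψ u).det :=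
  det_eq_det_toMatrix _

theorem fderiv_eq_sum_pd {f : E4 → ℝ} {u v : E4} :
    fderiv ℝ f u v = ∑ a, v a * pd f a u := by
  conv_lhs => rw [eq_sum_bvec v, map_sum]
  simp [pd]

theorem pd_jacMatrix_symm {ψ : E4 → E4} {u : E4} (hψ : ContDiffAt ℝ ∞ ψ u) (α a b : Fin 4) :
    pd (fun x => jacMatrix ψ x α a) b u = pd (fun x => jacMatrix ψ x α b) a u := by
  have hd : DifferentiableAt ℝ (fderiv ℝ ψ) u :=
    (hψ.fderiv_right (m := ∞) (by exact_mod_cast le_rfl)).diff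
  have h1 : ∀ a b, pd (fun x => jacMatrix ψ x α a) b u =
      fderiv ℝ (fderiv ℝ ψ) u (bvec b) (bvec a) α := by
    intro a b
    have h2 : HasFDerivAt (fun x => fderiv ℝ ψ x (bvec a)) _ u :=
      hd.hasFDerivAt.clm_apply (hasFDerivAt_const (bvec a) u)
    have h3 := (EuclideanSpace.proj (𝕜 := ℝ) α : E4 →L[ℝ] ℝ).hasFDerivAt.comp u h2
    have h4 : pd (fun x => jacMatrix ψ x α a) b u = _ :=
      congrArg (fun T : E4 →L[ℝ] ℝ => T (bvec b)) h3.fderiv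
    rw [h4]
    simp
  have hsymm : IsSymmSndFDerivAt ℝ ψ u :=
    hψ.isSymmSndFDerivAt (by
      simp only [minSmoothness_of_isRCLikeNormedField]
      exact (WithTop.coe_le_coe.2 le_top : ((2 : ℕ∞) : ℕ∞ω) ≤ ∞))
  rw [h1, h1, hsymm.eq]

theorem differentiableAt_jacMatrix {ψ : E4 → E4} {u : E4} (hψ : ContDiffAt ℝ ∞ ψ u)
    (α a : Fin 4) : DifferentiableAt ℝ (fun x => jacMatrix ψ x α a) u := by
  have hd : DifferentiableAt ℝ (fderiv ℝ ψ) u :=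
    (hψ.fderiv_right (m := ∞) (by exact_mod_cast le_rfl)).diff
  exact (EuclideanSpace.proj (𝕜 := ℝ) α : E4 →L[ℝ] ℝ).differentiableAt.comp u
    (hd.clm_apply (differentiableAt_const _))

/-- The chain rule in coordinates. -/
theorem pd_comp {ψ : E4 → E4} {f : E4 → ℝ} {u : E4} (hf : DifferentiableAt ℝ f (ψ u))
    (hψ : DifferentiableAt ℝ ψ u) (b : Fin 4) :
    pd (fun x => f (ψ x)) b u = ∑ β, pd f β (ψ u) * jacMatrix ψ u β b := by
  have h : pd (fun x => f (ψ x)) b u = fderiv ℝ f (ψ u) (fderiv ℝ ψ u (bvec b)) :=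
    congrArg (fun T : E4 →L[ℝ] ℝ => T (bvec b)) (fderiv_comp u hf hψ)
  rw [h, fderiv_eq_sum_pd]
  exact Finset.sum_congr rfl fun β _ => mul_comm _ _

theorem pd_sum {ι : Type*} {s : Finset ι} {f : ι → E4 → ℝ} {u : E4}
    (hf : ∀ i ∈ s, DifferentiableAt ℝ (f i) u) (b : Fin 4) :
    pd (fun x => ∑ i ∈ s, f i x) b u = ∑ i ∈ s, pd (f i) b u := by
  unfold pd
  rw [fderiv_fun_sum hf]
  simp

/-- The Piola identity: if `V` is obtained from `W` by the transformation law of vector densities,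
then the divergences of `V` and `W` are related by the law of scalar densities. -/
theorem divergence_density {ψ : E4 → E4} {u : E4} (hψ : ContDiffAt ℝ ∞ ψ u)
    {K : Matrix (Fin 4) (Fin 4) ℝ} (hK : K * jacMatrix ψ u = 1) {V W : Fin 4 → E4 → ℝ}
    (hV : ∀ a, DifferentiableAt ℝ (V a) u) (hW : ∀ α, DifferentiableAt ℝ (W α) (ψ u))
    (h : ∀ᶠ x in 𝓝 u, ∀ α, ∑ a, jacMatrix ψ x α a * V a x = (jacMatrix ψ x).det * W α (ψ x)) :
    ∑ a, pd (V a) a u = (jacMatrix ψ u).det * ∑ α, pd (W α) α (ψ u) := by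
  set J := jacMatrix ψ u with hJ
  have hK' : J * K = 1 := mul_eq_one_comm.1 hK
  have hjd := fun α a => differentiableAt_jacMatrix hψ α a
  have hadj : J.adjugate = J.det • K := by
    calc J.adjugate = (K * J) * J.adjugate := by rw [hK, one_mul]
      _ = J.det • K := by rw [mul_assoc, Matrix.mul_adjugate]; simp
  have hdet : ∀ b, pd (fun x => (jacMatrix ψ x).det) b u =
      J.det * ∑ c, ∑ α, K c α * pd (fun x => jacMatrix ψ x α c) b u := by
    intro b
    have h1 := hasFDerivAt_det (A := jacMatrix ψ) fun i j => (hjd i j).hasFDerivAt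
    have h2 : pd (fun x => (jacMatrix ψ x).det) b u = _ :=
      congrArg (fun T : E4 →L[ℝ] ℝ => T (bvec b)) h1.fderiv
    rw [h2, ← hJ, hadj]
    simp only [sum_apply, smul_apply, smul_eq_mul, Matrix.smul_apply, Finset.mul_sum, mul_assoc]
    rfl
  have hdd : DifferentiableAt ℝ (fun x => (jacMatrix ψ x).det) u :=
    (hasFDerivAt_det (A := jacMatrix ψ) fun i j => (hjd i j).hasFDerivAt).differentiableAt
  have hWc : ∀ α, DifferentiableAt ℝ (fun x => W α (ψ x)) u := fun α =>
    (hW α).comp u hψ.diff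
  -- the derivative of the transformation law
  have key : ∀ α b, ∑ a, (J α a * pd (V a) b u + V a u * pd (fun x => jacMatrix ψ x α b) a u) =
      J.det * (∑ β, pd (W α) β (ψ u) * J β b) +
        W α (ψ u) * pd (fun x => (jacMatrix ψ x).det) b u := by
    intro α b
    have h1 : (fun x => ∑ a, jacMatrix ψ x α a * V a x) =ᶠ[𝓝 u]
        fun x => (jacMatrix ψ x).det * W α (ψ x) := h.mono fun x hx => hx α
    have h2 := (pd_congr h1 b).eq_of_nhds
    rw [pd_sum (f := fun a x => jacMatrix ψ x α a * V a x) fun a _ => (hjd α a).mul (hV a),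
      pd_mul hdd (hWc α), pd_comp (hW α) hψ.diff] at h2
    rw [← h2]
    refine Finset.sum_congr rfl fun a _ => ?_
    rw [pd_mul (hjd α a) (hV a), pd_jacMatrix_symm hψ α b a]
  have h0 : ∀ c, V c u = J.det * ∑ α, K c α * W α (ψ u) := by
    intro c
    have h1 := fun α => h.self_of_nhds α
    calc V c u = ∑ a, (K * J) c a * V a u := by simp [hK, Matrix.one_apply]
      _ = ∑ α, K c α * ∑ a, J α a * V a u := by
        simp only [Matrix.mul_apply, Finset.sum_mul, Finset.mul_sum]
        rw [Finset.sum_comm]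
        exact Finset.sum_congr rfl fun _ _ => Finset.sum_congr rfl fun _ _ => by ring
      _ = _ := by
        rw [Finset.mul_sum]
        exact Finset.sum_congr rfl fun α _ => by rw [hJ, h1 α]; ring
  -- contract with the inverse matrix
  have hL : ∑ α, ∑ b, K b α * ∑ a, (J α a * pd (V a) b u +
      V a u * pd (fun x => jacMatrix ψ x α b) a u) = ∑ a, pd (V a) a u +
      ∑ a, V a u * ∑ c, ∑ α, K c α * pd (fun x => jacMatrix ψ x α c) a u := by
    have e1 : ∑ α, ∑ b, K b α * ∑ a, J α a * pd (V a) b u = ∑ a, pd (V a) a u := by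
      calc _ = ∑ b, ∑ a, (K * J) b a * pd (V a) b u := by
            rw [Finset.sum_comm]
            refine Finset.sum_congr rfl fun b _ => ?_
            simp only [Matrix.mul_apply, Finset.sum_mul, Finset.mul_sum]
            rw [Finset.sum_comm]
            exact Finset.sum_congr rfl fun _ _ => Finset.sum_congr rfl fun _ _ => by ring
        _ = _ := by simp [hK, Matrix.one_apply]
    have e2 : ∑ α, ∑ b, K b α * ∑ a, V a u * pd (fun x => jacMatrix ψ x α b) a u =
        ∑ a, V a u * ∑ c, ∑ α, K c α * pd (fun x => jacMatrix ψ x α c) a u := by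
      simp only [Finset.mul_sum]
      rw [Finset.sum_congr rfl fun α _ => Finset.sum_comm, Finset.sum_comm]
      refine Finset.sum_congr rfl fun a _ => ?_
      rw [Finset.sum_comm]
      exact Finset.sum_congr rfl fun _ _ => Finset.sum_congr rfl fun _ _ => by ring
    rw [← e1, ← e2]
    simp only [Finset.sum_add_distrib, mul_add]
  have hR : ∑ α, ∑ b, K b α * (J.det * (∑ β, pd (W α) β (ψ u) * J β b) +
        W α (ψ u) * pd (fun x => (jacMatrix ψ x).det) b u) =
      J.det * ∑ α, pd (W α) α (ψ u) +
      ∑ a, V a u * ∑ c, ∑ α, K c α * pd (fun x => jacMatrix ψ x α c) a u := by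
    have e1 : ∑ α, ∑ b, K b α * (J.det * (∑ β, pd (W α) β (ψ u) * J β b)) =
        J.det * ∑ α, pd (W α) α (ψ u) := by
      calc _ = ∑ α, J.det * ∑ β, pd (W α) β (ψ u) * (J * K) β α := by
            refine Finset.sum_congr rfl fun α _ => ?_
            simp only [Matrix.mul_apply, Finset.mul_sum]
            rw [Finset.sum_comm]
            exact Finset.sum_congr rfl fun _ _ => Finset.sum_congr rfl fun _ _ => by ring
        _ = _ := by simp [hK', Matrix.one_apply, Finset.mul_sum]
    have e2 : ∑ α, ∑ b, K b α * (W α (ψ u) * pd (fun x => (jacMatrix ψ x).det) b u) =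
        ∑ a, V a u * ∑ c, ∑ α, K c α * pd (fun x => jacMatrix ψ x α c) a u := by
      rw [Finset.sum_comm]
      refine Finset.sum_congr rfl fun b _ => ?_
      rw [h0 b, hdet b]
      generalize ∑ c, ∑ α, K c α * pd (fun x => jacMatrix ψ x α c) b u = T
      rw [Finset.mul_sum, Finset.sum_mul]
      exact Finset.sum_congr rfl fun _ _ => by ring
    rw [← e1, ← e2]
    simp only [Finset.sum_add_distrib, mul_add]
  have h9 := hL.symm.trans ((Finset.sum_congr rfl fun α _ => Finset.sum_congr rfl fun b _ =>
    congrArg (K b α * ·) (key α b)).trans hR)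
  linarith

/-! ### The boundary current of a variation -/

/-- The principal symbol of the linearized Lagrangian, applied to `h`: the components
`S^{αβ} = (∂L/∂z_{μναβ}) h_{μν}`. -/
def symbolAt (F : JetCoord 2 → ℝ) (g h : E4 → Fin 4 → Fin 4 → ℝ) (α β : Fin 4) (u : E4) : ℝ :=
  ∑ μ, ∑ ν, partialZ F 2 le_rfl ![α, β] μ ν (jetOf 2 g u) * h u μ ν

/-- The components `X^α = 2 (∂L/∂z_{μναβ}) h_{μν,β} + (∂L/∂z_{μνα}) h_{μν}`. If `f` vanishes at a
point, then the linearized Lagrangian maps `f h` to `X^α f_{,α} + S^{αβ} f_{,αβ}` there. -/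
def subsymbolAt (F : JetCoord 2 → ℝ) (g h : E4 → Fin 4 → Fin 4 → ℝ) (α : Fin 4) (u : E4) : ℝ :=
  ∑ μ, ∑ ν, (2 * ∑ β, partialZ F 2 le_rfl ![α, β] μ ν (jetOf 2 g u) * pd (fun x => h x μ ν) β u +
    partialZ F 1 one_le_two ![α] μ ν (jetOf 2 g u) * h u μ ν)

/-- The boundary current `J^α = p^{μνβα} h_{μν,β} + p^{μνα} h_{μν}` of the variation `h`. -/
def current (F : JetCoord 2 → ℝ) (g h : E4 → Fin 4 → Fin 4 → ℝ) (α : Fin 4) (u : E4) : ℝ :=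
  ∑ μ, ∑ ν, ((∑ β, partialZ F 2 le_rfl ![β, α] μ ν (jetOf 2 g u) * pd (fun x => h x μ ν) β u) +
    (partialZ F 1 one_le_two ![α] μ ν (jetOf 2 g u) -
      ∑ β, pd (fun x => partialZ F 2 le_rfl ![α, β] μ ν (jetOf 2 g x)) β u) * h u μ ν)

theorem pd_add {f g : E4 → ℝ} {u : E4} (hf : DifferentiableAt ℝ f u)
    (hg : DifferentiableAt ℝ g u) (α : Fin 4) :
    pd (fun x => f x + g x) α u = pd f α u + pd g α u := by
  unfold pd
  rw [fderiv_fun_add hf hg]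
  rfl

theorem pd_pd_mul {f φ : E4 → ℝ} {u : E4} (hf : ∀ᶠ x in 𝓝 u, ContDiffAt ℝ ∞ f x)
    (hφ : ∀ᶠ x in 𝓝 u, ContDiffAt ℝ ∞ φ x) (α β : Fin 4) :
    pd (pd (fun x => f x * φ x) β) α u = f u * pd (pd φ β) α u + pd φ β u * pd f α u +
      (φ u * pd (pd f β) α u + pd f β u * pd φ α u) := by
  have h1 : pd (fun x => f x * φ x) β =ᶠ[𝓝 u] fun x => f x * pd φ β x + φ x * pd f β x := by
    filter_upwards [hf, hφ] with x hx hx' using pd_mul hx.diff hx'.diff β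
  have f0 := hf.self_of_nhds
  have φ0 := hφ.self_of_nhds
  have d1 := (contDiffAt_pd f0 β).diff
  have d2 := (contDiffAt_pd φ0 β).diff
  rw [(pd_congr h1 α).eq_of_nhds, ← pd_mul f0.diff d2, ← pd_mul φ0.diff d1]
  exact pd_add (f0.diff.mul d2) (φ0.diff.mul d1) α

theorem eventually_contDiffAt_apply {h : E4 → Fin 4 → Fin 4 → ℝ} {u : E4}
    (hh : ∀ᶠ x in 𝓝 u, ContDiffAt ℝ ∞ h x) (μ ν : Fin 4) :
    ∀ᶠ x in 𝓝 u, ContDiffAt ℝ ∞ (fun x => h x μ ν) x :=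
  hh.mono fun _ hx => contDiffAt_pi.1 (contDiffAt_pi.1 hx μ) ν

theorem sum_mul_sum_comm {ι : Type*} [Fintype ι] (f : ι → ℝ) (G : ι → Fin 4 → Fin 4 → ℝ) :
    ∑ i, f i * ∑ μ, ∑ ν, G i μ ν = ∑ μ, ∑ ν, ∑ i, f i * G i μ ν := by
  simp only [Finset.mul_sum]
  rw [Finset.sum_comm]
  exact Finset.sum_congr rfl fun μ _ => Finset.sum_comm

/-- On products with a function vanishing at a point, the term of order zero of the linearized
Lagrangian drops out. -/
theorem variation_smul (F : JetCoord 2 → ℝ) (g : E4 → Fin 4 → Fin 4 → ℝ) {f : E4 → ℝ}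
    {h : E4 → Fin 4 → Fin 4 → ℝ} {u : E4} (hf : ∀ᶠ x in 𝓝 u, ContDiffAt ℝ ∞ f x)
    (hh : ∀ᶠ x in 𝓝 u, ContDiffAt ℝ ∞ h x) (h0 : f u = 0) :
    variation F g (fun x => f x • h x) u = (∑ α, pd f α u * subsymbolAt F g h α u) +
      ∑ α, ∑ β, pd (pd f β) α u * symbolAt F g h α β u := by
  have hfh : ∀ᶠ x in 𝓝 u, ContDiffAt ℝ ∞ (fun x => f x • h x) x := by
    filter_upwards [hf, hh] with x hx hx' using hx.smul hx'
  have e1 : ∑ α, ∑ β, pd (pd f β) α u * symbolAt F g h α β u = ∑ μ, ∑ ν, ∑ α, ∑ β,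
      pd (pd f β) α u * (partialZ F 2 le_rfl ![α, β] μ ν (jetOf 2 g u) * h u μ ν) := by
    unfold symbolAt
    have := sum_mul_sum_comm (fun i : Fin 4 × Fin 4 => pd (pd f i.2) i.1 u)
      (fun i μ ν => partialZ F 2 le_rfl ![i.1, i.2] μ ν (jetOf 2 g u) * h u μ ν)
    simpa only [Fintype.sum_prod_type] using this
  unfold subsymbolAt
  rw [variation_eq F g hfh, sum_mul_sum_comm, e1, ← Finset.sum_add_distrib]
  refine Finset.sum_congr rfl fun μ _ => ?_
  rw [← Finset.sum_add_distrib]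
  refine Finset.sum_congr rfl fun ν _ => ?_
  have hφ := eventually_contDiffAt_apply hh μ ν
  set φ : E4 → ℝ := fun x => h x μ ν with hφd
  have e2 : (fun x => (f x • h x) μ ν) = fun x => f x * φ x := rfl
  have e3 : ∑ α, ∑ β, partialZ F 2 le_rfl ![α, β] μ ν (jetOf 2 g u) * (pd f β u * pd φ α u) =
      ∑ α, ∑ β, partialZ F 2 le_rfl ![α, β] μ ν (jetOf 2 g u) * (pd f α u * pd φ β u) := by
    rw [Finset.sum_comm]
    exact Finset.sum_congr rfl fun α _ => Finset.sum_congr rfl fun β _ => by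
      rw [partialZ_two_swap]
  rw [e2]
  simp only [pd_pd_mul hf hφ, pd_mul hf.self_of_nhds.diff hφ.self_of_nhds.diff, h0,
    Pi.smul_apply, zero_smul, zero_mul, zero_add, mul_zero, add_zero]
  have e4 : ∑ α, ∑ β, partialZ F 2 le_rfl ![α, β] μ ν (jetOf 2 g u) *
      (pd φ β u * pd f α u + (φ u * pd (pd f β) α u + pd f β u * pd φ α u)) =
      2 * (∑ α, ∑ β, partialZ F 2 le_rfl ![α, β] μ ν (jetOf 2 g u) * (pd f α u * pd φ β u)) +
      ∑ α, ∑ β, pd (pd f β) α u *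
        (partialZ F 2 le_rfl ![α, β] μ ν (jetOf 2 g u) * φ u) := by
    rw [two_mul]
    nth_rewrite 2 [← e3]
    simp only [← Finset.sum_add_distrib]
    exact Finset.sum_congr rfl fun α _ => Finset.sum_congr rfl fun β _ => by ring
  rw [e4, add_right_comm]
  congr 1
  rw [Finset.mul_sum, ← Finset.sum_add_distrib]
  refine Finset.sum_congr rfl fun α _ => ?_
  rw [mul_add, Finset.mul_sum, Finset.mul_sum, Finset.mul_sum]
  exact congrArg₂ (· + ·) (Finset.sum_congr rfl fun β _ => by ring) (by ring)

theorem subsymbolAt_smul (F : JetCoord 2 → ℝ) (g : E4 → Fin 4 → Fin 4 → ℝ) {k : E4 → ℝ}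
    {h : E4 → Fin 4 → Fin 4 → ℝ} {u : E4} (hk : DifferentiableAt ℝ k u)
    (hh : DifferentiableAt ℝ h u) (h0 : k u = 0) (α : Fin 4) :
    subsymbolAt F g (fun x => k x • h x) α u = 2 * ∑ β, pd k β u * symbolAt F g h α β u := by
  unfold subsymbolAt symbolAt
  rw [sum_mul_sum_comm, Finset.mul_sum]
  refine Finset.sum_congr rfl fun μ _ => ?_
  rw [Finset.mul_sum]
  refine Finset.sum_congr rfl fun ν _ => ?_
  have hφ : DifferentiableAt ℝ (fun x => h x μ ν) u :=
    differentiableAt_pi.1 (differentiableAt_pi.1 hh μ) ν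
  have e2 : (fun x => (k x • h x) μ ν) = fun x => k x * h x μ ν := rfl
  have e3 : ∀ β, pd (fun x => (k x • h x) μ ν) β u = h u μ ν * pd k β u := fun β => by
    rw [e2, pd_mul hk hφ, h0, zero_mul, zero_add]
  simp only [e3, h0, zero_smul, Pi.zero_apply, mul_zero, add_zero]
  congr 1
  exact Finset.sum_congr rfl fun β _ => by ring

/-- On products with two functions vanishing at a point, only the principal symbol acts. -/
theorem variation_smul_smul (F : JetCoord 2 → ℝ) (g : E4 → Fin 4 → Fin 4 → ℝ) {f k : E4 → ℝ}
    {h : E4 → Fin 4 → Fin 4 → ℝ} {u : E4} (hf : ∀ᶠ x in 𝓝 u, ContDiffAt ℝ ∞ f x)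
    (hk : ∀ᶠ x in 𝓝 u, ContDiffAt ℝ ∞ k x)
    (hh : ∀ᶠ x in 𝓝 u, ContDiffAt ℝ ∞ h x) (h0 : f u = 0) (h0' : k u = 0) :
    variation F g (fun x => f x • k x • h x) u =
      2 * ∑ α, ∑ β, pd f α u * pd k β u * symbolAt F g h α β u := by
  have hkh : ∀ᶠ x in 𝓝 u, ContDiffAt ℝ ∞ (fun x => k x • h x) x := by
    filter_upwards [hk, hh] with x hx hx' using hx.smul hx'
  rw [variation_smul F g hf hkh h0]
  have e1 : ∀ α β, symbolAt F g (fun x => k x • h x) α β u = 0 := fun α β => by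
    simp [symbolAt, h0']
  simp only [e1, mul_zero, Finset.sum_const_zero, add_zero,
    subsymbolAt_smul F g hk.self_of_nhds.diff hh.self_of_nhds.diff h0', Finset.mul_sum]
  exact Finset.sum_congr rfl fun _ _ => Finset.sum_congr rfl fun _ _ => by ring

/-- The boundary current in terms of the coefficients `X^α`, `S^{αβ}` of the linearized Lagrangian:
`J^α = X^α - ∂_β S^{βα}`. -/
theorem current_eq (F : JetCoord 2 → ℝ) (g : E4 → Fin 4 → Fin 4 → ℝ)
    {h : E4 → Fin 4 → Fin 4 → ℝ} {u : E4} (hF : ContDiffAt ℝ ∞ F (jetOf 2 g u))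
    (hg : DifferentiableAt ℝ (jetOf 2 g) u) (hh : DifferentiableAt ℝ h u) (α : Fin 4) :
    current F g h α u = subsymbolAt F g h α u - ∑ β, pd (symbolAt F g h β α) β u := by
  have hφ : ∀ μ ν, DifferentiableAt ℝ (fun x => h x μ ν) u := fun μ ν =>
    differentiableAt_pi.1 (differentiableAt_pi.1 hh μ) ν
  have hA : ∀ α β μ ν, DifferentiableAt ℝ
      (fun x => partialZ F 2 le_rfl ![α, β] μ ν (jetOf 2 g x)) u := fun α β μ ν =>
    (contDiffAt_partialZ hF 2 le_rfl ![α, β] μ ν).diff.comp u hg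
  have e1 : ∀ β, pd (symbolAt F g h β α) β u = ∑ μ, ∑ ν,
      (partialZ F 2 le_rfl ![β, α] μ ν (jetOf 2 g u) * pd (fun x => h x μ ν) β u +
      h u μ ν * pd (fun x => partialZ F 2 le_rfl ![β, α] μ ν (jetOf 2 g x)) β u) := by
    intro β
    have hd : ∀ μ ν, DifferentiableAt ℝ
        (fun x => partialZ F 2 le_rfl ![β, α] μ ν (jetOf 2 g x) * h x μ ν) u :=
      fun μ ν => (hA β α μ ν).mul (hφ μ ν)
    unfold symbolAt
    rw [pd_sum fun μ _ => DifferentiableAt.fun_sum fun ν _ => hd μ ν]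
    refine Finset.sum_congr rfl fun μ _ => ?_
    rw [pd_sum fun ν _ => hd μ ν]
    exact Finset.sum_congr rfl fun ν _ => pd_mul (hA β α μ ν) (hφ μ ν) β
  have e2 := sum_mul_sum_comm (fun _ : Fin 4 => 1) fun β μ ν =>
      (partialZ F 2 le_rfl ![β, α] μ ν (jetOf 2 g u) * pd (fun x => h x μ ν) β u +
      h u μ ν * pd (fun x => partialZ F 2 le_rfl ![β, α] μ ν (jetOf 2 g x)) β u)
  simp only [one_mul] at e2
  rw [Finset.sum_congr rfl fun β _ => e1 β, e2]
  unfold current subsymbolAt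
  simp only [← Finset.sum_sub_distrib]
  refine Finset.sum_congr rfl fun μ _ => Finset.sum_congr rfl fun ν _ => ?_
  simp only [partialZ_two_swap F le_rfl α, Finset.sum_add_distrib, ← Finset.mul_sum]
  ring

/-! ### The boundary current is a vector density -/

theorem differentiableAt_symbolAt {F : JetCoord 2 → ℝ} {g h : E4 → Fin 4 → Fin 4 → ℝ} {u : E4}
    (hF : ContDiffAt ℝ ∞ F (jetOf 2 g u)) (hg : DifferentiableAt ℝ (jetOf 2 g) u)
    (hh : DifferentiableAt ℝ h u) (α β : Fin 4) :
    DifferentiableAt ℝ (symbolAt F g h α β) u :=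
  DifferentiableAt.fun_sum fun μ _ => DifferentiableAt.fun_sum fun ν _ =>
    ((contDiffAt_partialZ hF 2 le_rfl ![α, β] μ ν).diff.comp u hg).mul
      (differentiableAt_pi.1 (differentiableAt_pi.1 hh μ) ν)

section Density

variable {M : Type*} [TopologicalSpace M] [ChartedSpace E4 M]

theorem jacMatrix_mul {e e' : OpenPartialHomeomorph M E4} (he : e ∈ posAtlas M)
    (he' : e' ∈ posAtlas M) {u : E4} (hu : u ∈ e.target ∩ e.symm ⁻¹' e'.source) :
    jacMatrix (e ∘ e'.symm) ((e' ∘ e.symm) u) * jacMatrix (e' ∘ e.symm) u = 1 := by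
  have hd : DifferentiableAt ℝ (e' ∘ e.symm) u :=
    ((trans_contDiffOn he he').contDiffAt ((isOpen_overlap e e').mem_nhds hu)).diff
  have hd' : DifferentiableAt ℝ (e ∘ e'.symm) ((e' ∘ e.symm) u) :=
    ((trans_contDiffOn he' he).contDiffAt
      ((isOpen_overlap e' e).mem_nhds (overlap_image hu))).diff
  have h1 : (fun x => (e ∘ e'.symm) ((e' ∘ e.symm) x)) =ᶠ[𝓝 u] id :=
    Filter.eventuallyEq_of_mem ((isOpen_overlap e e').mem_nhds hu) fun x hx => overlap_inv hx
  have h2 : (fderiv ℝ (e ∘ e'.symm) ((e' ∘ e.symm) u)).comp (fderiv ℝ (e' ∘ e.symm) u) =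
      ContinuousLinearMap.id ℝ E4 := by
    rw [← fderiv_id (𝕜 := ℝ) (x := u), ← h1.fderiv_eq]
    exact (fderiv_comp u hd' hd).symm
  ext a μ
  have h3 : fderiv ℝ (e ∘ e'.symm) ((e' ∘ e.symm) u) (fderiv ℝ (e' ∘ e.symm) u (bvec μ)) =
      bvec μ := congrArg (fun T : E4 →L[ℝ] E4 => T (bvec μ)) h2
  rw [clm_apply_eq_sum] at h3
  have h4 := congrArg (fun v : E4 => v a) h3
  simp only [Matrix.mul_apply, jacMatrix, Matrix.of_apply, Matrix.one_apply]
  rw [Finset.sum_congr rfl fun _ _ => mul_comm _ _]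
  refine Eq.trans ?_ (h4.trans ?_)
  · simp
  · simp [bvec]

theorem contDiff_coord_sub (u : E4) (a : Fin 4) : ContDiff ℝ ∞ fun x : E4 => x a - u a :=
  (EuclideanSpace.proj (𝕜 := ℝ) a).contDiff.sub contDiff_const

theorem pd_coord_sub (u x : E4) (a α : Fin 4) :
    pd (fun x : E4 => x a - u a) α x = if α = a then 1 else 0 := by
  have h : HasFDerivAt (fun x : E4 => x a - u a) (EuclideanSpace.proj a : E4 →L[ℝ] ℝ) x :=
    (EuclideanSpace.proj (𝕜 := ℝ) a : E4 →L[ℝ] ℝ).hasFDerivAt.sub_const _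
  unfold pd
  rw [h.fderiv]
  simp [bvec, eq_comm]

theorem pd_coord_sub_comp {χ : E4 → E4} {x : E4} (hχ : DifferentiableAt ℝ χ x) (u : E4)
    (a α : Fin 4) : pd (fun x => (χ x) a - u a) α x = jacMatrix χ x a α := by
  have h : HasFDerivAt (fun x => (χ x) a - u a)
      ((EuclideanSpace.proj a : E4 →L[ℝ] ℝ) ∘L fderiv ℝ χ x) x :=
    ((EuclideanSpace.proj (𝕜 := ℝ) a : E4 →L[ℝ] ℝ).hasFDerivAt.comp x hχ.hasFDerivAt).sub_const _
  unfold pd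
  rw [h.fderiv]
  rfl

/-- A transformation law solved for the new components. -/
theorem sum_mul_sum_of_mul_eq_one {J K : Matrix (Fin 4) (Fin 4) ℝ} (h : J * K = 1) (d : ℝ)
    (w : Fin 4 → ℝ) (α : Fin 4) : ∑ a, J α a * (d * ∑ β, K a β * w β) = d * w α := by
  calc _ = d * ∑ β, (J * K) α β * w β := by
        simp only [Matrix.mul_apply, Finset.sum_mul, Finset.mul_sum]
        rw [Finset.sum_comm]
        exact Finset.sum_congr rfl fun _ _ => Finset.sum_congr rfl fun _ _ => by ring
    _ = _ := by
      rw [h]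
      simp [Matrix.one_apply]

/-- The cancellation behind the transformation law of the boundary current: `j` stands for the
Jacobian matrix of the inverse coordinate change, `dj` for its derivatives. -/
theorem current_algebra (d : ℝ) (j X : Fin 4 → ℝ) (S dS dj : Fin 4 → Fin 4 → ℝ) :
    ((∑ β, j β * X β) + ∑ α, ∑ β, dj α β * S α β) * d -
      d * ∑ α, ∑ β, (j β * dS α β + S α β * dj α β) = d * ∑ β, j β * (X β - ∑ α, dS α β) := by
  have h1 : ∑ α, ∑ β, (j β * dS α β + S α β * dj α β) =
      (∑ β, j β * ∑ α, dS α β) + ∑ α, ∑ β, dj α β * S α β := by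
    simp only [Finset.sum_add_distrib, Finset.mul_sum]
    rw [Finset.sum_comm]
    simp only [mul_comm]
  simp only [h1, mul_sub, Finset.sum_sub_distrib]
  ring

variable {L : OpenPartialHomeomorph M E4 → JetCoord 2 → ℝ}

/-- The principal symbol is a tensor density: it is the value of the linearized Lagrangian on
`(x^a - u^a) (x^c - u^c) h` at the point `u`. -/
theorem symbolAt_push (hL : IsInvariantLagrangian L)
    {e e' : OpenPartialHomeomorph M E4} (he : e ∈ posAtlas M) (he' : e' ∈ posAtlas M)
    {g h : E4 → Fin 4 → Fin 4 → ℝ} (hg : ContDiff ℝ ∞ g) (hs : ∀ u μ ν, g u μ ν = g u ν μ)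
    (hh : ContDiff ℝ ∞ h) (hhs : ∀ u μ ν, h u μ ν = h u ν μ) {u : E4}
    (hu : u ∈ e.target ∩ e.symm ⁻¹' e'.source) (hl : IsLorentzian (matForm (g u))) (a c : Fin 4) :
    symbolAt (L e) g h a c u = (jacMatrix (e' ∘ e.symm) u).det *
      ∑ α, ∑ β, jacMatrix (e ∘ e'.symm) ((e' ∘ e.symm) u) a α *
        jacMatrix (e ∘ e'.symm) ((e' ∘ e.symm) u) c β *
        symbolAt (L e') (push e e' g) (push e e' h) α β ((e' ∘ e.symm) u) := by
  have hO := isOpen_overlap e' e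
  have hu' := overlap_image hu
  have hχ := eventually_of_contDiffOn hO (trans_contDiffOn he' he) hu'
  have hf := contDiff_coord_sub u a
  have hk := contDiff_coord_sub u c
  have h1 := variation_push (h := fun x => (x a - u a) • (x c - u c) • h x) hL he he' hg hs
    (hf.smul (hk.smul hh))
    (fun x μ ν => by simp [hhs x μ ν]) hu hl
  have h2 := variation_smul_smul (L e) g (u := u) (Eventually.of_forall fun _ => hf.contDiffAt)
    (Eventually.of_forall fun _ => hk.contDiffAt)
    (Eventually.of_forall fun _ => hh.contDiffAt) (sub_self _) (sub_self _)
  have h3 := variation_smul_smul (L e') (push e e' g) (u := (e' ∘ e.symm) u)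
    (f := fun x => ((e ∘ e'.symm) x) a - u a) (k := fun x => ((e ∘ e'.symm) x) c - u c)
    (h := push e e' h)
    (hχ.mono fun x hx => hf.contDiffAt.comp x hx) (hχ.mono fun x hx => hk.contDiffAt.comp x hx)
    (eventually_of_contDiffOn hO (push_contDiffOn he he' hh) hu')
    (by rw [overlap_inv hu, sub_self]) (by rw [overlap_inv hu, sub_self])
  rw [h2, push_smul e e' _ fun x => (x c - u c) • h x, push_smul e e' _ h, h3, det_fderiv] at h1
  simp only [pd_coord_sub, pd_coord_sub_comp hχ.self_of_nhds.diff, mul_assoc, ite_mul, one_mul,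
    zero_mul, Finset.sum_ite_eq', Finset.mem_univ, if_true, mul_ite, mul_one, mul_zero] at h1
  simp only [mul_assoc]
  linarith

/-- The boundary current of a variation is a vector density. The linearized Lagrangian on
`(x^c - u^c) h` gives the transformation law of `X^c`, in which the second derivatives of the
coordinate change appear; they cancel those in the divergence of the symbol. -/
theorem current_push (hL : IsInvariantLagrangian L)
    {e e' : OpenPartialHomeomorph M E4} (he : e ∈ posAtlas M) (he' : e' ∈ posAtlas M)
    {g h : E4 → Fin 4 → Fin 4 → ℝ} (hg : ContDiff ℝ ∞ g) (hs : ∀ u μ ν, g u μ ν = g u ν μ)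
    (hh : ContDiff ℝ ∞ h) (hhs : ∀ u μ ν, h u μ ν = h u ν μ) {u : E4}
    (hu : u ∈ e.target ∩ e.symm ⁻¹' e'.source) (hl : IsLorentzian (matForm (g u))) (c : Fin 4) :
    current (L e) g h c u = (jacMatrix (e' ∘ e.symm) u).det *
      ∑ β, jacMatrix (e ∘ e'.symm) ((e' ∘ e.symm) u) c β *
        current (L e') (push e e' g) (push e e' h) β ((e' ∘ e.symm) u) := by
  have hO := isOpen_overlap e' e
  have hu' := overlap_image hu
  have hn := hO.mem_nhds hu'
  have hχ := eventually_of_contDiffOn hO (trans_contDiffOn he' he) hu'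
  have hf := contDiff_coord_sub u c
  -- regularity of the data in both coordinate systems
  have hF := hL.contDiffAt_jetOf he (hs u) hu.1 hl
  have hF' := hL.contDiffAt_jetOf he' (fun μ ν => pull_symm _ _ (hs _) μ ν) hu'.1
    (isLorentzian_push he he' hg hs hu hl)
  have hj : DifferentiableAt ℝ (jetOf 2 g) u :=
    ((contDiffOn_jetOf isOpen_univ hg.contDiffOn).contDiffAt univ_mem).diff
  have hj' : DifferentiableAt ℝ (jetOf 2 (push e e' g)) ((e' ∘ e.symm) u) :=
    ((contDiffOn_jetOf hO (push_contDiffOn he he' hg)).contDiffAt hn).diff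
  have hd' : DifferentiableAt ℝ (push e e' h) ((e' ∘ e.symm) u) :=
    ((push_contDiffOn he he' hh).contDiffAt hn).diff
  -- the transformation law of `subsymbolAt`
  have h1 := variation_push (h := fun x => (x c - u c) • h x) hL he he' hg hs
    (hf.smul hh) (fun x μ ν => by simp [hhs x μ ν]) hu hl
  have h2 := variation_smul (L e) g (u := u) (Eventually.of_forall fun _ => hf.contDiffAt)
    (Eventually.of_forall fun _ => hh.contDiffAt) (sub_self _)
  have h3 := variation_smul (L e') (push e e' g) (u := (e' ∘ e.symm) u)
    (f := fun x => ((e ∘ e'.symm) x) c - u c) (h := push e e' h)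
    (hχ.mono fun x hx => hf.contDiffAt.comp x hx)
    (eventually_of_contDiffOn hO (push_contDiffOn he he' hh) hu')
    (by rw [overlap_inv hu, sub_self])
  have h4 : ∀ α β, pd (pd (fun x => ((e ∘ e'.symm) x) c - u c) β) α ((e' ∘ e.symm) u) =
      pd (fun x => jacMatrix (e ∘ e'.symm) x c β) α ((e' ∘ e.symm) u) := fun α β =>
    (pd_congr (hχ.mono fun x hx => pd_coord_sub_comp hx.diff u c β) α).eq_of_nhds
  have h5 : ∀ α β, pd (pd (fun x : E4 => x c - u c) β) α u = 0 := fun α β => by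
    have : pd (fun x : E4 => x c - u c) β = fun _ => if β = c then 1 else 0 :=
      funext fun x => pd_coord_sub u x c β
    rw [this]
    simp [pd]
  rw [h2, push_smul e e' _ h, h3, det_fderiv] at h1
  simp only [h4, h5, pd_coord_sub, pd_coord_sub_comp hχ.self_of_nhds.diff, ite_mul, one_mul,
    zero_mul, Finset.sum_ite_eq', Finset.mem_univ, if_true, Finset.sum_const_zero, add_zero] at h1
  -- the transformation law of the divergence of the symbol
  have hS' := fun α β => differentiableAt_symbolAt hF' hj' hd' α β
  have hJ' := fun β => differentiableAt_jacMatrix hχ.self_of_nhds c β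
  have h6 := divergence_density (ψ := e' ∘ e.symm) (u := u)
    ((trans_contDiffOn he he').contDiffAt ((isOpen_overlap e e').mem_nhds hu))
    (jacMatrix_mul he he' hu) (V := fun a => symbolAt (L e) g h a c)
    (W := fun α x => ∑ β, jacMatrix (e ∘ e'.symm) x c β *
      symbolAt (L e') (push e e' g) (push e e' h) α β x)
    (fun a => differentiableAt_symbolAt hF hj hh.contDiffAt.diff a c)
    (fun α => DifferentiableAt.fun_sum fun β _ => (hJ' β).mul (hS' α β)) (by
      have ho := isOpen_lorentzian (isOpen_overlap e e') hg.continuous.continuousOn hs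
      filter_upwards [ho.mem_nhds ⟨hu, hl⟩] with x hx α
      have hm := mul_eq_one_comm.1 (jacMatrix_mul he he' hx.1)
      have e1 : ∀ a, symbolAt (L e) g h a c x = (jacMatrix (e' ∘ e.symm) x).det *
          ∑ α, jacMatrix (e ∘ e'.symm) ((e' ∘ e.symm) x) a α *
            ∑ β, jacMatrix (e ∘ e'.symm) ((e' ∘ e.symm) x) c β *
              symbolAt (L e') (push e e' g) (push e e' h) α β ((e' ∘ e.symm) x) := fun a => by
        rw [symbolAt_push hL he he' hg hs hh hhs hx.1 hx.2]
        simp only [Finset.mul_sum, mul_assoc]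
      simp only [e1]
      exact sum_mul_sum_of_mul_eq_one hm _ _ _)
  have h7 : ∀ α, pd (fun x => ∑ β, jacMatrix (e ∘ e'.symm) x c β *
      symbolAt (L e') (push e e' g) (push e e' h) α β x) α ((e' ∘ e.symm) u) =
      ∑ β, (jacMatrix (e ∘ e'.symm) ((e' ∘ e.symm) u) c β *
        pd (symbolAt (L e') (push e e' g) (push e e' h) α β) α ((e' ∘ e.symm) u) +
        symbolAt (L e') (push e e' g) (push e e' h) α β ((e' ∘ e.symm) u) *
        pd (fun x => jacMatrix (e ∘ e'.symm) x c β) α ((e' ∘ e.symm) u)) := fun α => by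
    rw [pd_sum (f := fun β x => jacMatrix (e ∘ e'.symm) x c β *
      symbolAt (L e') (push e e' g) (push e e' h) α β x) fun β _ => (hJ' β).mul (hS' α β)]
    exact Finset.sum_congr rfl fun β _ => pd_mul (hJ' β) (hS' α β) α
  rw [Finset.sum_congr rfl fun α _ => h7 α] at h6
  rw [current_eq (L e) g hF hj hh.contDiffAt.diff, h6, ← h1]
  simp only [current_eq (L e') (push e e' g) hF' hj' hd']
  exact current_algebra _ _ _ _ _ _

end Density

/-! ### Exterior forms -/

theorem wedge_apply {k : ℕ} (η : TotalCoord →L[ℝ] ℝ) (ξ : TotalCoord [⋀^Fin k]→L[ℝ] ℝ)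
    (v : Fin (k + 1) → TotalCoord) :
    wedge η ξ v = ∑ i : Fin (k + 1), (-1) ^ (i : ℕ) * (η (v i) * ξ (i.removeNth v)) := by
  unfold wedge
  rw [ContinuousAlternatingMap.alternatizeUncurryFin_apply]
  refine Finset.sum_congr rfl fun i _ => ?_
  simp

theorem wedge_comp {k : ℕ} (η : TotalCoord →L[ℝ] ℝ) (ξ : TotalCoord [⋀^Fin k]→L[ℝ] ℝ)
    (T : TotalCoord →L[ℝ] TotalCoord) : (wedge η ξ).compContinuousLinearMap T =
      wedge (η ∘L T) (ξ.compContinuousLinearMap T) := by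
  ext v
  rw [ContinuousAlternatingMap.compContinuousLinearMap_apply, wedge_apply, wedge_apply]
  rfl

/-- The wedge product as a bilinear map. -/
def wedgeBilin (k : ℕ) : (TotalCoord →L[ℝ] ℝ) →ₗ[ℝ] (TotalCoord [⋀^Fin k]→L[ℝ] ℝ) →ₗ[ℝ]
    (TotalCoord [⋀^Fin (k + 1)]→L[ℝ] ℝ) :=
  LinearMap.mk₂ ℝ wedge
    (fun η η' ξ => by
      ext v
      simp only [wedge_apply, ContinuousAlternatingMap.add_apply, add_apply,
        ← Finset.sum_add_distrib]
      exact Finset.sum_congr rfl fun _ _ => by ring)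
    (fun c η ξ => by
      ext v
      simp only [wedge_apply, ContinuousAlternatingMap.smul_apply, smul_apply, smul_eq_mul,
        Finset.mul_sum]
      exact Finset.sum_congr rfl fun _ _ => by ring)
    (fun η ξ ξ' => by
      ext v
      simp only [wedge_apply, ContinuousAlternatingMap.add_apply, ← Finset.sum_add_distrib]
      exact Finset.sum_congr rfl fun _ _ => by ring)
    (fun c η ξ => by
      ext v
      simp only [wedge_apply, ContinuousAlternatingMap.smul_apply, smul_eq_mul, Finset.mul_sum]
      exact Finset.sum_congr rfl fun _ _ => by ring)

theorem wedgeBilin_apply {k : ℕ} (η : TotalCoord →L[ℝ] ℝ) (ξ : TotalCoord [⋀^Fin k]→L[ℝ] ℝ) :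
    wedgeBilin k η ξ = wedge η ξ := rfl

/-- The inclusion of `ℝ⁴` as the space of the coordinates `x^μ`. -/
def xIncl : E4 →L[ℝ] TotalCoord :=
  ContinuousLinearMap.inl ℝ (JetCoord 3) (ℝ × (Fin 4 → ℝ)) ∘L
    ContinuousLinearMap.inl ℝ E4 ((i : Fin 4) → JetArr i)

/-- The projection to the coordinates `x^μ`. -/
def xProj : TotalCoord →L[ℝ] E4 :=
  ContinuousLinearMap.fst ℝ E4 ((i : Fin 4) → JetArr i) ∘L
    ContinuousLinearMap.fst ℝ (JetCoord 3) (ℝ × (Fin 4 → ℝ))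

/-- The form `d₄x` depends only on the `x^μ`-components of its arguments. -/
theorem d4x_comp_proj : d4x = d4x.compContinuousLinearMap (xIncl ∘L xProj) := by
  unfold d4x
  simp only [wedge_comp]
  rfl

/-- The volume form on `ℝ⁴`. -/
def vol4 : E4 [⋀^Fin 4]→L[ℝ] ℝ := d4x.compContinuousLinearMap xIncl

theorem d4x_apply (v : Fin 4 → TotalCoord) : d4x v = vol4 fun i => (v i).1.1 := by
  conv_lhs => rw [d4x_comp_proj]
  rfl

theorem vol4_comp (A : E4 →L[ℝ] E4) (v : Fin 4 → E4) :
    vol4 (fun i => A (v i)) = A.det * vol4 v := by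
  have h := vol4.toAlternatingMap.eq_smul_basis_det (EuclideanSpace.basisFun (Fin 4) ℝ).toBasis
  have h2 : ∀ v, vol4 v = vol4.toAlternatingMap (EuclideanSpace.basisFun (Fin 4) ℝ).toBasis *
      (EuclideanSpace.basisFun (Fin 4) ℝ).toBasis.det v := fun v =>
    congrArg (fun f : E4 [⋀^Fin 4]→ₗ[ℝ] ℝ => f v) h
  rw [h2, h2 v]
  have h3 := Module.Basis.det_comp (EuclideanSpace.basisFun (Fin 4) ℝ).toBasis
    (A : E4 →ₗ[ℝ] E4) v
  have h4 : (EuclideanSpace.basisFun (Fin 4) ℝ).toBasis.det (fun i => A (v i)) =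
    A.det * (EuclideanSpace.basisFun (Fin 4) ℝ).toBasis.det v := h3
  rw [h4]
  ring

theorem d4x_comp {T : TotalCoord →L[ℝ] TotalCoord} {A : E4 →L[ℝ] E4}
    (hT : ∀ v, (T v).1.1 = A v.1.1) : d4x.compContinuousLinearMap T = A.det • d4x := by
  ext v
  rw [ContinuousAlternatingMap.compContinuousLinearMap_apply, d4x_apply,
    ContinuousAlternatingMap.smul_apply, d4x_apply, smul_eq_mul, ← vol4_comp]
  exact congrArg vol4 (funext fun i => hT _)

theorem d3x_apply (β : Fin 4) (v : Fin 3 → TotalCoord) :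
    d3x β v = vol4 (Matrix.vecCons (bvec β) fun i => (v i).1.1) := by
  have h : d3x β v = d4x (Matrix.vecCons ((bvec β, 0), 0) v) := rfl
  rw [h, d4x_apply]
  congr 1
  ext i : 1
  refine Fin.cases ?_ (fun j => ?_) i <;> rfl

theorem vol4_vecCons_sum (c : Fin 4 → ℝ) (v : Fin 3 → E4) :
    vol4 (Matrix.vecCons (∑ a, c a • bvec a) v) = ∑ a, c a * vol4 (Matrix.vecCons (bvec a) v) := by
  let f : E4 →ₗ[ℝ] ℝ :=
    { toFun := fun x => vol4.curryLeft x v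
      map_add' := fun x y => by rw [map_add]; rfl
      map_smul' := fun r x => by rw [map_smul]; rfl }
  have h : f (∑ a, c a • bvec a) = ∑ a, c a * f (bvec a) := by
    rw [map_sum]
    simp only [map_smul, smul_eq_mul]
  exact h

/-- The transformation law of the forms `∂_β ⌟ d₄x`. -/
theorem d3x_comp {T : TotalCoord →L[ℝ] TotalCoord} {A : E4 →L[ℝ] E4}
    (hT : ∀ v, (T v).1.1 = A v.1.1) {B : Matrix (Fin 4) (Fin 4) ℝ}
    (hB : ∀ β, A (∑ c, B c β • bvec c) = bvec β) (β : Fin 4) :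
    (d3x β).compContinuousLinearMap T = ∑ c, (A.det * B c β) • d3x c := by
  ext v
  have h1 : (Matrix.vecCons (bvec β) fun i => (T (v i)).1.1 : Fin 4 → E4) = fun i =>
      A ((Matrix.vecCons (∑ c, B c β • bvec c) fun i => (v i).1.1 : Fin 4 → E4) i) := by
    ext i : 1
    refine Fin.cases ?_ (fun j => ?_) i
    · exact (hB β).symm
    · exact hT _
  rw [ContinuousAlternatingMap.compContinuousLinearMap_apply, d3x_apply]
  have h2 := vol4_comp A (Matrix.vecCons (∑ c, B c β • bvec c) fun i => (v i).1.1)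
  rw [vol4_vecCons_sum] at h2
  refine (congrArg vol4 h1).trans (h2.trans ?_)
  rw [ContinuousAlternatingMap.sum_apply, Finset.mul_sum]
  refine Finset.sum_congr rfl fun c _ => ?_
  rw [ContinuousAlternatingMap.smul_apply, d3x_apply, smul_eq_mul, mul_assoc]

/-- The form `ℓ d₄x + j^β ∧ (∂_β ⌟ d₄x)`. -/
def lepageForm (ℓ : ℝ) (j : Fin 4 → TotalCoord →L[ℝ] ℝ) : TotalCoord [⋀^Fin 4]→L[ℝ] ℝ :=
  ℓ • d4x + ∑ β, wedge (j β) (d3x β)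

/-- The form `ℓ d₄x + j^β ∧ (∂_β ⌟ d₄x)` is invariant if `ℓ` transforms as a scalar density and the
`j^β` as the components of a vector density. Here `A` is the derivative of the change of the
coordinates `x^μ` and `B` its inverse matrix. -/
theorem lepageForm_comp {T : TotalCoord →L[ℝ] TotalCoord} {A : E4 →L[ℝ] E4}
    (hT : ∀ v, (T v).1.1 = A v.1.1) {B : Matrix (Fin 4) (Fin 4) ℝ}
    (hB : ∀ β, A (∑ c, B c β • bvec c) = bvec β) {ℓ ℓ' : ℝ} {j j' : Fin 4 → TotalCoord →L[ℝ] ℝ}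
    (hℓ : ℓ = ℓ' * A.det) (hj : ∀ c v, j c v = A.det * ∑ β, B c β * j' β (T v)) :
    (lepageForm ℓ' j').compContinuousLinearMap T = lepageForm ℓ j := by
  have h1 : (lepageForm ℓ' j').compContinuousLinearMap T =
      ℓ' • d4x.compContinuousLinearMap T +
        ∑ β, (wedge (j' β) (d3x β)).compContinuousLinearMap T := by
    ext v
    simp [lepageForm, ContinuousAlternatingMap.sum_apply]
  have h2 : ∀ c, j c = ∑ β, (A.det * B c β) • (j' β ∘L T) := fun c => by
    refine ContinuousLinearMap.ext fun v => ?_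
    rw [hj, sum_apply, Finset.mul_sum]
    exact Finset.sum_congr rfl fun β _ => (mul_assoc _ _ _).symm
  have h3 : ∀ β, (wedge (j' β) (d3x β)).compContinuousLinearMap T =
      ∑ c, (A.det * B c β) • wedgeBilin 3 (j' β ∘L T) (d3x c) := fun β => by
    rw [wedge_comp, d3x_comp hT hB, ← wedgeBilin_apply, map_sum]
    simp only [map_smul]
  rw [h1, d4x_comp hT, Finset.sum_congr rfl fun β _ => h3 β]
  unfold lepageForm
  simp only [← wedgeBilin_apply, h2, map_sum, map_smul, LinearMap.sum_apply, LinearMap.smul_apply]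
  rw [Finset.sum_comm, hℓ, smul_smul]

/-! ### Contact forms and changes of coordinates -/

theorem jetOf_apply {k : ℕ} {g : E4 → Fin 4 → Fin 4 → ℝ} {s : Set E4} (ho : IsOpen s)
    (hg : ContDiffOn ℝ ∞ g s) (hs : ∀ x ∈ s, ∀ μ ν, g x μ ν = g x ν μ) {u : E4} (hu : u ∈ s)
    (i : Fin (k + 1)) (l : Fin i → Fin 4) :
    ((jetOf k g u).2 i).1 l = iteratedFDeriv ℝ i g u fun j => bvec (l j) := by
  have hm : (fun l : Fin i → Fin 4 => iteratedFDeriv ℝ i g u fun j => bvec (l j)) ∈ JetArr i := by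
    refine ⟨fun l μ ν => ?_, fun l τ => iteratedFDeriv_symm ho hg i hu (fun j => bvec (l j)) τ⟩
    let S : (Fin 4 → Fin 4 → ℝ) →L[ℝ] (Fin 4 → Fin 4 → ℝ) := LinearMap.toContinuousLinearMap
      { toFun := fun y μ ν => y ν μ, map_add' := fun _ _ => rfl, map_smul' := fun _ _ => rfl }
    have h1 : S ∘ g =ᶠ[𝓝 u] g :=
      Filter.eventuallyEq_of_mem (ho.mem_nhds hu) fun x hx => by
        funext μ ν; exact hs x hx ν μ
    have h2 := S.iteratedFDeriv_comp_left (hg.contDiffAt (ho.mem_nhds hu)) (i := i)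
      (by exact_mod_cast le_top)
    rw [(h1.iteratedFDeriv ℝ i).eq_of_nhds] at h2
    exact congrArg (fun T : ContinuousMultilinearMap ℝ (fun _ : Fin i => E4)
      (Fin 4 → Fin 4 → ℝ) => T (fun j => bvec (l j)) μ ν) h2
  simp only [jetOf]
  rw [symArr_of_symm _ hm]

theorem jetOf_polyMetric {k : ℕ} (w : JetCoord k) : jetOf k (polyMetric w) w.1 = w := by
  refine Prod.ext rfl (funext fun i => Subtype.ext (funext fun l => ?_))
  rw [jetOf_apply isOpen_univ (polyMetric_contDiffOn w _)
    (fun x _ => polyMetric_symm w x) (mem_univ _), iteratedFDeriv_polyMetric]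

theorem zCoord_zero_jetOf {k : ℕ} {g : E4 → Fin 4 → Fin 4 → ℝ} {s : Set E4} (ho : IsOpen s)
    (hg : ContDiffOn ℝ ∞ g s) (hs : ∀ x ∈ s, ∀ μ ν, g x μ ν = g x ν μ) {u : E4} (hu : u ∈ s)
    (μ ν : Fin 4) :
    zCoord 0 (Nat.zero_le k) ![] μ ν (jetOf k g u) = g u μ ν :=
  congrFun₂ (jetOf_apply ho hg hs hu (0 : Fin (k + 1)) ![]) μ ν

theorem zCoord_one_jetOf {k : ℕ} {g : E4 → Fin 4 → Fin 4 → ℝ} {s : Set E4} (ho : IsOpen s)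
    (hg : ContDiffOn ℝ ∞ g s) (hs : ∀ x ∈ s, ∀ μ ν, g x μ ν = g x ν μ) {u : E4} (hu : u ∈ s)
    (hk : 1 ≤ k) (α μ ν : Fin 4) :
    zCoord 1 hk ![α] μ ν (jetOf k g u) = pd (fun x => g x μ ν) α u := by
  refine (congrFun₂ (jetOf_apply ho hg hs hu ⟨1, Nat.lt_succ_of_le hk⟩ ![α]) μ ν).trans ?_
  exact iteratedFDeriv_one_bvec (hg.contDiffAt (ho.mem_nhds hu)).diff α μ ν

theorem zCoord_two_jetOf {k : ℕ} {g : E4 → Fin 4 → Fin 4 → ℝ} {s : Set E4} (ho : IsOpen s)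
    (hg : ContDiffOn ℝ ∞ g s) (hs : ∀ x ∈ s, ∀ μ ν, g x μ ν = g x ν μ) {u : E4} (hu : u ∈ s)
    (hk : 2 ≤ k) (α β μ ν : Fin 4) :
    zCoord 2 hk ![α, β] μ ν (jetOf k g u) = pd (pd (fun x => g x μ ν) β) α u := by
  refine (congrFun₂ (jetOf_apply ho hg hs hu ⟨2, Nat.lt_succ_of_le hk⟩ ![α, β]) μ ν).trans ?_
  exact iteratedFDeriv_two_bvec (hg.contDiffAt (ho.mem_nhds hu))
    ((eventually_of_contDiffOn ho hg hu).mono fun x hx => hx.diff) α β μ ν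

theorem zCoord_two_swap {k : ℕ} (hk : 2 ≤ k) (α β μ ν : Fin 4) (w : JetCoord k) :
    zCoord 2 hk ![α, β] μ ν w = zCoord 2 hk ![β, α] μ ν w := by
  have h := (w.2 ⟨2, Nat.lt_succ_of_le hk⟩).2.2 ![β, α] (Equiv.swap (0 : Fin 2) 1)
  have h2 : (![β, α] : Fin 2 → Fin 4) ∘ Equiv.swap (0 : Fin 2) 1 = ![α, β] := by
    ext j
    fin_cases j <;> simp
  have h3 := congrFun₂ ((congrArg (w.2 ⟨2, Nat.lt_succ_of_le hk⟩).1 h2).symm.trans h) μ ν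
  exact h3

/-- A tangent vector at the jet of `g` is the sum of a vector tangent to the prolonged section
`j³g` and of the jet of a variation `h`. The contact forms read off the `1`-jet of `h`. -/
theorem contact_eq {g h : E4 → Fin 4 → Fin 4 → ℝ} {s : Set E4} (ho : IsOpen s)
    (hg : ContDiffOn ℝ ∞ g s) (hs : ∀ x ∈ s, ∀ μ ν, g x μ ν = g x ν μ)
    (hh : ContDiffOn ℝ ∞ h s) (hhs : ∀ x ∈ s, ∀ μ ν, h x μ ν = h x ν μ) {u : E4} (hu : u ∈ s)
    {w v : TotalCoord} (hw : w.1 = jetOf 3 g u)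
    (hv : v.1 = fderiv ℝ (jetOf 3 g) u v.1.1 + ((0, (jetOf 3 h u).2) : JetCoord 3)) (μ ν : Fin 4) :
    contactY w μ ν v = h u μ ν ∧
      ∀ α, contactZ w μ ν α v = pd (fun x => h x μ ν) α u := by
  have hj : DifferentiableAt ℝ (jetOf 3 g) u :=
    ((contDiffOn_jetOf ho hg).contDiffAt (ho.mem_nhds hu)).diff
  have e0 : ∀ (i : ℕ) (hi : i ≤ 3) (l : Fin i → Fin 4), dz i hi l μ ν v =
      fderiv ℝ (fun x => zCoord i hi l μ ν (jetOf 3 g x)) u v.1.1 +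
        zCoord i hi l μ ν (jetOf 3 h u) := by
    intro i hi l
    have h1 : fderiv ℝ (fun x => zCoord i hi l μ ν (jetOf 3 g x)) u =
        zCoord i hi l μ ν ∘L fderiv ℝ (jetOf 3 g) u :=
      ((zCoord i hi l μ ν).hasFDerivAt.comp u hj.hasFDerivAt).fderiv
    have h2 : dz i hi l μ ν v = zCoord i hi l μ ν v.1 := rfl
    rw [h1, h2]
    exact (congrArg (zCoord i hi l μ ν) hv).trans (map_add _ _ _)
  have hn := ho.mem_nhds hu
  have ex : ∀ γ (v : TotalCoord), dx γ v = v.1.1 γ := fun _ _ => rfl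
  constructor
  · have h1 : (fun x => zCoord 0 (Nat.zero_le 3) ![] μ ν (jetOf 3 g x)) =ᶠ[𝓝 u]
        fun x => g x μ ν :=
      Filter.eventuallyEq_of_mem hn fun x hx => zCoord_zero_jetOf ho hg hs hx μ ν
    unfold contactY
    rw [sub_apply, e0, h1.fderiv_eq, zCoord_zero_jetOf ho hh hhs hu, fderiv_eq_sum_pd, sum_apply,
      hw]
    simp only [smul_apply, smul_eq_mul, ex, zCoord_one_jetOf ho hg hs hu]
    simp only [mul_comm]
    ring
  · intro α
    have h1 : (fun x => zCoord 1 (by norm_num) ![α] μ ν (jetOf 3 g x)) =ᶠ[𝓝 u]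
        pd (fun x => g x μ ν) α :=
      Filter.eventuallyEq_of_mem hn fun x hx => zCoord_one_jetOf ho hg hs hx _ α μ ν
    unfold contactZ
    rw [sub_apply, e0, h1.fderiv_eq, zCoord_one_jetOf ho hh hhs hu, fderiv_eq_sum_pd, sum_apply, hw]
    simp only [smul_apply, smul_eq_mul, ex, zCoord_two_swap _ α, zCoord_two_jetOf ho hg hs hu]
    simp only [mul_comm]
    ring

theorem hasDerivAt_jetOf_curve {k : ℕ} {g h : E4 → Fin 4 → Fin 4 → ℝ} {s : Set E4} (ho : IsOpen s)
    (hg : ContDiffOn ℝ ∞ g s) (hh : ContDiffOn ℝ ∞ h s) {γ : ℝ → E4} {γ' : E4}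
    (hγ : HasDerivAt γ γ' 0) (hu : γ 0 ∈ s) :
    HasDerivAt (fun t : ℝ => jetOf k (fun x => g x + t • h x) (γ t))
      (fderiv ℝ (jetOf k g) (γ 0) γ' + ((0, (jetOf k h (γ 0)).2) : JetCoord k)) 0 := by
  have hn := ho.mem_nhds hu
  have h1 : HasDerivAt (fun t => jetOf k g (γ t)) (fderiv ℝ (jetOf k g) (γ 0) γ') 0 :=
    ((contDiffOn_jetOf ho hg).contDiffAt hn).diff.hasFDerivAt.comp_hasDerivAt (0 : ℝ) hγ
  have h2 : DifferentiableAt ℝ (fun t => ((0, (jetOf k h (γ t)).2) : JetCoord k)) 0 := by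
    have h3 : DifferentiableAt ℝ (fun t => jetOf k h (γ t)) 0 :=
      (((contDiffOn_jetOf ho hh).contDiffAt hn).diff.hasFDerivAt.comp_hasDerivAt (0 : ℝ)
        hγ).differentiableAt
    exact (differentiableAt_const _).prodMk h3.snd
  have h4 := h1.add ((hasDerivAt_id (0 : ℝ)).smul h2.hasDerivAt)
  simp only [id, zero_smul, one_smul, zero_add] at h4
  refine h4.congr_of_eventuallyEq ?_
  filter_upwards [hγ.continuousAt.preimage_mem_nhds hn] with t ht
  exact jetOf_add_smul (hg.contDiffAt (ho.mem_nhds ht)) (hh.contDiffAt (ho.mem_nhds ht)) t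

section Change

variable {M : Type*} [TopologicalSpace M] [ChartedSpace E4 M] [HasGroupoid M orientedGroupoid]

/-- The coordinates `e'` of the point whose coordinates `e` are given by the jet of `g`. -/
theorem coord_ofCoord_jetOf {e e' : OpenPartialHomeomorph M E4} (he : e ∈ posAtlas M)
    (he' : e' ∈ posAtlas M) {g : E4 → Fin 4 → Fin 4 → ℝ} (hg : ContDiff ℝ ∞ g)
    (hs : ∀ u μ ν, g u μ ν = g u ν μ) {u : E4} (hu : u ∈ e.target ∩ e.symm ⁻¹' e'.source)
    (hl : IsLorentzian (matForm (g u))) (t : ℝ) (z : Fin 4 → ℝ)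
    (hw : ((jetOf 3 g u, t, z) : TotalCoord) ∈ coordTarget e) :
    (TotalJet.ofCoord he _ hw).coord e' = (jetOf 3 (push e e' g) ((e' ∘ e.symm) u), t,
      fun μ => ∑ a, z a * jacMatrix (e ∘ e'.symm) ((e' ∘ e.symm) u) a μ) := by
  have hd := (mem_dom_ofComps_iff he hg.contDiffOn hs hu.1).2 hl
  have hd' : e.symm u ∈ (LocalScalar.ofCoord he u t z).dom := e.map_target hu.1
  have hj : ∀ {e' : OpenPartialHomeomorph M E4}, e' ∈ posAtlas M → e.symm u ∈ e'.source →
      TotalJet.coord e' ⟨(LocalMetric.ofComps he g hg.contDiffOn hs).jet 3 (e.symm u) hd,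
        (LocalScalar.ofCoord he u t z).jet (e.symm u) hd', rfl⟩ =
      ((LocalMetric.ofComps he g hg.contDiffOn hs).jetCoord 3 e' (e' (e.symm u)),
        ((LocalScalar.ofCoord he u t z).jetCoord e' (e' (e.symm u))).2) :=
    fun {e'} he' hx => Prod.ext
    (MetricJet.coord_jet (LocalMetric.ofComps he g hg.contDiffOn hs) 3 hd he' hx)
    (congrArg (fun p : E4 × ℝ × (Fin 4 → ℝ) => p.2)
      (ScalarJet.coord_jet (LocalScalar.ofCoord he u t z) hd' he' hx))
  have h1 : TotalJet.ofCoord he _ hw =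
      ⟨(LocalMetric.ofComps he g hg.contDiffOn hs).jet 3 (e.symm u) hd,
        (LocalScalar.ofCoord he u t z).jet (e.symm u) hd', rfl⟩ := by
    refine (TotalJet.coord_bijOn he).injOn (e.map_target hu.1) (e.map_target hu.1) ?_
    rw [TotalJet.coord_ofCoord, hj he (e.map_target hu.1), e.right_inv hu.1]
    refine Prod.ext ?_ ?_
    · exact jetOf_congr (Filter.eventuallyEq_of_mem (e.open_target.mem_nhds hu.1)
        fun x hx => (comps_tensorOfComps he _ hx).symm)
    · exact (congrArg Prod.snd (ofCoord_jetCoord he hu.1 t z)).symm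
  rw [h1, hj he' hu.2]
  refine Prod.ext ?_ ?_
  · exact jetOf_congr (Filter.eventuallyEq_of_mem ((isOpen_overlap e' e).mem_nhds
      (overlap_image hu)) fun x hx => comps_ofComps he he' hg.contDiffOn hs hx)
  · have h2 := scalar_change (LocalScalar.ofCoord he u t z) he he' (overlap_image hu)
      (overlap_image hu).2
    have h3 := overlap_inv hu
    simp only [Function.comp] at h3 h2
    rw [h3, ofCoord_jetCoord he hu.1] at h2
    exact congrArg (fun p : E4 × ℝ × (Fin 4 → ℝ) => p.2) h2

/-- The derivative of the change of coordinates of the fibre product, at the point with coordinates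
`w` and applied to the vector `v`: if `v` is the velocity of the jets of a family of metrics
`g + t h` along a curve in `M`, then its image is the velocity of the jets of the transformed
family. -/
theorem fderiv_coord_change {e e' : OpenPartialHomeomorph M E4} (he : e ∈ posAtlas M)
    (he' : e' ∈ posAtlas M) {f : TotalCoord → TotalCoord}
    (hf : ∀ w (hw : w ∈ coordTarget e), f w = (TotalJet.ofCoord he w hw).coord e')
    {w : TotalCoord} (hw : w ∈ coordTarget e) (hw' : e.symm w.1.1 ∈ e'.source) (v : TotalCoord) :
    ∃ h : E4 → Fin 4 → Fin 4 → ℝ, ContDiff ℝ ∞ h ∧ (∀ u μ ν, h u μ ν = h u ν μ) ∧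
      v.1 = fderiv ℝ (jetOf 3 (polyMetric w.1)) w.1.1 v.1.1 +
        ((0, (jetOf 3 h w.1.1).2) : JetCoord 3) ∧
      (fderiv ℝ f w v).1 = fderiv ℝ (jetOf 3 (push e e' (polyMetric w.1)))
        ((e' ∘ e.symm) w.1.1) (fderiv ℝ f w v).1.1 +
        ((0, (jetOf 3 (push e e' h) ((e' ∘ e.symm) w.1.1)).2) : JetCoord 3) ∧
      (fderiv ℝ f w v).1.1 = fderiv ℝ (e' ∘ e.symm) w.1.1 v.1.1 ∧
      (fderiv ℝ f w v).2.1 = v.2.1 := by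
  set u := w.1.1 with hu
  set g := polyMetric w.1 with hgd
  have hg : ContDiff ℝ ∞ g := contDiffOn_univ.1 (polyMetric_contDiffOn _ _)
  have hs : ∀ u μ ν, g u μ ν = g u ν μ := polyMetric_symm w.1
  -- the variation `h` whose jet is the difference of `v` and a vector tangent to `j³g`
  set b : JetCoord 3 := (u, v.1.2 - (fderiv ℝ (jetOf 3 g) u v.1.1).2) with hb
  set h := polyMetric b with hhd
  have hh : ContDiff ℝ ∞ h := contDiffOn_univ.1 (polyMetric_contDiffOn _ _)
  have hhs : ∀ u μ ν, h u μ ν = h u ν μ := polyMetric_symm b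
  have hO : u ∈ e.target ∩ e.symm ⁻¹' e'.source := ⟨hw.1, hw'⟩
  have hfst : ∀ {G : E4 → Fin 4 → Fin 4 → ℝ} {x : E4} (_ : DifferentiableAt ℝ (jetOf 3 G) x)
      (y : E4), (fderiv ℝ (jetOf 3 G) x y).1 = y := by
    intro G x hG y
    have h1 : fderiv ℝ (fun x => (jetOf 3 G x).1) x = _ :=
      ((ContinuousLinearMap.fst ℝ E4 ((i : Fin 4) → JetArr i)).hasFDerivAt.comp x
        hG.hasFDerivAt).fderiv
    have h2 : (fun x => (jetOf 3 G x).1) = id := rfl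
    rw [h2, fderiv_id] at h1
    exact (congrArg (fun T : E4 →L[ℝ] E4 => T y) h1).symm
  have hjg : DifferentiableAt ℝ (jetOf 3 g) u :=
    ((contDiffOn_jetOf isOpen_univ hg.contDiffOn).contDiffAt univ_mem).diff
  have hv : v.1 = fderiv ℝ (jetOf 3 g) u v.1.1 + ((0, (jetOf 3 h u).2) : JetCoord 3) := by
    have h1 : jetOf 3 h u = b := jetOf_polyMetric b
    rw [h1]
    refine Prod.ext ?_ ?_
    · rw [Prod.fst_add, hfst hjg, add_zero]
    · simp [hb]
  -- a curve with velocity `v`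
  have hγ : HasDerivAt (fun t : ℝ => u + t • v.1.1) v.1.1 0 := by
    simpa using ((hasDerivAt_id (0 : ℝ)).smul_const v.1.1).const_add u
  set c : ℝ → TotalCoord := fun t => (jetOf 3 (fun x => g x + t • h x) (u + t • v.1.1),
    w.2.1 + t • v.2.1, w.2.2 + t • v.2.2) with hc
  have hc0 : c 0 = w := by
    have h1 : jetOf 3 g u = w.1 := jetOf_polyMetric w.1
    simp only [hc, zero_smul, add_zero]
    rw [h1]
  have hcd : HasDerivAt c v 0 := by
    have h1 := hasDerivAt_jetOf_curve (k := 3) isOpen_univ hg.contDiffOn hh.contDiffOn hγ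
      (mem_univ _)
    simp only [zero_smul, add_zero] at h1
    rw [← hv] at h1
    refine h1.prodMk (HasDerivAt.prodMk ?_ ?_)
    · simpa using ((hasDerivAt_id (0 : ℝ)).smul_const v.2.1).const_add w.2.1
    · simpa using ((hasDerivAt_id (0 : ℝ)).smul_const v.2.2).const_add w.2.2
  -- its image
  have hSo := isOpen_coordTarget_inter e e'.open_source
  have hfd : DifferentiableAt ℝ f w :=
    ((coord_change_contDiffOn he he' hf).contDiffAt (hSo.mem_nhds ⟨hw, hw'⟩)).diff
  have hfc : HasDerivAt (fun t => f (c t)) (fderiv ℝ f w v) 0 :=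
    HasFDerivAt.comp_hasDerivAt (0 : ℝ) (by rw [hc0]; exact hfd.hasFDerivAt) hcd
  have hev : (fun t => f (c t)) =ᶠ[𝓝 0] fun t =>
      (jetOf 3 (fun x => push e e' g x + t • push e e' h x) ((e' ∘ e.symm) (u + t • v.1.1)),
        w.2.1 + t • v.2.1, fun μ => ∑ a, (w.2.2 + t • v.2.2) a *
          jacMatrix (e ∘ e'.symm) ((e' ∘ e.symm) (u + t • v.1.1)) a μ) := by
    filter_upwards [hcd.continuousAt.preimage_mem_nhds
      (hSo.mem_nhds (by rw [hc0]; exact ⟨hw, hw'⟩))] with t ht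
    have hsym : ∀ x μ ν, g x μ ν + t • h x μ ν = g x ν μ + t • h x ν μ := fun x μ ν => by
      rw [hs x μ ν, hhs x μ ν]
    have hL : IsLorentzian (matForm (g (u + t • v.1.1) + t • h (u + t • v.1.1))) := by
      have := ht.1.2
      rwa [show yCoord (c t).1 = _ from
        yCoord_jetOf (g := fun x => g x + t • h x) (fun μ ν => hsym _ μ ν)] at this
    rw [hf _ ht.1]
    have h1 := coord_ofCoord_jetOf he he' (g := fun x => g x + t • h x) (hg.add (hh.const_smul t))
      hsym (u := u + t • v.1.1) ⟨ht.1.1, ht.2⟩ hL _ _ ht.1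
    rw [push_add_smul] at h1
    exact h1
  have hfc' := hfc.congr_of_eventuallyEq hev.symm
  have hψ : HasDerivAt (fun t : ℝ => (e' ∘ e.symm) (u + t • v.1.1))
      (fderiv ℝ (e' ∘ e.symm) u v.1.1) 0 :=
    HasFDerivAt.comp_hasDerivAt (0 : ℝ) (by
      simpa using ((trans_contDiffOn he he').contDiffAt
        ((isOpen_overlap e e').mem_nhds hO)).diff.hasFDerivAt) hγ
  have hu' := overlap_image hO
  have h1 := hasDerivAt_jetOf_curve (k := 3) (isOpen_overlap e' e) (push_contDiffOn he he' hg)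
    (push_contDiffOn he he' hh) hψ (by simpa using hu')
  simp only [zero_smul, add_zero] at h1
  have hfc1 : HasDerivAt (fun t => (f (c t)).1) (fderiv ℝ f w v).1 0 :=
    (ContinuousLinearMap.fst ℝ (JetCoord 3) (ℝ × (Fin 4 → ℝ))).hasFDerivAt.comp_hasDerivAt
      (0 : ℝ) hfc
  have hfc2 : HasDerivAt (fun t => (f (c t)).2.1) (fderiv ℝ f w v).2.1 0 :=
    ((ContinuousLinearMap.fst ℝ ℝ (Fin 4 → ℝ)) ∘L
      (ContinuousLinearMap.snd ℝ (JetCoord 3) (ℝ × (Fin 4 → ℝ)))).hasFDerivAt.comp_hasDerivAt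
      (0 : ℝ) hfc
  have h2 := hfc1.unique (h1.congr_of_eventuallyEq (hev.mono fun t ht => congrArg Prod.fst ht))
  have h3 : (fderiv ℝ f w v).1.1 = fderiv ℝ (e' ∘ e.symm) u v.1.1 := by
    rw [h2, Prod.fst_add, hfst ((contDiffOn_jetOf (isOpen_overlap e' e)
      (push_contDiffOn he he' hg)).contDiffAt ((isOpen_overlap e' e).mem_nhds hu')).diff, add_zero]
  refine ⟨h, hh, hhs, hv, ?_, h3, ?_⟩
  · rw [h3]
    exact h2
  · have h4 : HasDerivAt (fun t : ℝ => w.2.1 + t • v.2.1) v.2.1 0 := by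
      simpa using ((hasDerivAt_id (0 : ℝ)).smul_const v.2.1).const_add w.2.1
    exact hfc2.unique (h4.congr_of_eventuallyEq
      (hev.mono fun t ht => congrArg (fun x : TotalCoord => x.2.1) ht))

end Change

/-! ### Momenta -/

/-- The total derivative `d/dx^β` as a vector at a second order jet: the velocity in the direction
`∂_β` of a prolonged section with third order jet `w`. -/
def totalDeriv (w : JetCoord 3) (β : Fin 4) : JetCoord 2 :=
  (bvec β, fun i => symArr i fun l => (w.2 i.succ).1 (Fin.cons β l))

theorem fderiv_jetOf {g : E4 → Fin 4 → Fin 4 → ℝ} {s : Set E4} (ho : IsOpen s)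
    (hg : ContDiffOn ℝ ∞ g s) (hs : ∀ x ∈ s, ∀ μ ν, g x μ ν = g x ν μ) {u : E4} (hu : u ∈ s)
    (β : Fin 4) : fderiv ℝ (jetOf 2 g) u (bvec β) = totalDeriv (jetOf 3 g u) β := by
  have hn := ho.mem_nhds hu
  have h1 : HasFDerivAt (jetOf 2 g) ((ContinuousLinearMap.id ℝ E4).prod
      (ContinuousLinearMap.pi fun i : Fin 3 => LinearMap.toContinuousLinearMap (symArr i) ∘L
        ContinuousLinearMap.pi fun l : Fin i → Fin 4 =>
          ContinuousMultilinearMap.apply ℝ (fun _ : Fin i => E4) (Fin 4 → Fin 4 → ℝ)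
            (fun j => bvec (l j)) ∘L fderiv ℝ (iteratedFDeriv ℝ i g) u)) u := by
    refine (hasFDerivAt_id u).prodMk (hasFDerivAt_pi.2 fun i => ?_)
    refine (LinearMap.toContinuousLinearMap (symArr i)).hasFDerivAt.comp u
      (hasFDerivAt_pi.2 fun l => ?_)
    exact (ContinuousMultilinearMap.apply ℝ (fun _ : Fin i => E4) (Fin 4 → Fin 4 → ℝ)
      (fun j => bvec (l j))).hasFDerivAt.comp u
        ((hg.contDiffAt hn).iteratedFDeriv_right (m := ∞)
          (by exact_mod_cast le_rfl)).diff.hasFDerivAt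
  rw [h1.fderiv]
  refine Prod.ext rfl (funext fun i => ?_)
  refine congrArg (symArr i) (funext fun l => ?_)
  rw [jetOf_apply ho hg hs hu i.succ]
  rfl

/-- The momentum `p^{μνα}` as a function of the third order jet: the derivative along a section is
replaced by the total derivative. -/
def momentumOne (F : JetCoord 2 → ℝ) (μ ν α : Fin 4) (w : JetCoord 3) : ℝ :=
  partialZ F 1 one_le_two ![α] μ ν (trunc w) -
    ∑ β, fderiv ℝ (partialZ F 2 le_rfl ![α, β] μ ν) (trunc w) (totalDeriv w β)

/-- The momentum `q^μ` of the scalar field. -/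
def matterMomentum (μ : Fin 4) (w : TotalCoord) : ℝ :=
  (∑ ν, invMetric (yCoord w.1) μ ν * w.2.2 ν) * volDensity (yCoord w.1)

theorem momentumOne_jetOf {F : JetCoord 2 → ℝ} {g : E4 → Fin 4 → Fin 4 → ℝ} {s : Set E4}
    (ho : IsOpen s) (hg : ContDiffOn ℝ ∞ g s) (hs : ∀ x ∈ s, ∀ μ ν, g x μ ν = g x ν μ) {u : E4}
    (hu : u ∈ s) (hF : ContDiffAt ℝ ∞ F (jetOf 2 g u)) (μ ν α : Fin 4) :
    momentumOne F μ ν α (jetOf 3 g u) = partialZ F 1 one_le_two ![α] μ ν (jetOf 2 g u) -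
      ∑ β, pd (fun x => partialZ F 2 le_rfl ![α, β] μ ν (jetOf 2 g x)) β u := by
  have h1 : ∀ β, pd (fun x => partialZ F 2 le_rfl ![α, β] μ ν (jetOf 2 g x)) β u =
      fderiv ℝ (partialZ F 2 le_rfl ![α, β] μ ν) (jetOf 2 g u) (totalDeriv (jetOf 3 g u) β) := by
    intro β
    rw [← fderiv_jetOf ho hg hs hu]
    exact congrArg (fun T : E4 →L[ℝ] ℝ => T (bvec β)) (fderiv_comp u
      (contDiffAt_partialZ hF 2 le_rfl ![α, β] μ ν).diff
      ((contDiffOn_jetOf ho hg).contDiffAt (ho.mem_nhds hu)).diff)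
  simp only [h1]
  rfl

/-- The `1`-forms `j^β` of the coordinate expression `ℓ d₄x + j^β ∧ (∂_β ⌟ d₄x)` of the De Donder
form: the coefficients of `∂_β ⌟ d₄x` collected from its contact terms. -/
def deDonderCurrent (F : JetCoord 2 → ℝ) (w : TotalCoord) (β : Fin 4) : TotalCoord →L[ℝ] ℝ :=
  (∑ μ, ∑ ν, ∑ α, partialZ F 2 le_rfl ![α, β] μ ν (trunc w.1) • contactZ w μ ν α) +
    (∑ μ, ∑ ν, momentumOne F μ ν β w.1 • contactY w μ ν) + matterMomentum β w • contactT w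

/-- The coordinate expression of the De Donder form as a function on the coordinate space, with the
momenta expressed by the derivatives of the Lagrangian `F`. -/
def deDonderExpr (F : JetCoord 2 → ℝ) (V : ℝ → ℝ) (w : TotalCoord) : TotalCoord [⋀^Fin 4]→L[ℝ] ℝ :=
  lepageForm (F (trunc w.1) + matterLagrangian V w) (deDonderCurrent F w)

theorem sum_comm_three {V : Type*} [AddCommMonoid V] (f : Fin 4 → Fin 4 → Fin 4 → V) :
    ∑ μ, ∑ ν, ∑ α, f μ ν α = ∑ α, ∑ μ, ∑ ν, f μ ν α := by
  rw [Finset.sum_congr rfl fun μ _ => Finset.sum_comm, Finset.sum_comm]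

theorem sum_comm_four {V : Type*} [AddCommMonoid V] (f : Fin 4 → Fin 4 → Fin 4 → Fin 4 → V) :
    ∑ μ, ∑ ν, ∑ α, ∑ β, f μ ν α β = ∑ β, ∑ μ, ∑ ν, ∑ α, f μ ν α β := by
  rw [Finset.sum_congr rfl fun μ _ => sum_comm_three (f μ), Finset.sum_comm]

section Momenta

variable {M : Type*} [TopologicalSpace M] [ChartedSpace E4 M]
  {L : OpenPartialHomeomorph M E4 → JetCoord 2 → ℝ}

theorem isOpen_chart_dom (e : OpenPartialHomeomorph M E4) (σ : LocalMetric M) :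
    IsOpen (e.target ∩ e.symm ⁻¹' (σ.dom : Set M)) :=
  e.isOpen_inter_preimage_symm σ.dom.isOpen

/-- The momenta, given by their coordinate expressions. -/
def coordMomenta (L : OpenPartialHomeomorph M E4 → JetCoord 2 → ℝ)
    (e : OpenPartialHomeomorph M E4) : Momenta M where
  p2 μ ν α β j := partialZ (L e) 2 le_rfl ![α, β] μ ν (trunc (j.coord e))
  p1 μ ν α j := momentumOne (L e) μ ν α (j.coord e)
  q μ P := matterMomentum μ (P.coord e)

theorem isMomenta_coordMomenta (hL : IsInvariantLagrangian L) {e : OpenPartialHomeomorph M E4}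
    (he : e ∈ posAtlas M) : IsMomenta L e (coordMomenta L e) where
  p2_eq σ x hx hxe μ ν α β := by
    simp only [coordMomenta]
    rw [MetricJet.coord_jet σ 3 hx he hxe]
    rfl
  p1_eq σ x hx hxe μ ν α := by
    have hu := mem_dom_coord hxe (s := (σ.dom : Set M)) hx
    simp only [coordMomenta]
    rw [MetricJet.coord_jet σ 3 hx he hxe]
    exact momentumOne_jetOf (isOpen_chart_dom e σ) (σ.smooth e he)
      (fun x hx μ ν => comps_symm σ hx.2 μ ν) hu
      (hL.contDiffAt_jetOf he (fun μ ν => comps_symm σ hu.2 μ ν) hu.1 (isLorentzian_comps σ he hu))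
      μ ν α
  q_eq σ φ x hσ hφ hxe μ := by
    simp only [coordMomenta, matterMomentum, TotalJet.coord]
    rw [MetricJet.coord_jet σ 3 hσ he hxe, ScalarJet.coord_jet φ hφ he hxe,
      yCoord_jetCoord σ he (mem_dom_coord hxe hσ)]
    rfl

/-- The momenta are determined over the coordinate domain, since every point of the fibre product
is a pair of jets of local sections. -/
theorem IsMomenta.eq_coordMomenta (hL : IsInvariantLagrangian L) {e : OpenPartialHomeomorph M E4}
    (he : e ∈ posAtlas M) {𝔭 : Momenta M} (h : IsMomenta L e 𝔭) {P : TotalJet M}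
    (hP : P.base ∈ e.source) :
    (∀ μ ν α β, 𝔭.p2 μ ν α β P.grav = partialZ (L e) 2 le_rfl ![α, β] μ ν (trunc (P.coord e).1)) ∧
      (∀ μ ν α, 𝔭.p1 μ ν α P.grav = momentumOne (L e) μ ν α (P.coord e).1) ∧
      ∀ μ, 𝔭.q μ P = matterMomentum μ (P.coord e) := by
  obtain ⟨σ, φ, x, hσ, hφ, rfl⟩ := P.exists_rep
  have h0 := isMomenta_coordMomenta hL he
  exact ⟨fun μ ν α β => (h.p2_eq σ x hσ hP μ ν α β).trans (h0.p2_eq σ x hσ hP μ ν α β).symm,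
    fun μ ν α => (h.p1_eq σ x hσ hP μ ν α).trans (h0.p1_eq σ x hσ hP μ ν α).symm,
    fun μ => (h.q_eq σ φ x hσ hφ hP μ).trans (h0.q_eq σ φ x hσ hφ hP μ).symm⟩

theorem deDonderCoord_eq (hL : IsInvariantLagrangian L) (V : ℝ → ℝ)
    {e : OpenPartialHomeomorph M E4} (he : e ∈ posAtlas M) {𝔭 : Momenta M} (h : IsMomenta L e 𝔭)
    {P : TotalJet M} (hP : P.base ∈ e.source) :
    deDonderCoord L V e 𝔭 P = deDonderExpr (L e) V (P.coord e) := by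
  obtain ⟨h2, h1, hq⟩ := h.eq_coordMomenta hL he hP
  unfold deDonderCoord deDonderExpr lepageForm deDonderCurrent
  simp only [h2, h1, hq, ← wedgeBilin_apply, map_add, map_sum, map_smul, LinearMap.add_apply,
    LinearMap.sum_apply, LinearMap.smul_apply, Finset.sum_add_distrib, add_smul]
  rw [sum_comm_four fun μ ν α β => partialZ (L e) 2 le_rfl ![α, β] μ ν (trunc (P.coord e).1) •
      wedgeBilin 3 (contactZ (P.coord e) μ ν α) (d3x β),
    sum_comm_three fun μ ν α => momentumOne (L e) μ ν α (P.coord e).1 •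
      wedgeBilin 3 (contactY (P.coord e) μ ν) (d3x α)]
  abel

/-- On a vector given by a variation `h`, the gravitational part of `j^β` is the boundary current
of `h`. -/
theorem deDonderCurrent_apply {F : JetCoord 2 → ℝ} {g h : E4 → Fin 4 → Fin 4 → ℝ} {s : Set E4}
    (ho : IsOpen s) (hg : ContDiffOn ℝ ∞ g s) (hs : ∀ x ∈ s, ∀ μ ν, g x μ ν = g x ν μ)
    (hh : ContDiffOn ℝ ∞ h s) (hhs : ∀ x ∈ s, ∀ μ ν, h x μ ν = h x ν μ) {u : E4} (hu : u ∈ s)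
    (hF : ContDiffAt ℝ ∞ F (jetOf 2 g u)) {w v : TotalCoord} (hw : w.1 = jetOf 3 g u)
    (hv : v.1 = fderiv ℝ (jetOf 3 g) u v.1.1 + ((0, (jetOf 3 h u).2) : JetCoord 3)) (β : Fin 4) :
    deDonderCurrent F w β v = current F g h β u + matterMomentum β w * contactT w v := by
  have hc := contact_eq ho hg hs hh hhs hu hw hv
  have ht : trunc w.1 = jetOf 2 g u := by rw [hw]; rfl
  simp only [deDonderCurrent, add_apply, sum_apply, smul_apply, smul_eq_mul, current,
    (hc _ _).1, (hc _ _).2, ht]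
  rw [hw]
  simp only [momentumOne_jetOf ho hg hs hu hF, Finset.sum_add_distrib]

end Momenta

/-! ### Transformation of the scalar field terms -/

theorem matrix_pull (J : Matrix (Fin 4) (Fin 4) ℝ) (y : Fin 4 → Fin 4 → ℝ) :
    (Matrix.of (pull (fun a μ => J a μ) y) : Matrix (Fin 4) (Fin 4) ℝ) =
      J.transpose * Matrix.of y * J := by
  ext μ ν
  simp only [Matrix.of_apply, pull, Matrix.mul_apply, Matrix.transpose_apply, Finset.sum_mul]
  rw [Finset.sum_comm]
  exact Finset.sum_congr rfl fun b _ => Finset.sum_congr rfl fun a _ => by ring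

/-- `√(-det g)` is a scalar density; here `D` is the inverse of the Jacobian matrix `J`. -/
theorem volDensity_pull {J D : Matrix (Fin 4) (Fin 4) ℝ} (h : J * D = 1) (hD : 0 < D.det)
    (y : Fin 4 → Fin 4 → ℝ) :
    volDensity (pull (fun a μ => J a μ) y) * D.det = volDensity y := by
  have h1 : J.det * D.det = 1 := by rw [← Matrix.det_mul, h, Matrix.det_one]
  have hJ : 0 < J.det := pos_of_mul_pos_left (by rw [h1]; exact one_pos) hD.le
  unfold volDensity
  rw [matrix_pull, Matrix.det_mul, Matrix.det_mul, Matrix.det_transpose]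
  have h2 : -(J.det * (Matrix.of y).det * J.det) = J.det ^ 2 * -(Matrix.of y).det := by ring
  rw [h2, Real.sqrt_mul (sq_nonneg _), Real.sqrt_sq hJ.le]
  linear_combination Real.sqrt (-(Matrix.of y).det) * h1

theorem inv_matrix_pull {J D : Matrix (Fin 4) (Fin 4) ℝ} (h : J * D = 1)
    (y : Fin 4 → Fin 4 → ℝ) :
    (Matrix.of (pull (fun a μ => J a μ) y) : Matrix (Fin 4) (Fin 4) ℝ)⁻¹ =
      D * (Matrix.of y)⁻¹ * D.transpose := by
  have h2 : J⁻¹ = D := Matrix.inv_eq_right_inv h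
  rw [matrix_pull, Matrix.mul_inv_rev, Matrix.mul_inv_rev, ← Matrix.transpose_nonsing_inv, h2,
    mul_assoc]

/-- Raising the index of a covector commutes with changes of coordinates. -/
theorem inv_pull_mulVec {J D : Matrix (Fin 4) (Fin 4) ℝ} (h : J * D = 1)
    (y : Fin 4 → Fin 4 → ℝ) (z : Fin 4 → ℝ) :
    ((Matrix.of (pull (fun a μ => J a μ) y) : Matrix (Fin 4) (Fin 4) ℝ)⁻¹).mulVec
      (J.transpose.mulVec z) = D.mulVec ((Matrix.of y)⁻¹.mulVec z) := by
  rw [inv_matrix_pull h, Matrix.mulVec_mulVec, Matrix.mulVec_mulVec, mul_assoc,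
    ← Matrix.transpose_mul, h, Matrix.transpose_one, mul_one]

theorem matterMomentum_eq (μ : Fin 4) (w : TotalCoord) : matterMomentum μ w =
    (Matrix.of (yCoord w.1))⁻¹.mulVec w.2.2 μ * volDensity (yCoord w.1) := rfl

theorem matterLagrangian_eq (V : ℝ → ℝ) (w : TotalCoord) : matterLagrangian V w =
    ((1 / 2 : ℝ) * (w.2.2 ⬝ᵥ (Matrix.of (yCoord w.1))⁻¹.mulVec w.2.2) + V w.2.1) *
      volDensity (yCoord w.1) := by
  unfold matterLagrangian
  congr 3
  simp only [dotProduct, Matrix.mulVec, Finset.mul_sum]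
  exact Finset.sum_congr rfl fun μ _ => Finset.sum_congr rfl fun ν _ => by
    rw [mul_right_comm, mul_comm]
    rfl

section MatterChange

variable {J D : Matrix (Fin 4) (Fin 4) ℝ} {w w' : TotalCoord}

theorem matterMomentum_change (h : J * D = 1) (hD : 0 < D.det)
    (hy : yCoord w'.1 = pull (fun a μ => J a μ) (yCoord w.1))
    (hz : w'.2.2 = J.transpose.mulVec w.2.2) (c : Fin 4) :
    matterMomentum c w = D.det * ∑ β, J c β * matterMomentum β w' := by
  simp only [matterMomentum_eq]
  rw [hy, hz, inv_pull_mulVec h, ← volDensity_pull h hD]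
  have h1 : J.mulVec (D.mulVec ((Matrix.of (yCoord w.1))⁻¹.mulVec w.2.2)) =
      (Matrix.of (yCoord w.1))⁻¹.mulVec w.2.2 := by
    rw [Matrix.mulVec_mulVec, h, Matrix.one_mulVec]
  conv_lhs => rw [← h1]
  generalize D.mulVec ((Matrix.of (yCoord w.1))⁻¹.mulVec w.2.2) = q
  simp only [Matrix.mulVec, dotProduct, Finset.sum_mul, Finset.mul_sum]
  exact Finset.sum_congr rfl fun β _ => by ring

theorem matterLagrangian_change (V : ℝ → ℝ) (h : J * D = 1) (hD : 0 < D.det)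
    (hy : yCoord w'.1 = pull (fun a μ => J a μ) (yCoord w.1)) (ht : w'.2.1 = w.2.1)
    (hz : w'.2.2 = J.transpose.mulVec w.2.2) :
    matterLagrangian V w = matterLagrangian V w' * D.det := by
  rw [matterLagrangian_eq, matterLagrangian_eq, hy, hz, ht, inv_pull_mulVec h,
    ← volDensity_pull h hD]
  have h1 : ∀ q, J.transpose.mulVec w.2.2 ⬝ᵥ D.mulVec q = w.2.2 ⬝ᵥ q := fun q => by
    rw [Matrix.dotProduct_mulVec, Matrix.mulVec_transpose, Matrix.vecMul_vecMul, h,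
      Matrix.vecMul_one]
  rw [h1, mul_assoc]

end MatterChange

/-! ### Coordinate independence of the De Donder form -/

section Invariance

variable {M : Type*} [TopologicalSpace M] [ChartedSpace E4 M]
  {L : OpenPartialHomeomorph M E4 → JetCoord 2 → ℝ}

theorem det_jacMatrix_pos {e e' : OpenPartialHomeomorph M E4} (he : e ∈ posAtlas M)
    (he' : e' ∈ posAtlas M) {u : E4} (hu : u ∈ e.target ∩ e.symm ⁻¹' e'.source) :
    0 < (jacMatrix (e' ∘ e.symm) u).det := by
  rw [← det_fderiv]
  exact (show orientedPregroupoid.property _ _ ∧ orientedPregroupoid.property _ _ from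
    StructureGroupoid.compatible_of_mem_maximalAtlas he he').1.2 u hu

/-- The coordinate expressions of the De Donder form agree under changes of coordinates. The jet
`w` is represented by a polynomial metric `g`, and each tangent vector at `w` by a variation of
`g`, on which the gravitational part of `j^β` is the boundary current. -/
theorem deDonderExpr_change [HasGroupoid M orientedGroupoid] (hL : IsInvariantLagrangian L)
    (V : ℝ → ℝ)
    {e e' : OpenPartialHomeomorph M E4} (he : e ∈ posAtlas M) (he' : e' ∈ posAtlas M)
    {f : TotalCoord → TotalCoord}
    (hf : ∀ w (hw : w ∈ coordTarget e), f w = (TotalJet.ofCoord he w hw).coord e')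
    {w : TotalCoord} (hw : w ∈ coordTarget e) (hw' : e.symm w.1.1 ∈ e'.source) :
    (deDonderExpr (L e') V (f w)).compContinuousLinearMap (fderiv ℝ f w) =
      deDonderExpr (L e) V w := by
  set u := w.1.1 with hu
  set g := polyMetric w.1 with hgd
  have hg : ContDiff ℝ ∞ g := contDiffOn_univ.1 (polyMetric_contDiffOn _ _)
  have hs : ∀ u μ ν, g u μ ν = g u ν μ := polyMetric_symm w.1
  have hO : u ∈ e.target ∩ e.symm ⁻¹' e'.source := ⟨hw.1, hw'⟩
  have hO' := overlap_image hO
  have ho := isOpen_overlap e' e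
  have hps : ∀ {h : E4 → Fin 4 → Fin 4 → ℝ}, (∀ u μ ν, h u μ ν = h u ν μ) →
      ∀ x ∈ e'.target ∩ e'.symm ⁻¹' e.source, ∀ μ ν, push e e' h x μ ν = push e e' h x ν μ :=
    fun hh x _ μ ν => pull_symm _ _ (hh _) μ ν
  have hwj : w.1 = jetOf 3 g u := (jetOf_polyMetric w.1).symm
  have hl : IsLorentzian (matForm (g u)) := by
    rw [hgd, hu, polyMetric_self]
    exact hw.2
  have hfw : f w = (jetOf 3 (push e e' g) ((e' ∘ e.symm) u), w.2.1,
      fun μ => ∑ a, w.2.2 a * jacMatrix (e ∘ e'.symm) ((e' ∘ e.symm) u) a μ) := by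
    have hw1 : w = ((jetOf 3 g u, w.2.1, w.2.2) : TotalCoord) := by rw [← hwj]
    have hw2 : ((jetOf 3 g u, w.2.1, w.2.2) : TotalCoord) ∈ coordTarget e := hw1 ▸ hw
    exact (congrArg f hw1).trans
      ((hf _ hw2).trans (coord_ofCoord_jetOf he he' hg hs hO hl w.2.1 w.2.2 hw2))
  have hKD := jacMatrix_mul he he' hO
  have hDK := mul_eq_one_comm.1 hKD
  have hD := det_jacMatrix_pos he he' hO
  set K := jacMatrix (e ∘ e'.symm) ((e' ∘ e.symm) u) with hK
  set D := jacMatrix (e' ∘ e.symm) u with hDd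
  have hy : yCoord (f w).1 = pull (fun a μ => K a μ) (yCoord w.1) := by
    have h1 : yCoord (f w).1 = push e e' g ((e' ∘ e.symm) u) := by
      rw [hfw]
      exact yCoord_jetOf (fun μ ν => hps hs _ hO' μ ν)
    rw [h1, ← polyMetric_self]
    unfold push
    rw [overlap_inv hO]
    rfl
  have hz : (f w).2.2 = K.transpose.mulVec w.2.2 := by
    rw [hfw]
    funext μ
    simp only [Matrix.mulVec, dotProduct, Matrix.transpose_apply, mul_comm]
  have ht : (f w).2.1 = w.2.1 := by rw [hfw]
  have hF := hL.contDiffAt_jetOf he (hs u) hO.1 hl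
  have hF' := hL.contDiffAt_jetOf he' (hps hs _ hO') hO'.1 (isLorentzian_push he he' hg hs hO hl)
  have hx : ∀ v, (fderiv ℝ f w v).1.1 = fderiv ℝ (e' ∘ e.symm) u v.1.1 := fun v => by
    obtain ⟨h, -, -, -, -, h3, -⟩ := fderiv_coord_change he he' hf hw hw' v
    exact h3
  -- the coefficients transform as densities
  refine lepageForm_comp (A := fderiv ℝ (e' ∘ e.symm) u) (B := K) hx ?_ ?_ ?_
  · intro β
    rw [map_sum]
    have h1 : ∀ c, fderiv ℝ (e' ∘ e.symm) u (bvec c) = ∑ ν, D ν c • bvec ν := fun c =>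
      eq_sum_bvec _
    simp only [map_smul, h1, Finset.smul_sum, smul_smul]
    rw [Finset.sum_comm]
    simp only [← Finset.sum_smul]
    have h2 : ∀ ν, ∑ c, K c β * D ν c = (D * K) ν β := fun ν => by
      simp only [Matrix.mul_apply, mul_comm]
    simp only [h2, hDK, Matrix.one_apply, ite_smul, one_smul, zero_smul, Finset.sum_ite_eq',
      Finset.mem_univ, if_true]
  · rw [det_fderiv, ← hDd, add_mul, ← matterLagrangian_change V hKD hD hy ht hz]
    congr 1
    have h1 := hL.apply_push he he' hg hs hO hl
    rw [det_fderiv] at h1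
    have h2 : trunc w.1 = jetOf 2 g u := by rw [hwj]; rfl
    have h3 : trunc (f w).1 = jetOf 2 (push e e' g) ((e' ∘ e.symm) u) := by rw [hfw]; rfl
    rw [h2, h3, ← h1]
  · intro c v
    obtain ⟨h, hh, hhs, hv, hv', -, hvt⟩ := fderiv_coord_change he he' hf hw hw' v
    rw [deDonderCurrent_apply isOpen_univ hg.contDiffOn (fun x _ => hs x) hh.contDiffOn
      (fun x _ => hhs x) (mem_univ u) hF hwj hv]
    have hfw1 : (f w).1 = jetOf 3 (push e e' g) ((e' ∘ e.symm) u) := by rw [hfw]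
    have h1 : ∀ β, deDonderCurrent (L e') (f w) β (fderiv ℝ f w v) = _ :=
      deDonderCurrent_apply ho (push_contDiffOn he he' hg) (hps hs) (push_contDiffOn he he' hh)
        (hps hhs) hO' hF' hfw1 hv'
    have hT : contactT (f w) (fderiv ℝ f w v) = contactT w v := by
      have e1 : ∀ w v, contactT w v = v.2.1 - ∑ ν, w.2.2 ν * v.1.1 ν := fun w v => by
        simp only [contactT, sub_apply, sum_apply, smul_apply, smul_eq_mul]
        rfl
      rw [e1, e1, hvt]
      congr 1
      have e2 : ∀ ν, (fderiv ℝ f w v).1.1 ν = D.mulVec v.1.1 ν := fun ν => by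
        rw [hx, clm_apply_eq_sum]
        simp only [Matrix.mulVec, dotProduct, WithLp.ofLp_sum, WithLp.ofLp_smul, Finset.sum_apply,
          Pi.smul_apply, smul_eq_mul]
        exact Finset.sum_congr rfl fun a _ => mul_comm _ _
      have e3 : (f w).2.2 ⬝ᵥ D.mulVec v.1.1 = w.2.2 ⬝ᵥ v.1.1 := by
        rw [hz, Matrix.dotProduct_mulVec, Matrix.mulVec_transpose, Matrix.vecMul_vecMul, hKD,
          Matrix.vecMul_one]
      simp only [e2]
      exact e3
    simp only [h1, hT]
    rw [current_push hL he he' hg hs hh hhs hO hl, matterMomentum_change hKD hD hy hz, det_fderiv,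
      ← hK, ← hDd]
    simp only [mul_add, Finset.sum_add_distrib, mul_assoc, Finset.sum_mul]

end Invariance

/-! ### Smoothness of the coordinate expression -/

theorem matForm_eq_dotProduct (y : Fin 4 → Fin 4 → ℝ) (v w : E4) :
    matForm y v w = v.ofLp ⬝ᵥ (Matrix.of y).mulVec w.ofLp := by
  simp only [matForm, dotProduct, Matrix.mulVec, Finset.mul_sum, Matrix.of_apply]
  exact Finset.sum_congr rfl fun μ _ => Finset.sum_congr rfl fun ν _ => by ring

/-- Lorentzian metrics are nondegenerate: a vector in the kernel would span, together with a
positive definite hyperplane, the whole space, on which the metric would then be nonnegative. -/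
theorem IsLorentzian.det_ne_zero {y : Fin 4 → Fin 4 → ℝ} (h : IsLorentzian (matForm y)) :
    (Matrix.of y).det ≠ 0 := by
  intro hdet
  obtain ⟨n, hn0, hn⟩ := Matrix.exists_mulVec_eq_zero_iff.2 hdet
  obtain ⟨hsymm, ⟨t, ht⟩, S, hS, hpos⟩ := h
  have hker : ∀ v : E4, matForm y v (WithLp.toLp 2 n) = 0 := fun v => by
    rw [matForm_eq_dotProduct, hn, dotProduct_zero]
  have hnS : WithLp.toLp 2 n ∉ S := fun hm =>
    (hpos _ hm fun h0 => hn0 (congrArg WithLp.ofLp h0)).ne' (hker _)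
  have htop : S ⊔ Submodule.span ℝ {WithLp.toLp 2 n} = ⊤ := by
    refine Submodule.eq_top_of_finrank_eq (le_antisymm (Submodule.finrank_le _) ?_)
    have hlt : S < S ⊔ Submodule.span ℝ {WithLp.toLp 2 n} :=
      lt_of_le_of_ne le_sup_left fun heq =>
        hnS (heq ▸ Submodule.mem_sup_right (Submodule.mem_span_singleton_self _))
    have h1 := Submodule.finrank_lt_finrank_of_lt hlt
    rw [hS] at h1
    rw [finrank_euclideanSpace_fin]
    exact h1
  obtain ⟨s, hs, n', hn', rfl⟩ := Submodule.mem_sup.1 (htop ▸ Submodule.mem_top (x := t))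
  obtain ⟨c, rfl⟩ := Submodule.mem_span_singleton.1 hn'
  have h1 : matForm y (s + c • WithLp.toLp 2 n) (s + c • WithLp.toLp 2 n) = matForm y s s := by
    have h2 := (hsymm (WithLp.toLp 2 n) s).trans (hker s)
    rw [matForm_eq_dotProduct] at h2 ⊢
    rw [matForm_eq_dotProduct]
    simp only [WithLp.ofLp_add, WithLp.ofLp_smul, Matrix.mulVec_add, Matrix.mulVec_smul, hn,
      smul_zero, add_zero, add_dotProduct, smul_dotProduct, h2]
  rw [h1] at ht
  have h0 : s ≠ 0 := by
    rintro rfl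
    simp [matForm] at ht
  exact ht.not_gt (hpos s hs h0)

theorem contDiff_yCoord : ContDiff ℝ ∞ fun w : TotalCoord => yCoord w.1 :=
  contDiff_pi.2 fun μ => contDiff_pi.2 fun ν =>
    (zCoord 0 (Nat.zero_le 3) ![] μ ν).contDiff.comp contDiff_fst

theorem contDiff_det {n : Type*} [Fintype n] [DecidableEq n] :
    ContDiff ℝ ∞ fun A : n → n → ℝ => (Matrix.of A).det := by
  simp only [Matrix.det_apply', Matrix.of_apply]
  exact ContDiff.sum fun σ _ => contDiff_const.mul (contDiff_prod fun i _ =>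
    contDiff_apply_apply ℝ ℝ (σ i) i)

theorem contDiffAt_invMetric {y : Fin 4 → Fin 4 → ℝ} (h : (Matrix.of y).det ≠ 0) (μ ν : Fin 4) :
    ContDiffAt ℝ ∞ (fun y => invMetric y μ ν) y := by
  -- Cramer's rule
  have h1 : (fun y => invMetric y μ ν) = fun y : Fin 4 → Fin 4 → ℝ =>
      ((Matrix.of y).det)⁻¹ * (Matrix.of (Function.update y ν (Pi.single μ 1))).det := by
    funext y
    simp only [invMetric, Matrix.inv_def, Matrix.smul_apply, smul_eq_mul, Ring.inverse_eq_inv',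
      Matrix.adjugate_apply]
    rfl
  rw [h1]
  refine (contDiff_det.contDiffAt.inv h).mul (contDiff_det.contDiffAt.comp y ?_)
  refine ContDiff.contDiffAt (contDiff_pi.2 fun i => ?_)
  by_cases hi : i = ν
  · subst hi
    simp only [Function.update_self]
    exact contDiff_const
  · simp only [Function.update_of_ne hi]
    exact contDiff_apply ℝ (Fin 4 → ℝ) i

theorem contDiffAt_volDensity {y : Fin 4 → Fin 4 → ℝ} (h : (Matrix.of y).det ≠ 0) :
    ContDiffAt ℝ ∞ volDensity y :=
  contDiff_det.contDiffAt.neg.sqrt (neg_ne_zero.2 h)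

/-- `ContDiffAt.smul` with real scalars only: for spaces of forms on `TotalCoord`, instance search
finds `NormedSpace` but not the classes which the general statement asks for. -/
theorem ContDiffAt.real_smul {W E : Type*} [NormedAddCommGroup W] [NormedSpace ℝ W]
    [NormedAddCommGroup E] [NormedSpace ℝ E] {f : W → ℝ} {g : W → E} {w : W}
    (hf : ContDiffAt ℝ ∞ f w) (hg : ContDiffAt ℝ ∞ g w) :
    ContDiffAt ℝ ∞ (fun w => f w • g w) w :=
  hf.smul hg

theorem ContDiffAt.alternatize {W E : Type*} [NormedAddCommGroup W] [NormedSpace ℝ W]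
    [NormedAddCommGroup E] [NormedSpace ℝ E] {k : ℕ} {η : W → E →L[ℝ] ℝ} {w : W}
    (hη : ContDiffAt ℝ ∞ η w) (ξ : E [⋀^Fin k]→L[ℝ] ℝ) :
    ContDiffAt ℝ ∞
      (fun w => ContinuousAlternatingMap.alternatizeUncurryFin ((η w).smulRight ξ)) w := by
  simp only [← ContinuousAlternatingMap.alternatizeUncurryFinCLM_apply (𝕜 := ℝ)]
  exact (ContinuousAlternatingMap.alternatizeUncurryFinCLM ℝ E ℝ (n := k)).contDiff.contDiffAt.comp
    (f := fun w => (η w).smulRight ξ) w (hη.smulRight contDiffAt_const)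

theorem contDiff_trunc : ContDiff ℝ ∞ trunc :=
  contDiff_fst.prodMk (contDiff_pi.2 fun i =>
    (ContinuousLinearMap.proj (R := ℝ) (φ := fun j : Fin 4 => JetArr j) i.castSucc ∘L
      ContinuousLinearMap.snd ℝ E4 ((j : Fin 4) → JetArr j)).contDiff)

theorem contDiff_totalDeriv (β : Fin 4) : ContDiff ℝ ∞ fun w => totalDeriv w β := by
  refine contDiff_const.prodMk (contDiff_pi.2 fun i =>
    (LinearMap.toContinuousLinearMap (symArr i)).contDiff.comp (contDiff_pi.2 fun l => ?_))
  exact (ContinuousLinearMap.proj (R := ℝ)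
    (φ := fun _ : Fin (i.succ : ℕ) → Fin 4 => Fin 4 → Fin 4 → ℝ) (Fin.cons β l) ∘L
      (JetArr (i.succ : ℕ)).subtypeL ∘L
      ContinuousLinearMap.proj (R := ℝ) (φ := fun j : Fin 4 => JetArr j) i.succ ∘L
      ContinuousLinearMap.snd ℝ E4 ((j : Fin 4) → JetArr j)).contDiff

section Smooth

variable {F : JetCoord 2 → ℝ} {w : TotalCoord}

theorem contDiffAt_momentumOne {w : JetCoord 3} (hF : ContDiffAt ℝ ∞ F (trunc w))
    (μ ν α : Fin 4) : ContDiffAt ℝ ∞ (momentumOne F μ ν α) w := by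
  refine ((contDiffAt_partialZ hF _ _ _ _ _).comp w contDiff_trunc.contDiffAt).sub
    (ContDiffAt.sum fun β _ => ContDiffAt.clm_apply ?_ (contDiff_totalDeriv β).contDiffAt)
  exact ((contDiffAt_partialZ hF _ _ _ _ _).fderiv_right (m := ∞)
    (by exact_mod_cast le_rfl)).comp w contDiff_trunc.contDiffAt

theorem contDiffAt_matterMomentum (h : (Matrix.of (yCoord w.1)).det ≠ 0) (μ : Fin 4) :
    ContDiffAt ℝ ∞ (matterMomentum μ) w := by
  refine (ContDiffAt.sum fun ν _ => ContDiffAt.mul ?_ ?_).mul ?_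
  · exact (contDiffAt_invMetric h μ ν).comp w contDiff_yCoord.contDiffAt
  · exact ContDiff.contDiffAt (by fun_prop)
  · exact ContDiffAt.comp w (g := volDensity) (contDiffAt_volDensity h) contDiff_yCoord.contDiffAt

theorem contDiffAt_matterLagrangian {V : ℝ → ℝ} (hV : ContDiff ℝ ∞ V)
    (h : (Matrix.of (yCoord w.1)).det ≠ 0) : ContDiffAt ℝ ∞ (matterLagrangian V) w := by
  refine ((contDiffAt_const.mul (ContDiffAt.sum fun μ _ => ContDiffAt.sum fun ν _ =>
    (ContDiffAt.mul ?_ ?_).mul ?_)).add ?_).mul ?_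
  · exact (contDiffAt_invMetric h μ ν).comp w contDiff_yCoord.contDiffAt
  · exact ContDiff.contDiffAt (by fun_prop)
  · exact ContDiff.contDiffAt (by fun_prop)
  · exact ContDiff.contDiffAt (hV.comp (by fun_prop))
  · exact ContDiffAt.comp w (g := volDensity) (contDiffAt_volDensity h) contDiff_yCoord.contDiffAt

theorem contDiffAt_contactZ (μ ν α : Fin 4) (w : TotalCoord) :
    ContDiffAt ℝ ∞ (fun w => contactZ w μ ν α) w :=
  contDiffAt_const.sub (ContDiffAt.sum fun γ _ => ContDiffAt.real_smul
    ((zCoord 2 (by norm_num) ![α, γ] μ ν).contDiff.comp contDiff_fst).contDiffAt contDiffAt_const)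

theorem contDiffAt_contactY (μ ν : Fin 4) (w : TotalCoord) :
    ContDiffAt ℝ ∞ (fun w => contactY w μ ν) w :=
  contDiffAt_const.sub (ContDiffAt.sum fun β _ => ContDiffAt.real_smul
    ((zCoord 1 (by norm_num) ![β] μ ν).contDiff.comp contDiff_fst).contDiffAt contDiffAt_const)

theorem contDiffAt_contactT (w : TotalCoord) : ContDiffAt ℝ ∞ contactT w :=
  contDiffAt_const.sub (ContDiffAt.sum fun ν _ => ContDiffAt.real_smul
    (ContDiff.contDiffAt (by fun_prop)) contDiffAt_const)

theorem contDiffAt_deDonderCurrent (hF : ContDiffAt ℝ ∞ F (trunc w.1))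
    (h : (Matrix.of (yCoord w.1)).det ≠ 0) (β : Fin 4) :
    ContDiffAt ℝ ∞ (fun w => deDonderCurrent F w β) w := by
  have h1 : ∀ μ ν α, ContDiffAt ℝ ∞ (fun w : TotalCoord =>
      partialZ F 2 le_rfl ![α, β] μ ν (trunc w.1) • contactZ w μ ν α) w := fun μ ν α =>
    ContDiffAt.real_smul ((contDiffAt_partialZ hF 2 le_rfl ![α, β] μ ν).comp
      (f := fun w : TotalCoord => trunc w.1) w (contDiff_trunc.comp contDiff_fst).contDiffAt)
      (contDiffAt_contactZ μ ν α w)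
  have h2 : ∀ μ ν, ContDiffAt ℝ ∞ (fun w : TotalCoord =>
      momentumOne F μ ν β w.1 • contactY w μ ν) w := fun μ ν =>
    ContDiffAt.real_smul ((contDiffAt_momentumOne hF μ ν β).comp w contDiffAt_fst)
      (contDiffAt_contactY μ ν w)
  exact ((ContDiffAt.sum fun μ _ => ContDiffAt.sum fun ν _ => ContDiffAt.sum fun α _ =>
    h1 μ ν α).add (ContDiffAt.sum fun μ _ => ContDiffAt.sum fun ν _ => h2 μ ν)).add
    (ContDiffAt.real_smul (contDiffAt_matterMomentum h β) (contDiffAt_contactT w))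

theorem contDiffAt_deDonderExpr {V : ℝ → ℝ} (hV : ContDiff ℝ ∞ V)
    (hF : ContDiffAt ℝ ∞ F (trunc w.1)) (h : (Matrix.of (yCoord w.1)).det ≠ 0) :
    ContDiffAt ℝ ∞ (deDonderExpr F V) w :=
  ContDiffAt.add (ContDiffAt.real_smul ((hF.comp w (contDiff_trunc.comp
    contDiff_fst).contDiffAt).add (contDiffAt_matterLagrangian hV h)) contDiffAt_const)
    (ContDiffAt.sum fun β _ => (contDiffAt_deDonderCurrent hF h β).alternatize (d3x β))

theorem contDiffOn_deDonderExpr {M : Type*} [TopologicalSpace M] [ChartedSpace E4 M]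
    {L : OpenPartialHomeomorph M E4 → JetCoord 2 → ℝ} (hL : IsInvariantLagrangian L)
    {V : ℝ → ℝ} (hV : ContDiff ℝ ∞ V) {e : OpenPartialHomeomorph M E4} (he : e ∈ posAtlas M) :
    ContDiffOn ℝ ∞ (deDonderExpr (L e) V) (coordTarget e) := fun _ hw =>
  (contDiffAt_deDonderExpr hV ((hL.1 e he).contDiffAt
    ((isOpen_lagrangian_domain 2 e.open_target).mem_nhds hw)) hw.2.det_ne_zero).contDiffWithinAt

end Smooth

/-! ### The global form -/

section Global

variable {M : Type*} [TopologicalSpace M] [ChartedSpace E4 M] [HasGroupoid M orientedGroupoid]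
  {L : OpenPartialHomeomorph M E4 → JetCoord 2 → ℝ}

theorem exists_coord_of_mem_atlas {c : OpenPartialHomeomorph (TotalJet M) TotalCoord}
    (hc : c ∈ atlas TotalCoord (TotalJet M)) : ∃ e ∈ posAtlas M,
      c.source = {P | P.base ∈ e.source} ∧ c.target = coordTarget e ∧ ∀ P, c P = P.coord e := by
  obtain ⟨d, ⟨e, he, h1, h2, h3⟩, rfl⟩ := mem_iUnion₂.1 hc
  exact ⟨e, he, h1, h2, h3⟩

theorem exists_mem_atlas_coord {e : OpenPartialHomeomorph M E4} (he : e ∈ posAtlas M)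
    (P : TotalJet M) : ∃ c ∈ atlas TotalCoord (TotalJet M),
      c.source = {P | P.base ∈ e.source} ∧ c.target = coordTarget e ∧ ∀ P, c P = P.coord e := by
  have : Nonempty (TotalJet M) := ⟨P⟩
  have hd : (TotalJet.coord_bijOn he).toPartialEquiv ∈ (totalJetCore M).atlas :=
    ⟨e, he, rfl, rfl, fun _ => rfl⟩
  exact ⟨_, mem_iUnion₂.2 ⟨_, hd, rfl⟩, rfl, rfl, fun _ => rfl⟩

theorem mdifferentiableAt_coord {e : OpenPartialHomeomorph M E4} (he : e ∈ posAtlas M)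
    {P : TotalJet M} (hP : P.base ∈ e.source) :
    MDifferentiableAt 𝓘(ℝ, TotalCoord) 𝓘(ℝ, TotalCoord) (TotalJet.coord e) P := by
  obtain ⟨c, hc, h1, -, h3⟩ := exists_mem_atlas_coord he P
  have h := (mdifferentiable_of_mem_atlas (I := 𝓘(ℝ, TotalCoord)) hc).mdifferentiableAt
    (x := P) (by rw [h1]; exact hP)
  rwa [show (c : TotalJet M → TotalCoord) = TotalJet.coord e from funext h3] at h

/-- The De Donder forms of two coordinate systems agree over the intersection of their domains. -/
theorem deDonderForm_eq (hL : IsInvariantLagrangian L) (V : ℝ → ℝ)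
    {e e' : OpenPartialHomeomorph M E4} (he : e ∈ posAtlas M) (he' : e' ∈ posAtlas M)
    {𝔭 𝔭' : Momenta M} (h : IsMomenta L e 𝔭) (h' : IsMomenta L e' 𝔭') {P : TotalJet M}
    (hP : P.base ∈ e.source) (hP' : P.base ∈ e'.source) :
    deDonderForm L V e 𝔭 P = deDonderForm L V e' 𝔭' P := by
  obtain ⟨c, hc, h1, h2, h3⟩ := exists_mem_atlas_coord he P
  set f : TotalCoord → TotalCoord := fun w => (c.symm w).coord e' with hfd
  have hf : ∀ w (hw : w ∈ coordTarget e), f w = (TotalJet.ofCoord he w hw).coord e' :=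
    fun w hw => congrArg (TotalJet.coord e') (coord_symm he h1 h2 h3 hw)
  have hw : P.coord e ∈ coordTarget e := (TotalJet.coord_bijOn he).mapsTo hP
  have hPc : P ∈ c.source := by rw [h1]; exact hP
  have hinv : ∀ Q ∈ c.source, f (Q.coord e) = Q.coord e' := fun Q hQ => by
    rw [hfd]
    simp only
    rw [← h3, c.left_inv hQ]
  have hw' : e.symm (P.coord e).1.1 ∈ e'.source := by
    have h4 : TotalJet.ofCoord he _ hw = P := by
      rw [← coord_symm he h1 h2 h3 hw]
      exact (congrArg c.symm (h3 P).symm).trans (c.left_inv hPc)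
    have h5 : (TotalJet.ofCoord he _ hw).base ∈ e'.source := by rw [h4]; exact hP'
    exact h5
  have hfw : DifferentiableAt ℝ f (P.coord e) :=
    ((coord_change_contDiffOn he he' hf).contDiffAt
      ((isOpen_coordTarget_inter e e'.open_source).mem_nhds ⟨hw, hw'⟩)).diff
  have hev : TotalJet.coord e' =ᶠ[𝓝 P] f ∘ TotalJet.coord e :=
    Filter.eventuallyEq_of_mem (c.open_source.mem_nhds hPc) fun Q hQ => (hinv Q hQ).symm
  have hmf : mfderiv 𝓘(ℝ, TotalCoord) 𝓘(ℝ, TotalCoord) (TotalJet.coord e') P =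
      (fderiv ℝ f (P.coord e)).comp
        (mfderiv 𝓘(ℝ, TotalCoord) 𝓘(ℝ, TotalCoord) (TotalJet.coord e) P) := by
    rw [hev.mfderiv_eq, mfderiv_comp P hfw.mdifferentiableAt (mdifferentiableAt_coord he hP),
      mfderiv_eq_fderiv]
    rfl
  unfold deDonderForm
  rw [deDonderCoord_eq hL V he h hP, deDonderCoord_eq hL V he' h' hP', hmf,
    ← deDonderExpr_change hL V he he' hf hw hw', hinv P hPc]
  rfl

/-- The chart expression of the De Donder form is `deDonderExpr`. -/
theorem deDonderForm_comp_mfderiv_symm (hL : IsInvariantLagrangian L) (V : ℝ → ℝ)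
    {e : OpenPartialHomeomorph M E4} (he : e ∈ posAtlas M) {𝔭 : Momenta M} (h : IsMomenta L e 𝔭)
    {c : OpenPartialHomeomorph (TotalJet M) TotalCoord} (hc : c ∈ atlas TotalCoord (TotalJet M))
    (h1 : c.source = {P | P.base ∈ e.source}) (h3 : ∀ P, c P = P.coord e) {w : TotalCoord}
    (hw : w ∈ c.target) :
    ((deDonderForm L V e 𝔭 (c.symm w)).compContinuousLinearMap
      (mfderiv 𝓘(ℝ, TotalCoord) 𝓘(ℝ, TotalCoord) c.symm w) : TotalCoord [⋀^Fin 4]→L[ℝ] ℝ) =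
      deDonderExpr (L e) V w := by
  have hP : (c.symm w).base ∈ e.source := by
    have := c.map_target hw
    rwa [h1] at this
  have h4 := (mdifferentiable_of_mem_atlas (I := 𝓘(ℝ, TotalCoord)) hc).comp_symm_deriv hw
  rw [show (c : TotalJet M → TotalCoord) = TotalJet.coord e from funext h3] at h4
  have h5 : (c.symm w).coord e = w := (h3 _).symm.trans (c.right_inv hw)
  have h6 := deDonderCoord_eq hL V he h hP
  rw [h5] at h6
  unfold deDonderForm
  rw [h6]
  ext v
  refine congrArg (deDonderExpr (L e) V w) (funext fun i => ?_)
  exact congrArg (fun T : TotalCoord →L[ℝ] TotalCoord => T (v i)) h4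

end Global

end

theorem proposition6 {M : Type*} [TopologicalSpace M] [ChartedSpace E4 M]
    [HasGroupoid M orientedGroupoid]
    (L : OpenPartialHomeomorph M E4 → JetCoord 2 → ℝ) (hL : IsInvariantLagrangian L)
    (V : ℝ → ℝ) (hV : ContDiff ℝ ∞ V) :
    (∀ e ∈ posAtlas M, ∃ 𝔭 : Momenta M, IsMomenta L e 𝔭) ∧
    (∀ e ∈ posAtlas M, ∀ e' ∈ posAtlas M, ∀ 𝔭 𝔭' : Momenta M, IsMomenta L e 𝔭 →
      IsMomenta L e' 𝔭' → ∀ P : TotalJet M, P.base ∈ e.source → P.base ∈ e'.source →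
      deDonderForm L V e 𝔭 P = deDonderForm L V e' 𝔭' P) ∧
    ∃! Θ : FourForm M, IsSmoothForm Θ ∧ ∀ e ∈ posAtlas M, ∀ 𝔭 : Momenta M, IsMomenta L e 𝔭 →
      ∀ P : TotalJet M, P.base ∈ e.source → Θ P = deDonderForm L V e 𝔭 P := by
  have hm : ∀ P : TotalJet M,
      IsMomenta L (chartAt E4 P.base) (coordMomenta L (chartAt E4 P.base)) := fun P => isMomenta_coordMomenta hL (chartAt_mem_posAtlas P.base)
  refine ⟨fun e he => ⟨_, isMomenta_coordMomenta hL he⟩,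
    fun e he e' he' 𝔭 𝔭' h h' P hP hP' => deDonderForm_eq hL V he he' h h' hP hP',
    fun P => deDonderForm L V (chartAt E4 P.base) (coordMomenta L (chartAt E4 P.base)) P,
    ⟨fun c hc => ?_, fun e he 𝔭 h P hP => deDonderForm_eq hL V (chartAt_mem_posAtlas P.base) he
      (hm P) h (mem_chart_source E4 P.base) hP⟩, fun Θ hΘ => funext fun P =>
      hΘ.2 _ (chartAt_mem_posAtlas P.base) _ (hm P) P (mem_chart_source E4 P.base)⟩
  obtain ⟨e, he, h1, h2, h3⟩ := exists_coord_of_mem_atlas hc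
  rw [h2]
  refine (contDiffOn_deDonderExpr hL hV he).congr fun w hw => ?_
  have hP : (c.symm w).base ∈ e.source := by
    have := c.map_target (h2 ▸ hw)
    rwa [h1] at this
  rw [← deDonderForm_comp_mfderiv_symm hL V he (isMomenta_coordMomenta hL he) hc h1 h3 (h2 ▸ hw),
    deDonderForm_eq hL V he (chartAt_mem_posAtlas _) (isMomenta_coordMomenta hL he) (hm _) hP
      (mem_chart_source E4 _)]
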